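/- Graphs are finite non-empty multigraphs (loops and parallel edges allowed). For $U\subseteq V(G)$ let $\delta_G(U)$ be the set of edges with exactly one end in $U$; $G$ is $k$-edge-connected if $|\delta_G(U)|\ge k$ whenever $\emptyset\ne U\subsetneq V(G)$. A set $F\subseteq E(G)$ is $a$-thin in $G$ if $|F\cap\delta_G(U)|\le a\,|\delta_G(U)|$ for all $U\subseteq V(G)$. Embeddings in orientable surfaces are given, as usual, by rotation systems, i.e. by a cyclic order of the half-edges around each vertex; the genus of the embedding is determined by Euler's formula $|V|-|E|+|F|=2-2g$ for connected graphs, and a connected graph is embeddable on the orientable surface of genus $\gamma$ (the sphere with $\gamma$ handles) if it has a rotation system of genus at most $\gamma$. **Theorem.** There is a function $f:\mathbb{N}\to\mathbb{R}$ with $f(\gamma)=O(\sqrt{\gamma}\,\log\gamma)$ as $\gamma\to\infty$ and $f(0)=10$ such that the following hold. 1. For all integers $\gamma\ge 0$ and $k\ge 1$, every $k$-edge-connected graph that is embeddable on the orientable surface of genus $\gamma$ has a spanning tree that is $\frac{f(\gamma)}{k}$-thin. In particular, every $k$-edge-connected planar graph has a $\frac{10}{k}$-thin spanning tree. 2. Such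 a tree can be found in polynomial time from an embedding: there is a polynomial-time (Turing machine) algorithm whose input is a graph $G$ with a rotation system and whose output is a set of edges of $G$ such that, for all $\gamma\ge 0$ and $k\ge 1$, if $G$ is $k$-edge-connected and the rotation system has genus at most $\gamma$, then the output is the edge set of an $\frac{f(\gamma)}{k}$-thin spanning tree of $G$. 3. (Goddyn's thin-tree conjecture for graphs of bounded orientable genus.) For every $\gamma\ge 0$ there is a function $h_\gamma:\mathbb{R}\to\mathbb{N}$ such that for every $\varepsilon>0$, every $h_\gamma(\varepsilon)$-edge-connected graph embeddable on the orientable surface of genus $\gamma$ has an $\varepsilon$-thin spanning tree. -/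

import Mathlib

open Filter Asymptotics

universe u v

namespace Graph

variable {α : Type u} {β : Type v}

/-! ### Cuts, edge connectivity, spanning trees, thinness

Graphs are multigraphs (loops and parallel edges are allowed): Mathlib's `Graph α β`. -/

/-- The set of edges of `G` in the cut `(U, V(G) \ U)`, for `U ⊆ V(G)`. -/
def cut (G : Graph α β) (U : Set α) : Set β :=
  {e | ∃ x ∈ U, ∃ y ∉ U, G.IsLink e x y}

/-- A (non-null) graph is `k`-edge-connected if each of its cuts with two non-empty sides has at
least `k` edges. -/
def IsEdgeConnected (G : Graph α β) (k : ℕ) : Prop :=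
  G.vertexSet.Nonempty ∧
    ∀ U ⊆ G.vertexSet, U.Nonempty → U ≠ G.vertexSet → k ≤ (G.cut U).ncard

/-- The edge set `T` contains (the edge set of) a cycle of `G`: for some `n ≥ 1` there are `n`
distinct vertices and `n` distinct edges of `T` such that the `i`-th edge joins the `i`-th vertex to
the next one, cyclically. (A loop is a cycle with `n = 1`, two parallel edges form a cycle with
`n = 2`.) -/
def HasCycleIn (G : Graph α β) (T : Set β) : Prop :=
  ∃ n : ℕ, 1 ≤ n ∧ ∃ (x : ZMod n → α) (e : ZMod n → β),
    Function.Injective x ∧ Function.Injective e ∧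
      ∀ i, e i ∈ T ∧ G.IsLink (e i) (x i) (x (i + 1))

/-- `T` is the edge set of a spanning tree of `G`: the spanning subgraph with edge set `T` is
connected and has no cycle. -/
def IsSpanningTree (G : Graph α β) (T : Set β) : Prop :=
  T ⊆ G.edgeSet ∧ G.vertexSet.Nonempty ∧
    (∀ x ∈ G.vertexSet, ∀ y ∈ G.vertexSet,
      Relation.ReflTransGen (fun a b => ∃ e ∈ T, G.IsLink e a b) x y) ∧
    ¬ G.HasCycleIn T

/-- `F` is `a`-thin in `G`: in every cut, `F` has at most an `a`-fraction of the edges of `G`. -/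
def IsThin (G : Graph α β) (a : ℝ) (F : Set β) : Prop :=
  ∀ U ⊆ G.vertexSet, ((F ∩ G.cut U).ncard : ℝ) ≤ a * ((G.cut U).ncard : ℝ)

/-- The number of connected components of `G`. -/
noncomputable def numComponents (G : Graph α β) : ℕ :=
  Nat.card (Quot fun x y : G.vertexSet => G.Adj x y)

/-! ### Embeddings in orientable surfaces -/

/-- A rotation system of `G`, that is, an embedding of `G` in an oriented surface. Each edge `e`
consists of two half-edges `(e, false)` and `(e, true)`, one at each end of `e` (both at the same
vertex if `e` is a loop), and `rot` maps each half-edge to the next one in the clockwise order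
around the vertex at which it starts. Thus the orbits of `rot` correspond to the non-isolated
vertices. -/
structure RotationSystem (G : Graph α β) where
  /-- The vertex at which a half-edge starts. -/
  tail : G.edgeSet × Bool → G.vertexSet
  isLink_tail : ∀ e : G.edgeSet, G.IsLink e (tail (e, false)) (tail (e, true))
  /-- The next half-edge around the vertex. -/
  rot : Equiv.Perm (G.edgeSet × Bool)
  sameCycle_iff : ∀ d d' : G.edgeSet × Bool, rot.SameCycle d d' ↔ tail d = tail d'

namespace RotationSystem

variable {G : Graph α β}

/-- Facial walks: go along a half-edge to its other end, and leave there through the next half-edge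
in the rotation. -/
def facePerm (R : RotationSystem G) : Equiv.Perm (G.edgeSet × Bool) :=
  (Equiv.prodCongr (Equiv.refl G.edgeSet) Equiv.boolNot).trans R.rot

/-- The number of faces: one for each facial walk, and one for each isolated vertex (which is
embedded in a sphere of its own). -/
noncomputable def numFaces (R : RotationSystem G) : ℕ :=
  Nat.card (Quotient (Equiv.Perm.SameCycle.setoid R.facePerm)) +
    {x ∈ G.vertexSet | ∀ e, ¬ G.Inc e x}.ncard

/-- The genus of the embedding is `g`, by Euler's formula `|V| - |E| + |F| = 2 c - 2 g` with `c` the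
number of components of `G` (so `|V| - |E| + |F| = 2 - 2 g` for connected `G`). -/
def HasGenus (R : RotationSystem G) (g : ℕ) : Prop :=
  (G.vertexSet.ncard : ℤ) - G.edgeSet.ncard + R.numFaces = 2 * G.numComponents - 2 * g

/-- The embedding has genus at most `γ`, so that it gives an embedding in the sphere with `γ`
handles (not a cellular one, if its genus is smaller than `γ`). -/
def GenusLE (R : RotationSystem G) (γ : ℕ) : Prop :=
  ∃ g ≤ γ, R.HasGenus g

end RotationSystem

/-- `G` is embeddable in the sphere with `γ` handles. -/
def IsEmbeddable (G : Graph α β) (γ : ℕ) : Prop :=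
  ∃ R : RotationSystem G, R.GenusLE γ

end Graph

/-! ### Embedded graphs as inputs of algorithms -/

/-- A finite graph with vertices `0, …, numVerts - 1` and edges `0, …, numEdges - 1`, embedded in an
oriented surface. -/
structure EmbeddedGraph where
  numVerts : ℕ
  numEdges : ℕ
  graph : Graph (Fin numVerts) (Fin numEdges)
  vertexSet_eq : graph.vertexSet = Set.univ
  edgeSet_eq : graph.edgeSet = Set.univ
  rotation : graph.RotationSystem

namespace EmbeddedGraph

/-- A self-delimiting code of a number. (Unary, which changes the length of the code of a connected
graph only by a polynomial, since all numbers in it are at most twice the number of edges, plus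
one.) -/
def encodeNumber (n : ℕ) : List Bool :=
  List.replicate n true ++ [false]

/-- The half-edge `(i, b)` of `M`. -/
def halfEdge (M : EmbeddedGraph) (i : Fin M.numEdges) (b : Bool) : M.graph.edgeSet × Bool :=
  (⟨i, M.edgeSet_eq ▸ Set.mem_univ i⟩, b)

/-- The entry of the half-edge `(i, b)` in the table that describes the embedding: the number
of the vertex at which it starts, and the number `2 j + c` of the next half-edge `(j, c)` around
that vertex. -/
def encodeHalfEdge (M : EmbeddedGraph) (i : Fin M.numEdges) (b : Bool) : List Bool :=
  encodeNumber ((M.rotation.tail (M.halfEdge i b)).1 : ℕ) ++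
    encodeNumber (2 * ((M.rotation.rot (M.halfEdge i b)).1.1 : ℕ) +
      (M.rotation.rot (M.halfEdge i b)).2.toNat)

/-- The code of an embedded graph as a string of bits: number of vertices, number of edges, and the
table of all half-edges. -/
def encode (M : EmbeddedGraph) : List Bool :=
  encodeNumber M.numVerts ++ encodeNumber M.numEdges ++
    (List.finRange M.numEdges).flatMap fun i =>
      M.encodeHalfEdge i false ++ M.encodeHalfEdge i true

/-- The set of edges of `M` that is selected by a string of bits (the `i`-th bit tells whether the
edge `i` belongs to the set). -/
def selectedEdges (M : EmbeddedGraph) (s : List Bool) : Set (Fin M.numEdges) :=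
  {i | s[(i : ℕ)]? = some true}

end EmbeddedGraph

/-! The tree consists of edges that are contracted one by one, in an embedding whose faces are
inherited from the given one, until a single vertex remains. The choice of these edges makes it
thin.

Loops that bound a face are deleted whenever they exist, so that otherwise every face has length at
least two. Let n be the number of vertices of the contracted graph. Euler's formula leaves at most
6n + 12γ - 12 half-edges in faces that are not digons (`Good.six_mul_numFaces_le`). If this is less
than n(D + 1), then some vertex has at most D such half-edges. At least k half-edges of non-loops
start there, and crossing digons groups them into at most D bundles, so one bundle contains about
k/D parallel edges, and its middle edge has about k/(2D) parallel edges on either side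
(`Good.exists_hasArms`). An edge whose two arms are as long as possible is contracted. The edges in
its arms become loops and can no longer be contracted.

A cut is a union of closed walks in the dual: the half-edges leaving U can be arranged in cycles
such that consecutive ones share a face (`exists_outDarts_perm`). The invariant `Spread` says that a
short dual trail between two edges that are contracted, or may still be, with no contracted edge in
between, uses live edges only. It survives every step (`ArmStep.spread`): a trail of live edges that
starts at an edge with long arms must run along an arm. Hence contracted edges are more than r =
(k-1)/(2D) apart on each dual cycle of a cut, so they make up at most a fraction 1/(r+1) ≤ 2D/k of
it (`Spread.thin`).

In the plane D = 5 works throughout, which gives 10/k. In general let q be the integer part of √γ.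
Then D = 5 + 12q works as long as n ≥ q + 2. At most q edges are contracted after that, and as a
nonempty cut has at least k edges, they add at most a fraction q/k. The sum is (2D + q)/k = (10 +
25q)/k.

Contracting an edge with longest arms requires no knowledge of k or γ, so one algorithm serves all
of them. It is written in a small language with arrays whose only arithmetic is truncated
subtraction. Numbers never exceed a bound that is linear in the input length, so each loop has
linearly many rounds, and compilation to programs on lists, then on stacks of bits, then to a Turing
machine keeps the time polynomial. -/

/-! ### Structured programs on stacks of bits, and their compilation to Turing machines -/

/-- Structured programs that act on a family of stacks of bits. -/
inductive StackProg (K : Type) : Type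
  | push (k : K) (b : Bool)
  | pop (k : K)
  | skip
  | seq (p q : StackProg K)
  | cond (k : K) (c : Option Bool → Bool) (p q : StackProg K)
  | loop (k : K) (c : Option Bool → Bool) (p : StackProg K)

namespace StackProg

variable {K : Type}

/-- The program points of a program. -/
def Label : StackProg K → Type
  | push _ _ => Unit
  | pop _ => Unit
  | skip => Unit
  | seq p q => Label p ⊕ Label q
  | cond _ _ p q => Option (Label p ⊕ Label q)
  | loop _ _ p => Option (Label p)

theorem finite_label (p : StackProg K) : Finite (Label p) := by
  induction p with
  | push | pop | skip => exact inferInstanceAs (Finite Unit)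
  | seq p q hp hq => exact inferInstanceAs (Finite (Label p ⊕ Label q))
  | cond k c p q hp hq => exact inferInstanceAs (Finite (Option (Label p ⊕ Label q)))
  | loop k c p hp => exact inferInstanceAs (Finite (Option (Label p)))

/-- The program point at which the execution starts. -/
def entry : (p : StackProg K) → Label p
  | push _ _ => ()
  | pop _ => ()
  | skip => ()
  | seq p _ => Sum.inl (entry p)
  | cond _ _ _ _ => none
  | loop _ _ _ => none

/-- The statements of a Turing machine (with the last symbol seen as its internal state) that runs
the program `p` and then jumps to the label `e`. -/
def compile {L : Type} : (p : StackProg K) → (Label p → L) → L → Label p →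
    Turing.TM2.Stmt (fun _ : K => Bool) L (Option Bool)
  | push k b, _, e => fun _ => .push k (fun _ => b) (.goto fun _ => e)
  | pop k, _, e => fun _ => .pop k (fun _ o => o) (.goto fun _ => e)
  | skip, _, e => fun _ => .goto fun _ => e
  | seq p q, ι, e => Sum.elim (compile p (fun l => ι (Sum.inl l)) (ι (Sum.inr (entry q))))
      (compile q (fun l => ι (Sum.inr l)) e)
  | cond k c p q, ι, e => fun l => match l with
    | none => .peek k (fun _ o => o) (.branch c (.goto fun _ => ι (some (Sum.inl (entry p))))
        (.goto fun _ => ι (some (Sum.inr (entry q)))))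
    | some (Sum.inl l) => compile p (fun l => ι (some (Sum.inl l))) e l
    | some (Sum.inr l) => compile q (fun l => ι (some (Sum.inr l))) e l
  | loop k c p, ι, e => fun l => match l with
    | none => .peek k (fun _ o => o) (.branch c (.goto fun _ => ι (some (entry p)))
        (.goto fun _ => e))
    | some l => compile p (fun l => ι (some l)) (ι none) l

variable [DecidableEq K]

open Function (update)

/-- Big-step semantics: `Exec p S S' t` means that `p` transforms `S` to `S'` in `t` steps. -/
inductive Exec : StackProg K → (K → List Bool) → (K → List Bool) → ℕ → Prop
  | push (k b S) : Exec (push k b) S (update S k (b :: S k)) 1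
  | pop (k S) : Exec (pop k) S (update S k (S k).tail) 1
  | skip (S) : Exec skip S S 1
  | seq {p q S S' S'' t t'} : Exec p S S' t → Exec q S' S'' t' → Exec (seq p q) S S'' (t + t')
  | cond_true {k c p q S S' t} : c (S k).head? = true → Exec p S S' t →
      Exec (cond k c p q) S S' (t + 1)
  | cond_false {k c p q S S' t} : c (S k).head? = false → Exec q S S' t →
      Exec (cond k c p q) S S' (t + 1)
  | loop_false {k c p S} : c (S k).head? = false → Exec (loop k c p) S S 1
  | loop_true {k c p S S' S'' t t'} : c (S k).head? = true → Exec p S S' t →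
      Exec (loop k c p) S' S'' t' → Exec (loop k c p) S S'' (t + t' + 1)

/-- `n` steps of a machine. -/
def Steps {L : Type} (m : L → Turing.TM2.Stmt (fun _ : K => Bool) L (Option Bool)) (n : ℕ)
    (a b : Turing.TM2.Cfg (fun _ : K => Bool) L (Option Bool)) : Prop :=
  (flip Bind.bind (Turing.TM2.step m))^[n] (some a) = some b

theorem Steps.trans {L : Type} {m : L → Turing.TM2.Stmt (fun _ : K => Bool) L (Option Bool)}
    {n n' a b c} (h : Steps m n a b) (h' : Steps m n' b c) : Steps m (n + n') a c := by
  unfold Steps at *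
  rw [add_comm, Function.iterate_add_apply, h, h']

theorem Steps.single {L : Type} {m : L → Turing.TM2.Stmt (fun _ : K => Bool) L (Option Bool)}
    {a b} (h : Turing.TM2.step m a = some b) : Steps m 1 a b := h

theorem step_eq {L : Type} {m : L → Turing.TM2.Stmt (fun _ : K => Bool) L (Option Bool)}
    {p : StackProg K} {ι : Label p → L} {e : L} (hm : ∀ l, m (ι l) = compile p ι e l) {l v S b}
    (h : Turing.TM2.stepAux (compile p ι e l) v S = b) :
    Turing.TM2.step m ⟨some (ι l), v, S⟩ = some b := by
  rw [Turing.TM2.step, hm, h]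

/-- The placement `ι` of the program points and the exit label `e` are arbitrary, so that the
induction can embed a subprogram in a larger machine. The internal state `v` is arbitrary because
every test first reads the top of its stack again. -/
theorem Exec.steps {L : Type} {m : L → Turing.TM2.Stmt (fun _ : K => Bool) L (Option Bool)}
    {p : StackProg K} {S S' t} (h : Exec p S S' t) :
    ∀ (ι : Label p → L) (e : L), (∀ l, m (ι l) = compile p ι e l) → ∀ v, ∃ v',
      Steps m t ⟨some (ι (entry p)), v, S⟩ ⟨some e, v', S'⟩ := by
  induction h with
  | push k b S =>
    intro ι e hm v
    exact ⟨v, .single (step_eq hm rfl)⟩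
  | pop k S =>
    intro ι e hm v
    exact ⟨_, .single (step_eq hm rfl)⟩
  | skip S =>
    intro ι e hm v
    exact ⟨v, .single (step_eq hm rfl)⟩
  | seq h1 h2 ih1 ih2 =>
    intro ι e hm v
    obtain ⟨v1, hv1⟩ := ih1 (fun l => ι (Sum.inl l)) (ι (Sum.inr (entry _)))
      (fun l => hm (Sum.inl l)) v
    obtain ⟨v2, hv2⟩ := ih2 (fun l => ι (Sum.inr l)) e (fun l => hm (Sum.inr l)) v1
    exact ⟨v2, hv1.trans hv2⟩
  | @cond_true k c p q S S' t hc h ih =>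
    intro ι e hm v
    obtain ⟨v1, hv1⟩ := ih (fun l => ι (some (Sum.inl l))) e (fun l => hm (some (Sum.inl l)))
      (S k).head?
    refine ⟨v1, ?_⟩
    rw [add_comm]
    refine Steps.trans (.single (step_eq hm ?_)) hv1
    simp [compile, entry, hc]
  | @cond_false k c p q S S' t hc h ih =>
    intro ι e hm v
    obtain ⟨v1, hv1⟩ := ih (fun l => ι (some (Sum.inr l))) e (fun l => hm (some (Sum.inr l)))
      (S k).head?
    refine ⟨v1, ?_⟩
    rw [add_comm]
    refine Steps.trans (.single (step_eq hm ?_)) hv1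
    simp [compile, entry, hc]
  | @loop_false k c p S hc =>
    intro ι e hm v
    refine ⟨(S k).head?, .single (step_eq hm ?_)⟩
    simp [compile, entry, hc]
  | @loop_true k c p S S' S'' t t' hc h h' ih ih' =>
    intro ι e hm v
    obtain ⟨v1, hv1⟩ := ih (fun l => ι (some l)) (ι none) (fun l => hm (some l)) (S k).head?
    obtain ⟨v2, hv2⟩ := ih' ι e hm v1
    refine ⟨v2, ?_⟩
    rw [add_comm]
    refine Steps.trans (.single (step_eq hm ?_)) (hv1.trans hv2)
    simp [compile, entry, hc]

/-- One step pushes at most one bit. This bounds the contents that have to be cleared after the run.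
-/
theorem Exec.sum_length_le [Fintype K] {p : StackProg K} {S S' t} (h : Exec p S S' t) :
    ∑ k, (S' k).length ≤ ∑ k, (S k).length + t := by
  induction h with
  | push k b S =>
    rw [← Finset.add_sum_erase _ _ (Finset.mem_univ k),
      ← Finset.add_sum_erase _ (fun k => (S k).length) (Finset.mem_univ k)]
    have : ∀ x ∈ Finset.univ.erase k, (update S k (b :: S k) x).length = (S x).length := by
      intro x hx
      rw [Function.update_of_ne (Finset.ne_of_mem_erase hx)]
    rw [Finset.sum_congr rfl this, Function.update_self, List.length_cons]
    omega
  | pop k S =>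
    refine le_trans (Finset.sum_le_sum fun x _ => ?_) (Nat.le_add_right _ _)
    by_cases hx : x = k
    · subst hx; simp
    · simp [hx]
  | _ => omega

/-- The program that empties the stack `k`. -/
def clear (k : K) : StackProg K := loop k Option.isSome (pop k)

theorem exec_clear (k : K) (S : K → List Bool) :
    Exec (clear k) S (update S k []) (2 * (S k).length + 1) := by
  generalize h : S k = l
  induction l generalizing S with
  | nil =>
    have : update S k [] = S := by rw [← h, Function.update_eq_self]
    rw [this]
    exact .loop_false (by simp [h])
  | cons b l ih =>
    have := ih (update S k l) (by simp)
    rw [Function.update_idem] at this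
    have h2 : Exec (pop k) S (update S k l) 1 := by simpa [h] using Exec.pop k S
    convert Exec.loop_true (by simp [h]) h2 this using 1
    · rfl
    · rw [List.length_cons]; omega

/-- The program that empties the stacks in a list. -/
def clearAll : List K → StackProg K
  | [] => skip
  | k :: l => seq (clear k) (clearAll l)

theorem exec_clearAll [Fintype K] (l : List K) (S : K → List Bool) :
    ∃ t, t ≤ l.length * (2 * (∑ k, (S k).length) + 1) + 1 ∧
      Exec (clearAll l) S (fun k => if k ∈ l then [] else S k) t := by
  induction l generalizing S with
  | nil => exact ⟨1, by simp, by simpa using! Exec.skip S⟩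
  | cons k l ih =>
    obtain ⟨t, ht, h⟩ := ih (update S k [])
    have h' : (fun x => if x ∈ l then [] else update S k [] x) =
        fun x => if x ∈ k :: l then [] else S x := by
      funext x
      by_cases hx : x = k
      · subst hx; simp
      · simp [hx]
    rw [h'] at h
    refine ⟨_, ?_, (exec_clear k S).seq h⟩
    have h1 : ∑ x, (update S k [] x).length ≤ ∑ x, (S x).length := by
      refine Finset.sum_le_sum fun x _ => ?_
      by_cases hx : x = k
      · subst hx; simp
      · simp [hx]
    have h2 : (S k).length ≤ ∑ x, (S x).length :=
      Finset.single_le_sum (f := fun x => (S x).length) (fun _ _ => Nat.zero_le _)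
        (Finset.mem_univ k)
    have h3 := Nat.mul_le_mul_left l.length (Nat.add_le_add_right (Nat.mul_le_mul_left 2 h1) 1)
    simp only [List.length_cons, Nat.add_mul]
    omega

/-- The Turing machine that runs `p`. -/
noncomputable def machine [Fintype K] (p : StackProg K) (k₀ k₁ : K) : Turing.FinTM2 :=
  have := finite_label p
  have : Fintype (Label p) := Fintype.ofFinite _
  { K := K, k₀ := k₀, k₁ := k₁, Γ := fun _ => Bool, Λ := Option (Label p),
    main := some (entry p), σ := Option Bool, initialState := none,
    m := fun o => match o with
      | none => .load (fun _ => none) .halt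
      | some l => compile p some none l }

theorem initList_machine [Fintype K] (p : StackProg K) (k₀ k₁ : K) (s : List Bool) :
    Turing.initList (machine p k₀ k₁) s =
      ⟨some (some (entry p)), none, update (fun _ => []) k₀ s⟩ := by
  refine (Turing.TM2.Cfg.mk.injEq ..).mpr ⟨rfl, rfl, funext fun k : K => ?_⟩
  by_cases hk : k = k₀
  · cases hk
    exact (dif_pos rfl).trans (Function.update_self (f := fun _ : K => ([] : List Bool)) k₀ s).symm
  · refine (dif_neg hk).trans ?_
    change ([] : List Bool) = @update K (fun _ => List Bool) _ (fun _ => []) k₀ s k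
    rw [Function.update_of_ne hk]

theorem haltList_machine [Fintype K] (p : StackProg K) (k₀ k₁ : K) (s : List Bool) :
    Turing.haltList (machine p k₀ k₁) s = ⟨none, none, update (fun _ => []) k₁ s⟩ := by
  refine (Turing.TM2.Cfg.mk.injEq ..).mpr ⟨rfl, rfl, funext fun k : K => ?_⟩
  by_cases hk : k = k₁
  · cases hk
    exact (dif_pos rfl).trans (Function.update_self (f := fun _ : K => ([] : List Bool)) k₁ s).symm
  · refine (dif_neg hk).trans ?_
    change ([] : List Bool) = @update K (fun _ => List Bool) _ (fun _ => []) k₁ s k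
    rw [Function.update_of_ne hk]

/-- A stack program with polynomially bounded running time that leaves its output on the stack
`k₁` yields a polynomial time Turing machine. -/
theorem nonempty_computableInPolyTime [Fintype K] {α : Type} (ea : α → List Bool)
    (f : α → List Bool) (k₀ k₁ : K) (p : StackProg K) (time : Polynomial ℕ)
    (h : ∀ a, ∃ S t, t ≤ time.eval (ea a).length ∧
      Exec p (update (fun _ => []) k₀ (ea a)) S t ∧ S k₁ = f a) :
    Nonempty (Turing.TM2ComputableInPolyTime ea id f) := by
  -- A halting configuration must have empty stacks apart from the output stack, hence the appended
  -- `clearAll`. Its cost is linear in the total contents, which are at most the input length plus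
  -- the running time.
  set l : List K := (Finset.univ.erase k₁).toList with hl
  refine ⟨{ tm := machine (seq p (clearAll l)) k₀ k₁, inputAlphabet := Equiv.refl Bool,
            outputAlphabet := Equiv.refl Bool,
            time := time + (Polynomial.C l.length *
              (2 * (Polynomial.X + time) + 1) + 1) + 1,
            outputsFun := fun a => ?_ }⟩
  apply Classical.choice
  obtain ⟨S, t, ht, he, hS⟩ := h a
  obtain ⟨t', ht', he'⟩ := exec_clearAll l S
  have hlS : (fun k => if k ∈ l then [] else S k) = update (fun _ => []) k₁ (f a) := by
    funext k
    by_cases hk : k = k₁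
    · subst hk; simp [hl, hS]
    · simp [hl, hk]
  rw [hlS] at he'
  obtain ⟨v, hv⟩ := (he.seq he').steps (m := (machine (seq p (clearAll l)) k₀ k₁).m) some none
    (fun _ => rfl) none
  -- One extra step at the label `none` resets the internal state and halts.
  have hall := hv.trans (.single (b := ⟨none, none, update (fun _ => []) k₁ (f a)⟩)
    (by simp [machine]))
  refine ⟨⟨⟨t + t' + 1, ?_⟩, ?_⟩⟩
  · have hi (s : List Bool) : s.map (Equiv.refl Bool).invFun = s := by simp [Equiv.refl]
    rw [Option.map_some]
    erw [hi, hi, initList_machine, haltList_machine]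
    exact hall
  · have hs := he.sum_length_le
    have hs0 : ∑ k, (update (fun _ => []) k₀ (ea a) k).length = (ea a).length := by
      rw [Finset.sum_eq_single k₀]
      · simp
      · intro b _ hb; simp [hb]
      · simp
    have h3 : l.length * (2 * (∑ k, (S k).length) + 1) ≤
        l.length * (2 * ((ea a).length + time.eval (ea a).length) + 1) := by
      apply Nat.mul_le_mul_left; omega
    simp only [Polynomial.eval_add, Polynomial.eval_mul, Polynomial.eval_C, Polynomial.eval_one,
      Polynomial.eval_X, Polynomial.eval_ofNat]
    change t + t' + 1 ≤ _
    omega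

end StackProg

/-! ### Unary numbers on stacks -/

namespace StackProg

variable {K : Type} [DecidableEq K]

open Function (update)

theorem Exec.cast {p : StackProg K} {S S₁ S' t₁ t} (h : Exec p S S₁ t₁) (hS : S' = S₁)
    (ht : t = t₁) : Exec p S S' t := by
  rwa [hS, ht]

/-- Push `true` on each stack of a list. -/
def pushAll : List K → StackProg K
  | [] => skip
  | k :: l => seq (push k true) (pushAll l)

theorem exec_pushAll (l : List K) (hl : l.Nodup) (S : K → List Bool) :
    Exec (pushAll l) S (fun x => if x ∈ l then true :: S x else S x) (l.length + 1) := by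
  induction l generalizing S with
  | nil => simpa using! Exec.skip S
  | cons k l ih =>
    rw [List.nodup_cons] at hl
    have h := (Exec.push k true S).seq (ih hl.2 _)
    refine h.cast ?_ ?_
    · funext x
      by_cases hx : x = k
      · subst hx; simp [hl.1]
      · simp [hx]
    · rw [List.length_cons]; omega

/-- Move a unary number from the stack `k` to all stacks in a list. -/
def transfer (k : K) (l : List K) : StackProg K :=
  loop k (· == some true) (seq (pop k) (pushAll l))

theorem exec_transfer (k : K) (l : List K) (hl : l.Nodup) (hk : k ∉ l) (n : ℕ) (r : List Bool)
    (hr : r.head? ≠ some true) (S : K → List Bool) (hS : S k = List.replicate n true ++ r) :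
    Exec (transfer k l) S
      (fun x => if x = k then r else if x ∈ l then List.replicate n true ++ S x else S x)
      (n * (l.length + 3) + 1) := by
  induction n generalizing S with
  | zero =>
    have : (fun x => if x = k then r else if x ∈ l then List.replicate 0 true ++ S x else S x)
        = S := by
      funext x
      by_cases hx : x = k
      · subst hx; simpa using hS.symm
      · simp [hx]
    rw [this, Nat.zero_mul]
    exact .loop_false (by simpa [hS] using hr)
  | succ n ih =>
    have h1 := (Exec.pop k S).seq (exec_pushAll l hl _)
    have h2 := ih (fun x => if x ∈ l then
      true :: update S k (S k).tail x else update S k (S k).tail x)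
        (by simp [hk, hS, List.replicate_succ])
    have h3 := Exec.loop_true (by simp [hS, List.replicate_succ]) h1 h2
    refine h3.cast ?_ ?_
    · funext x
      by_cases hx : x = k
      · simp [hx]
      · simp only [hx, if_false]
        by_cases hxl : x ∈ l
        · simp [hxl, hx, List.replicate_succ']
        · simp [hxl, hx]
    · ring

/-- Push the unary number on the stack `x` on the stack `k`, using the auxiliary stack `t`. -/
def pushNumber (t k x : K) : StackProg K :=
  seq (transfer x [t]) (seq (push k false) (transfer t [x, k]))

theorem exec_pushNumber {t k x : K} (htk : t ≠ k) (htx : t ≠ x) (hkx : k ≠ x) (n : ℕ)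
    (S : K → List Bool) (ht : S t = []) (hx : S x = List.replicate n true) :
    Exec (pushNumber t k x) S (update S k (EmbeddedGraph.encodeNumber n ++ S k))
      (9 * n + 3) := by
  have h1 := exec_transfer x [t] (by simp) (by simpa using htx.symm) n [] (by simp) S
    (by simpa using hx)
  have h2 := Exec.push k false
    (fun y => if y = x then [] else if y ∈ [t] then List.replicate n true ++ S y else S y)
  have h3 := exec_transfer t [x, k] (by simpa using hkx.symm) (by simp [htk, htx]) n [] (by simp) _
    (by simp [htk, htx, ht] : update (fun y => if y = x then [] else if y ∈ [t] then
      List.replicate n true ++ S y else S y) k (false :: (fun y => if y = x then [] else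
      if y ∈ [t] then List.replicate n true ++ S y else S y) k) t = List.replicate n true ++ [])
  refine (h1.seq (h2.seq h3)).cast ?_ ?_
  · funext y
    by_cases hyt : y = t
    · subst hyt; simp [htk, ht]
    by_cases hyk : y = k
    · subst hyk; simp [hyt, hkx, EmbeddedGraph.encodeNumber]
    by_cases hyx : y = x
    · subst hyx; simp [hyk, hyt, hx]
    simp [hyk, hyt, hyx]
  · simp only [List.length_cons, List.length_nil]; ring

/-- Pop a number from the stack `k` and store it on the stack `x`. -/
def popNumber (x k : K) : StackProg K :=
  seq (clear x) (seq (transfer k [x]) (pop k))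

/-- The remainder `r` normally starts with the delimiter `false`, which the last `pop` removes. The
case `r = []` is included, so that an empty stack yields the number 0. -/
theorem exec_popNumber {x k : K} (hkx : k ≠ x) (n : ℕ) (r : List Bool) (S : K → List Bool)
    (hr : r.head? ≠ some true) (hk : S k = List.replicate n true ++ r) :
    Exec (popNumber x k) S (update (update S x (List.replicate n true)) k r.tail)
      (2 * (S x).length + 4 * n + 3) := by
  have h1 := exec_clear x S
  have h2 := exec_transfer k [x] (by simp) (by simpa using hkx) n r hr (update S x [])
    (by simp [hkx, hk])
  refine (h1.seq (h2.seq (Exec.pop k _))).cast ?_ ?_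
  · funext y
    by_cases hyk : y = k
    · subst hyk; simp
    by_cases hyx : y = x
    · subst hyx; simp [hyk]
    simp [hyk, hyx]
  · simp only [List.length_cons, List.length_nil]; ring

/-- Copy the unary number on the stack `y` to the stack `x`, using the auxiliary stack `t`. -/
def copyNumber (t x y : K) : StackProg K :=
  seq (clear x) (seq (transfer y [t]) (transfer t [x, y]))

theorem exec_copyNumber {t x y : K} (htx : t ≠ x) (hty : t ≠ y) (hxy : x ≠ y) (n : ℕ)
    (S : K → List Bool) (ht : S t = []) (hy : S y = List.replicate n true) :
    Exec (copyNumber t x y) S (update S x (List.replicate n true))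
      (2 * (S x).length + 9 * n + 3) := by
  have h1 := exec_clear x S
  have h2 := exec_transfer y [t] (by simp) (by simpa using hty.symm) n [] (by simp)
    (update S x []) (by simp [hxy.symm, hy])
  have h3 := exec_transfer t [x, y] (by simpa using hxy) (by simp [htx, hty]) n [] (by simp)
    (fun z => if z = y then [] else if z ∈ [t] then
      List.replicate n true ++ update S x [] z else update S x [] z) (by simp [htx, hty, ht])
  refine (h1.seq (h2.seq h3)).cast ?_ ?_
  · funext z
    by_cases hzt : z = t
    · subst hzt; simp [htx, ht]
    by_cases hzx : z = x
    · subst hzx; simp [hzt, hxy]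
    by_cases hzy : z = y
    · subst hzy; simp [hzx, hzt, hy]
    simp [hzt, hzx, hzy]
  · simp only [List.length_cons, List.length_nil]; ring

end StackProg

/-! ### Programs on numbers and lists of numbers -/

/-- `countdown f n a` applies `f (n - 1)`, …, `f 0` to `a`, in this order. -/
def countdown {α : Type*} (f : ℕ → α → α) : ℕ → α → α
  | 0, a => a
  | n + 1, a => countdown f n (f n a)

/-- Programs that act on numbers (with names in `V`) and lists of numbers (with names in `W`), and
emit bits. There is no instruction that yields a number larger than those that are present, which
makes the running time polynomial. -/
inductive NumProg (V W : Type) : Type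
  | copy (x y : V)
  | dec (x : V)
  | push (A : W) (x : V)
  | pop (x : V) (A : W)
  | emit (b : Bool)
  | skip
  | ifz (x : V) (p q : NumProg V W)
  | loop (c : V) (p : NumProg V W)
  | seq (p q : NumProg V W)

/-- The memory of a program. -/
@[ext]
structure NumState (V W : Type) where
  num : V → ℕ
  lst : W → List ℕ
  out : List Bool

namespace NumState

variable {V W : Type} [DecidableEq V] [DecidableEq W]

/-- Assign a value to a number variable. -/
def setNum (s : NumState V W) (x : V) (v : ℕ) : NumState V W :=
  { s with num := Function.update s.num x v }

/-- Assign a value to a list variable. -/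
def setLst (s : NumState V W) (A : W) (l : List ℕ) : NumState V W :=
  { s with lst := Function.update s.lst A l }

/-- All numbers in the memory are at most `N`. -/
def Bounded (s : NumState V W) (N : ℕ) : Prop :=
  (∀ x, s.num x ≤ N) ∧ ∀ A, ∀ v ∈ s.lst A, v ≤ N

omit [DecidableEq W] in
theorem Bounded.setNum {s : NumState V W} {N : ℕ} (h : s.Bounded N) {x : V} {v : ℕ} (hv : v ≤ N) :
    (s.setNum x v).Bounded N := by
  refine ⟨fun y => ?_, h.2⟩
  by_cases hy : y = x
  · subst hy; simpa [NumState.setNum] using hv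
  · simpa [NumState.setNum, hy] using h.1 y

omit [DecidableEq V] in
theorem Bounded.setLst {s : NumState V W} {N : ℕ} (h : s.Bounded N) {A : W} {l : List ℕ}
    (hl : ∀ v ∈ l, v ≤ N) : (s.setLst A l).Bounded N := by
  refine ⟨h.1, fun B => ?_⟩
  by_cases hB : B = A
  · subst hB; simpa [NumState.setLst] using hl
  · simpa [NumState.setLst, hB] using h.2 B

end NumState

/-! ### Compilation of programs on numbers and lists, with a polynomial time bound -/

namespace NumProg

variable {V W : Type} [DecidableEq V] [DecidableEq W]

/-- The semantics of programs. -/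
def eval : NumProg V W → NumState V W → NumState V W
  | copy x y, s => s.setNum x (s.num y)
  | dec x, s => s.setNum x (s.num x - 1)
  | push A x, s => s.setLst A (s.num x :: s.lst A)
  | pop x A, s => (s.setNum x (s.lst A).headI).setLst A (s.lst A).tail
  | emit b, s => { s with out := b :: s.out }
  | skip, s => s
  | ifz x p q, s => if s.num x = 0 then eval p s else eval q s
  | loop c p, s => countdown (fun i s => (eval p (s.setNum c i)).setNum c i) (s.num c) s
  | seq p q, s => eval q (eval p s)

/-- Instructions copy or decrease numbers, and a loop only assigns smaller values to its counter.
This is what keeps the number of rounds of nested loops polynomial. -/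
theorem bounded_eval (p : NumProg V W) {s : NumState V W} {N : ℕ} (h : s.Bounded N) :
    (eval p s).Bounded N := by
  induction p generalizing s with
  | copy x y => exact h.setNum (h.1 y)
  | dec x => exact h.setNum ((Nat.sub_le _ _).trans (h.1 x))
  | push A x =>
    refine h.setLst fun v hv => ?_
    rcases List.mem_cons.1 hv with rfl | hv
    exacts [h.1 x, h.2 A v hv]
  | pop x A =>
    refine (h.setNum ?_).setLst fun v hv => h.2 A v (List.mem_of_mem_tail hv)
    rcases hA : s.lst A with _ | ⟨v, l⟩
    · exact Nat.zero_le _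
    · exact h.2 A v (by simp [hA])
  | emit b => exact h
  | skip => exact h
  | ifz x p q hp hq =>
    unfold eval
    split_ifs
    exacts [hp h, hq h]
  | loop c p hp =>
    unfold eval
    have hc := h.1 c
    generalize s.num c = n at hc ⊢
    induction n generalizing s with
    | zero => exact h
    | succ n ih =>
      exact ih ((hp (h.setNum (by omega))).setNum (by omega)) (by omega)
  | seq p q hp hq => exact hq (hp h)

/-- The stacks used by the implementation of a program: one for each variable, and three more, with
auxiliary data (`0` and `1`) and the output (`2`). -/
abbrev Stack (V W : Type) : Type := V ⊕ W ⊕ Fin 3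

/-- The implementation of a program. -/
def compile : NumProg V W → StackProg (Stack V W)
  | copy x y => if x = y then .skip else .copyNumber (.inr (.inr 0)) (.inl x) (.inl y)
  | dec x => .pop (.inl x)
  | push A x => .pushNumber (.inr (.inr 0)) (.inr (.inl A)) (.inl x)
  | pop x A => .popNumber (.inl x) (.inr (.inl A))
  | emit b => .push (.inr (.inr 2)) b
  | skip => .skip
  | ifz x p q => .cond (.inl x) Option.isSome (compile q) (compile p)
  | loop c p => .loop (.inl c) Option.isSome
      (.seq (.pop (.inl c)) (.seq (.pushNumber (.inr (.inr 0)) (.inr (.inr 1)) (.inl c))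
        (.seq (compile p) (.popNumber (.inl c) (.inr (.inr 1))))))
  | seq p q => .seq (compile p) (compile q)

/-- The contents of the stacks for a given memory; the auxiliary stack `1` contains `h`. -/
def toStacks (s : NumState V W) (h : List Bool) : Stack V W → List Bool
  | .inl x => List.replicate (s.num x) true
  | .inr (.inl A) => (s.lst A).flatMap EmbeddedGraph.encodeNumber
  | .inr (.inr 0) => []
  | .inr (.inr 1) => h
  | .inr (.inr 2) => s.out

theorem toStacks_setNum (s : NumState V W) (h : List Bool) (x : V) (v : ℕ) :
    toStacks (s.setNum x v) h = Function.update (toStacks s h) (.inl x) (List.replicate v true) := by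
  funext k
  rcases k with y | B | i
  · by_cases hy : y = x
    · subst hy; simp [toStacks, NumState.setNum]
    · simp [toStacks, NumState.setNum, hy]
  · simp [toStacks, NumState.setNum]
  · fin_cases i <;> simp [toStacks, NumState.setNum]

theorem toStacks_setLst (s : NumState V W) (h : List Bool) (A : W) (l : List ℕ) :
    toStacks (s.setLst A l) h =
      Function.update (toStacks s h) (.inr (.inl A)) (l.flatMap EmbeddedGraph.encodeNumber) := by
  funext k
  rcases k with y | B | i
  · simp [toStacks, NumState.setLst]
  · by_cases hy : B = A
    · subst hy; simp [toStacks, NumState.setLst]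
    · simp [toStacks, NumState.setLst, hy]
  · fin_cases i <;> simp [toStacks, NumState.setLst]

theorem toStacks_aux (s : NumState V W) (h h' : List Bool) :
    toStacks s h' = Function.update (toStacks s h) (.inr (.inr 1)) h' := by
  funext k
  rcases k with y | B | i
  · simp [toStacks]
  · simp [toStacks]
  · fin_cases i <;> simp [toStacks]

/-- A bound on the running time, in terms of a bound on the numbers in the memory. -/
noncomputable def time : NumProg V W → Polynomial ℕ
  | ifz _ p q => time p + time q + 1
  | loop _ p => Polynomial.X * (20 * Polynomial.X + 20 + time p) + 1
  | seq p q => time p + time q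
  | _ => 20 * Polynomial.X + 20

open StackProg (Exec)

/-- The contents `h` of the second auxiliary stack are arbitrary, since they hold the saved counters
of the enclosing loops. By `bounded_eval` the bound `N` persists through the run, so every loop has
at most `N` rounds. -/
theorem exec_compile (p : NumProg V W) {s : NumState V W} {N : ℕ} (hs : s.Bounded N)
    (h : List Bool) :
    ∃ t ≤ (time p).eval N, Exec (compile p) (toStacks s h) (toStacks (eval p s) h) t := by
  induction p generalizing s h with
  | copy x y =>
    have hx := hs.1 x
    have hy := hs.1 y
    by_cases hxy : x = y
    · subst hxy
      refine ⟨1, by simp [time], ?_⟩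
      have hx : List.replicate (s.num x) true = toStacks s h (.inl x) := rfl
      rw [compile, if_pos rfl, eval, toStacks_setNum, hx, Function.update_eq_self]
      exact Exec.skip _
    · have h' := StackProg.exec_copyNumber (t := .inr (.inr 0)) (x := .inl x) (y := .inl y) (by simp)
        (by simp) (by simpa using hxy) (s.num y) (toStacks s h) rfl rfl
      rw [← toStacks_setNum] at h'
      refine ⟨_, ?_, by rw [compile, if_neg hxy, eval]; exact h'⟩
      simp [time, toStacks]; omega
  | dec x =>
    refine ⟨1, by simp [time], ?_⟩
    rw [compile, eval, toStacks_setNum]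
    simpa [toStacks] using Exec.pop (Sum.inl x) (toStacks s h)
  | push A x =>
    have hx := hs.1 x
    have h' := StackProg.exec_pushNumber (t := .inr (.inr 0)) (k := .inr (.inl A)) (x := .inl x)
      (by simp) (by simp) (by simp) (s.num x) (toStacks s h) rfl rfl
    refine ⟨_, ?_, by rw [compile, eval, toStacks_setLst, List.flatMap_cons]; exact h'⟩
    simp [time]; omega
  | pop x A =>
    have hx := hs.1 x
    have hA := hs.2 A
    rcases hl : s.lst A with _ | ⟨v, l⟩
    -- Popping from an empty list gives 0, in agreement with `List.headI`.
    · have h' := StackProg.exec_popNumber (x := .inl x) (k := .inr (.inl A)) (by simp) 0 []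
        (toStacks s h) (by simp) (by simp [toStacks, hl])
      refine ⟨_, ?_, by rw [compile, eval, toStacks_setLst, toStacks_setNum, hl]; exact h'⟩
      simp [time, toStacks]; omega
    · have hv := hA v (by simp [hl])
      have h' := StackProg.exec_popNumber (x := .inl x) (k := .inr (.inl A)) (by simp) v
        (false :: l.flatMap EmbeddedGraph.encodeNumber) (toStacks s h) (by simp)
        (by simp [toStacks, hl, EmbeddedGraph.encodeNumber])
      refine ⟨_, ?_, by rw [compile, eval, toStacks_setLst, toStacks_setNum, hl]; exact h'⟩
      simp [time, toStacks]; omega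
  | emit b =>
    refine ⟨1, by simp [time], ?_⟩
    rw [compile, eval]
    refine (Exec.push _ _ _).cast (funext fun k => ?_) rfl
    rcases k with y | B | i
    · simp [toStacks]
    · simp [toStacks]
    · fin_cases i <;> simp [toStacks]
  | skip => exact ⟨1, by simp [time], Exec.skip _⟩
  | ifz x p q hp hq =>
    by_cases hx : s.num x = 0
    · obtain ⟨t, ht, h⟩ := hp hs h
      refine ⟨t + 1, by simp [time]; omega, ?_⟩
      rw [compile, eval, if_pos hx]
      exact .cond_false (by simp [toStacks, hx]) h
    · obtain ⟨t, ht, h⟩ := hq hs h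
      refine ⟨t + 1, by simp [time]; omega, ?_⟩
      rw [compile, eval, if_neg hx]
      refine .cond_true ?_ h
      obtain ⟨n, hn⟩ := Nat.exists_eq_succ_of_ne_zero hx
      simp [toStacks, hn, List.replicate_succ]
  | seq p q hp hq =>
    obtain ⟨t, ht, h1⟩ := hp hs h
    obtain ⟨t', ht', h2⟩ := hq (bounded_eval p hs) h
    exact ⟨t + t', by simp [time]; omega, h1.seq h2⟩
  | loop c p hp =>
    have hc := hs.1 c
    suffices ∀ n ≤ N, s.num c = n → ∃ t ≤ n * (20 * N + 20 + (time p).eval N) + 1,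
        Exec (compile (loop c p)) (toStacks s h) (toStacks (countdown
          (fun i s => (eval p (s.setNum c i)).setNum c i) n s) h) t by
      obtain ⟨t, ht, h'⟩ := this _ hc rfl
      refine ⟨t, ht.trans ?_, h'⟩
      simp only [time, Polynomial.eval_add, Polynomial.eval_mul, Polynomial.eval_X,
        Polynomial.eval_one, Polynomial.eval_ofNat]
      gcongr
    intro n hn hsc
    induction n generalizing s with
    | zero => exact ⟨1, by simp, .loop_false (by simp [toStacks, hsc])⟩
    | succ n ih =>
      have hs1 : (s.setNum c n).Bounded N := hs.setNum (by omega)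
      have h1 : Exec (.pop (.inl c)) (toStacks s h) (toStacks (s.setNum c n) h) 1 := by
        rw [toStacks_setNum]
        simpa [toStacks, hsc] using Exec.pop (Sum.inl c) (toStacks s h)
      have h2 := StackProg.exec_pushNumber (t := .inr (.inr 0)) (k := .inr (.inr 1)) (x := .inl c)
        (by simp) (by simp) (by simp) n (toStacks (s.setNum c n) h) rfl
        (by simp [toStacks, NumState.setNum])
      rw [← toStacks_aux] at h2
      -- The body runs with the counter saved on top of the auxiliary stack. Popping it afterwards
      -- restores the counter, whatever the body did to it.
      obtain ⟨t, ht, h3⟩ := hp hs1 (EmbeddedGraph.encodeNumber n ++ toStacks (s.setNum c n) h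
        (.inr (.inr 1)))
      have h4 := StackProg.exec_popNumber (x := .inl c) (k := .inr (.inr 1)) (by simp) n
        (false :: h) (toStacks (eval p (s.setNum c n)) (EmbeddedGraph.encodeNumber n ++
          toStacks (s.setNum c n) h (.inr (.inr 1)))) (by simp)
        (by simp [toStacks, EmbeddedGraph.encodeNumber])
      rw [← toStacks_setNum, ← toStacks_aux, List.tail_cons] at h4
      have hs2 := (bounded_eval p hs1).setNum (x := c) (v := n) (by omega)
      obtain ⟨t', ht', h5⟩ := ih hs2 (hs2.1 c) (by omega) (by simp [NumState.setNum])
      rw [compile] at h5 ⊢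
      have h6 := Exec.loop_true (c := Option.isSome) (k := .inl c)
        (by simp [toStacks, hsc, List.replicate_succ]) (h1.seq (h2.seq (h3.seq h4))) h5
      refine ⟨_, ?_, h6⟩
      have := (bounded_eval p hs1).1 c
      simp only [toStacks, List.length_replicate]
      rw [Nat.add_mul, Nat.one_mul]
      omega

/-- The initial memory for a given input list `l`, which is stored in `A`: the variable `x`
contains the length of the code of `l`, and the variable `y` contains `1`. -/
def initState (x y : V) (A : W) (l : List ℕ) : NumState V W where
  num := Function.update (Function.update (fun _ => 0) y 1) x
    (l.flatMap EmbeddedGraph.encodeNumber).length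
  lst := Function.update (fun _ => []) A l
  out := []

/-- Move the contents of the stack `k` to the stack `t`, and count them on the stack `x`. -/
def moveCount {K : Type} (k t x : K) : StackProg K :=
  .loop k Option.isSome (.cond k (· == some true)
    (.seq (.pop k) (.seq (.push t true) (.push x true)))
    (.seq (.pop k) (.seq (.push t false) (.push x true))))

theorem exec_moveCount {K : Type} [DecidableEq K] {k t x : K} (hkt : k ≠ t) (hkx : k ≠ x)
    (htx : t ≠ x) (l : List Bool) (S : K → List Bool) (hS : S k = l) :
    Exec (moveCount k t x) S (Function.update (Function.update (Function.update S k []) t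
      (l.reverse ++ S t)) x (List.replicate l.length true ++ S x)) (5 * l.length + 1) := by
  induction l generalizing S with
  | nil =>
    refine (Exec.loop_false (by simp [hS])).cast ?_ (by simp)
    have : Function.update S k [] = S := by rw [← hS, Function.update_eq_self]
    simp [this]
  | cons b l ih =>
    have h1 : Exec (.cond k (· == some true)
        (.seq (.pop k) (.seq (.push t true) (.push x true)))
        (.seq (.pop k) (.seq (.push t false) (.push x true)))) S
        (Function.update (Function.update (Function.update S k l) t (b :: S t)) x
          (true :: S x)) 4 := by
      have h (b : Bool) := (Exec.pop k S).seq ((Exec.push t b _).seq (Exec.push x true _))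
      simp only [hS, List.tail_cons, Function.update_of_ne hkt.symm, Function.update_of_ne htx.symm,
        Function.update_of_ne hkx.symm] at h
      rcases b with _ | _
      · exact .cond_false (by simp [hS]) (h _)
      · exact .cond_true (by simp [hS]) (h _)
    have h2 := ih _ (by simp [hkx, hkt] : Function.update (Function.update (Function.update S k l) t
      (b :: S t)) x (true :: S x) k = l)
    refine (Exec.loop_true (by simp [hS]) h1 h2).cast ?_ (by rw [List.length_cons]; ring)
    funext z
    by_cases hzx : z = x
    · subst hzx; simp [List.replicate_succ']
    by_cases hzt : z = t
    · subst hzt; simp [hzx]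
    by_cases hzk : z = k
    · subst hzk; simp [hzx, hzt]
    simp [hzx, hzt, hzk]

omit [DecidableEq V] [DecidableEq W] in
theorem le_length_flatMap_encodeNumber {l : List ℕ} {v : ℕ} (hv : v ∈ l) :
    v < (l.flatMap EmbeddedGraph.encodeNumber).length := by
  induction l with
  | nil => simp at hv
  | cons w l ih =>
    rw [List.flatMap_cons, List.length_append, EmbeddedGraph.encodeNumber, List.length_append]
    simp only [List.length_replicate, List.length_cons, List.length_nil]
    rcases List.mem_cons.1 hv with rfl | hv
    · omega
    · have := ih hv; omega

/-- The functions that are computed by programs on numbers can be computed in polynomial time. -/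
theorem nonempty_computableInPolyTime [Fintype V] [Fintype W] {α : Type} (ea : α → List Bool)
    (la : α → List ℕ) (hla : ∀ a, ea a = (la a).flatMap EmbeddedGraph.encodeNumber)
    (p : NumProg V W) {x y : V} (hxy : x ≠ y) (A : W) :
    Nonempty (Turing.TM2ComputableInPolyTime ea id
      fun a => (eval p (initState x y A (la a))).out) := by
  -- Moving the input to an auxiliary stack and back restores its order. The first pass counts its
  -- bits on `x`; the count of the second pass is discarded.
  refine StackProg.nonempty_computableInPolyTime ea _ (.inr (.inl A)) (.inr (.inr 2))
    (.seq (moveCount (.inr (.inl A)) (.inr (.inr 0)) (.inl x))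
      (.seq (moveCount (.inr (.inr 0)) (.inr (.inl A)) (.inr (.inr 1)))
        (.seq (StackProg.clear (.inr (.inr 1))) (.seq (.push (.inl y) true) (compile p)))))
    (5 * Polynomial.X + 1 + (5 * Polynomial.X + 1 + (2 * Polynomial.X + 1 +
      (1 + (time p).comp (Polynomial.X + 1))))) fun a => ?_
  have h1 := exec_moveCount (k := (.inr (.inl A) : Stack V W)) (t := .inr (.inr 0)) (x := .inl x)
    (by simp) (by simp) (by simp) (ea a) (Function.update (fun _ => []) (.inr (.inl A)) (ea a))
    (by simp)
  have h2 := exec_moveCount (k := (.inr (.inr 0) : Stack V W)) (t := .inr (.inl A))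
    (x := .inr (.inr 1)) (by simp) (by simp) (by simp) (ea a).reverse
  have hb : (initState x y A (la a) : NumState V W).Bounded ((ea a).length + 1) := by
    refine ⟨fun z => ?_, fun B v hv => ?_⟩
    · by_cases hzx : z = x
      · subst hzx; simp [initState, hla]
      by_cases hzy : z = y
      · subst hzy; simp [initState, hzx]
      simp [initState, hzx, hzy]
    · by_cases hB : B = A
      · subst hB
        have := le_length_flatMap_encodeNumber (by simpa [initState] using hv : v ∈ la a)
        rw [hla]
        omega
      · simp [initState, hB] at hv
  obtain ⟨t, ht, h3⟩ := exec_compile p hb []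
  refine ⟨_, _, ?_, h1.seq ((h2 _ (by simp)).seq ((StackProg.exec_clear _ _).seq
    ((Exec.push _ _ _).seq (?_ : Exec _ _ (toStacks (eval p (initState x y A (la a))) []) t)))), rfl⟩
  · clear h1 h2 h3
    simp
    omega
  · convert h3 using 1
    funext k
    rcases k with z | B | i
    · by_cases hzx : z = x
      · subst hzx; simp [initState, toStacks, hxy, hla]
      by_cases hzy : z = y
      · subst hzy; simp [initState, toStacks, hzx]
      simp [initState, toStacks, hzx, hzy]
    · by_cases hB : B = A
      · subst hB; simp [initState, toStacks, hla]
      · simp [initState, toStacks, hB]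
    · fin_cases i <;> simp [initState, toStacks]

end NumProg

/-! ### Programs with expressions and arrays -/

/-- Expressions: number variables, array entries, and truncated differences. -/
inductive ArrayExpr (V W : Type) : Type
  | var (x : V)
  | get (A : W) (e : ArrayExpr V W)
  | sub (e₁ e₂ : ArrayExpr V W)

/-- Programs that act on numbers (with names in `V`) and arrays of numbers (with names in `W`), and
emit bits. -/
inductive ArrayProg (V W : Type) : Type
  | assign (x : V) (e : ArrayExpr V W)
  | set (A : W) (i v : ArrayExpr V W)
  | emit (e : ArrayExpr V W)
  | skip
  | ifle (e₁ e₂ : ArrayExpr V W) (p q : ArrayProg V W)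
  | loop (c : V) (e : ArrayExpr V W) (p : ArrayProg V W)
  | seq (p q : ArrayProg V W)

/-- The memory of a program with arrays. -/
structure ArrayState (V W : Type) where
  num : V → ℕ
  arr : W → ℕ → ℕ
  out : List Bool

section

open Function (update)

variable {V W : Type} [DecidableEq V] [DecidableEq W]

namespace ArrayState

/-- Assign a value to a number variable. -/
def setNum (s : ArrayState V W) (x : V) (v : ℕ) : ArrayState V W :=
  { s with num := update s.num x v }

/-- Assign a value to an array entry. -/
def setArr (s : ArrayState V W) (A : W) (i v : ℕ) : ArrayState V W :=
  { s with arr := update s.arr A (update (s.arr A) i v) }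

/-- The memory `s` is represented by `r`, with operand stack `l`. -/
structure Repr (s : ArrayState V W) (l : List ℕ) (r : NumState (V ⊕ Fin 3) (W ⊕ Fin 2)) :
    Prop where
  num : ∀ x, r.num (.inl x) = s.num x
  num_aux : ∀ i, r.num (.inr i) = 0
  arr : ∀ A i, (r.lst (.inl A)).getD i 0 = s.arr A i
  stack : r.lst (.inr 0) = l
  lst_aux : r.lst (.inr 1) = []
  out : r.out = s.out

end ArrayState

namespace ArrayExpr

/-- The value of an expression. -/
def eval (s : ArrayState V W) : ArrayExpr V W → ℕ
  | var x => s.num x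
  | get A e => s.arr A (eval s e)
  | sub e₁ e₂ => eval s e₁ - eval s e₂

/-- The number `i` is moved from the operand stack to the auxiliary variables `0` and `1`, and the
first `i` entries of the array `A` are moved to the auxiliary list. -/
def seek (A : W) : NumProg (V ⊕ Fin 3) (W ⊕ Fin 2) :=
  .seq (.pop (.inr 0) (.inr 0)) (.seq (.copy (.inr 1) (.inr 0))
    (.loop (.inr 0) (.seq (.pop (.inr 2) (.inl A)) (.push (.inr 1) (.inr 2)))))

/-- The entries of the auxiliary list are moved back to the array `A`. -/
def unseek (A : W) : NumProg (V ⊕ Fin 3) (W ⊕ Fin 2) :=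
  .seq (.loop (.inr 1) (.seq (.pop (.inr 2) (.inr 1)) (.push (.inl A) (.inr 2))))
    (.copy (.inr 2) (.inr 0))

/-- The implementation of an expression: its value is pushed on the operand stack. -/
def compile : ArrayExpr V W → NumProg (V ⊕ Fin 3) (W ⊕ Fin 2)
  | var x => .push (.inr 0) (.inl x)
  | get A e => .seq (compile e) (.seq (seek A) (.seq (.pop (.inr 2) (.inl A))
      (.seq (.push (.inl A) (.inr 2)) (.seq (.push (.inr 0) (.inr 2)) (unseek A)))))
  | sub e₁ e₂ => .seq (compile e₁) (.seq (compile e₂) (.seq (.pop (.inr 1) (.inr 0))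
      (.seq (.pop (.inr 0) (.inr 0)) (.seq (.loop (.inr 1) (.dec (.inr 0)))
        (.seq (.push (.inr 0) (.inr 0)) (.copy (.inr 0) (.inr 1)))))))

end ArrayExpr

/-- The moved entries arrive in reverse order. An exhausted list keeps yielding zeros, so exactly
`n` entries are moved, and a list stands for an infinite array that ends in zeros. The value `z` is
a leftover in the transfer variable. -/
theorem NumProg.eval_loop_move (c t : V) (hct : c ≠ t) (A B : W) (hAB : A ≠ B) (n : ℕ)
    (r : NumState V W) (hn : r.num c = n) :
    ∃ z, eval (loop c (seq (pop t A) (push B t))) r =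
      ⟨update (update r.num t z) c 0, update (update r.lst A ((r.lst A).drop n)) B
        (((List.range n).map ((r.lst A).getD · 0)).reverse ++ r.lst B), r.out⟩ := by
  rw [eval, hn]
  induction n generalizing r with
  | zero =>
    refine ⟨r.num t, ?_⟩
    have h0 : update r.num c 0 = r.num := by rw [← hn, Function.update_eq_self]
    simp [countdown, h0]
  | succ n ih =>
    obtain ⟨z, hz⟩ := ih ((eval (seq (pop t A) (push B t)) (r.setNum c n)).setNum c n)
      (by simp [NumState.setNum])
    refine ⟨z, ?_⟩
    rw [countdown, hz]
    have hl : (r.lst A).headI = (r.lst A).getD 0 0 := by cases r.lst A <;> rfl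
    have hl' (i : ℕ) : (r.lst A).tail.getD i 0 = (r.lst A).getD (i + 1) 0 := by
      cases r.lst A <;> rfl
    ext x : 2
    · by_cases hxc : x = c
      · subst hxc; simp
      by_cases hxt : x = t
      · subst hxt; simp [hxc]
      simp [eval, NumState.setNum, NumState.setLst, hxc, hxt]
    · by_cases hxB : x = B
      · subst hxB
        simp [eval, NumState.setNum, NumState.setLst, hAB, List.range_succ_eq_map, hl, hl',
          Function.comp_def, hAB.symm, -List.getD_eq_getElem?_getD]
      by_cases hxA : x = A
      · subst hxA
        simp [eval, NumState.setNum, NumState.setLst, hAB]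
      simp [eval, NumState.setNum, NumState.setLst, hxA, hxB]
    · simp [eval, NumState.setNum, NumState.setLst]

theorem headI_drop (l : List ℕ) (n : ℕ) : (l.drop n).headI = l.getD n 0 := by
  rw [List.getD_eq_getElem?_getD, ← List.head?_drop]
  cases l.drop n <;> rfl

theorem map_getD_range (l : List ℕ) {n : ℕ} (h : n = l.length) :
    (List.range n).map (l.getD · 0) = l := by
  subst h
  apply List.ext_getElem <;> simp +contextual

/-! ### Random access to arrays that are stored as lists -/

namespace ArrayExpr

/-- The entries before position `i` are parked in the auxiliary list, so that entry `i` becomes the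
head of the list of `A`. The auxiliary variable `1` remembers how many entries `unseek` has to put
back. -/
theorem eval_seek (A : W) {s : ArrayState V W} {l i r} (h : s.Repr (i :: l) r) :
    ∃ z, NumProg.eval (seek A) r =
      ⟨update (update r.num (.inr 1) i) (.inr 2) z,
        update (update (update r.lst (.inr 0) l) (.inl A) ((r.lst (.inl A)).drop i)) (.inr 1)
          ((List.range i).map (s.arr A)).reverse, r.out⟩ := by
  have hr := h.num_aux
  simp only [seek, NumProg.eval.eq_9]
  obtain ⟨z, hz⟩ := NumProg.eval_loop_move (.inr 0 : V ⊕ Fin 3) (.inr 2) (by simp)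
    (.inl A : W ⊕ Fin 2) (.inr 1) (by simp) i
    (NumProg.eval (.copy (.inr 1) (.inr 0)) (NumProg.eval (.pop (.inr 0) (.inr 0)) r))
    (by simp [NumProg.eval, NumState.setNum, NumState.setLst, h.stack])
  refine ⟨z, hz.trans ?_⟩
  ext x : 2
  · rcases x with x | x
    · simp [NumProg.eval, NumState.setNum, NumState.setLst]
    · fin_cases x <;> simp [NumProg.eval, NumState.setNum, NumState.setLst, h.stack, hr]
  · rcases x with x | x
    · by_cases hx : x = A
      · subst hx
        simp [NumProg.eval, NumState.setNum, NumState.setLst]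
      · simp [NumProg.eval, NumState.setNum, NumState.setLst, hx]
    · fin_cases x
      · simp [NumProg.eval, NumState.setNum, NumState.setLst, h.stack]
      · simp [NumProg.eval, NumState.setNum, NumState.setLst, h.lst_aux, h.arr,
          -List.getD_eq_getElem?_getD]
  · rfl

theorem eval_unseek (A : W) (r : NumState (V ⊕ Fin 3) (W ⊕ Fin 2)) (h0 : r.num (.inr 0) = 0)
    (hr : (r.lst (.inr 1)).length = r.num (.inr 1)) :
    NumProg.eval (unseek A) r =
      ⟨update (update r.num (.inr 1) 0) (.inr 2) 0,
        update (update r.lst (.inl A) ((r.lst (.inr 1)).reverse ++ r.lst (.inl A))) (.inr 1)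
          [], r.out⟩ := by
  simp only [unseek, NumProg.eval.eq_9]
  obtain ⟨z, hz⟩ := NumProg.eval_loop_move (.inr 1 : V ⊕ Fin 3) (.inr 2) (by simp)
    (.inr 1 : W ⊕ Fin 2) (.inl A) (by simp) _ r rfl
  rw [map_getD_range _ hr.symm] at hz
  rw [hz]
  ext x : 2
  · rcases x with x | x
    · simp [NumProg.eval, NumState.setNum]
    · fin_cases x <;> simp [NumProg.eval, NumState.setNum, h0]
  · rcases x with x | x
    · by_cases hx : x = A
      · subst hx
        simp [NumProg.eval, NumState.setNum]
      · simp [NumProg.eval, NumState.setNum, hx]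
    · fin_cases x <;> simp [NumProg.eval, NumState.setNum, ← hr]
  · rfl

theorem getD_splice (f : ℕ → ℕ) (l : List ℕ) (hf : ∀ i, l.getD i 0 = f i) (n v i : ℕ) :
    ((List.range n).map f ++ v :: (l.drop n).tail).getD i 0 = update f n v i := by
  rcases lt_trichotomy i n with h | rfl | h
  · rw [List.getD_append _ _ _ _ (by simpa using h), Function.update_of_ne h.ne]
    simp [h]
  · rw [List.getD_append_right _ _ _ _ (by simp)]
    simp
  · rw [List.getD_append_right _ _ _ _ (by simpa using h.le), Function.update_of_ne h.ne', ← hf]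
    obtain ⟨k, rfl⟩ := Nat.exists_eq_add_of_lt h
    simp [show n + k + 1 - n = k + 1 by omega]
    congr 2
    omega

theorem eval_loop_dec (c x : V) (hcx : c ≠ x) (r : NumState V W) :
    NumProg.eval (.loop c (.dec x)) r = (r.setNum x (r.num x - r.num c)).setNum c 0 := by
  rw [NumProg.eval]
  generalize hn : r.num c = n
  induction n generalizing r with
  | zero =>
    ext y : 2
    · by_cases hy : y = c
      · subst hy; simp [countdown, NumState.setNum, hn]
      by_cases hy' : y = x
      · subst hy'; simp [countdown, NumState.setNum, hcx.symm]
      simp [countdown, NumState.setNum, hy]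
    · rfl
    · rfl
  | succ n ih =>
    rw [countdown, ih _ (by simp [NumState.setNum])]
    ext y : 2
    · by_cases hy : y = c
      · subst hy; simp [NumState.setNum]
      by_cases hy' : y = x
      · subst hy'; simp [NumProg.eval, NumState.setNum, hcx.symm]; omega
      simp [NumProg.eval, NumState.setNum, hy, hy']
    · rfl
    · rfl

/-- The operand stack `l` is arbitrary, so that a subexpression can be evaluated on top of
intermediate results. All auxiliary variables return to 0, which is the invariant `num_aux`. -/
theorem repr_compile (e : ArrayExpr V W) {s : ArrayState V W} {l r} (h : s.Repr l r) :
    s.Repr (e.eval s :: l) (NumProg.eval (compile e) r) := by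
  induction e generalizing l r with
  | var x =>
    refine ⟨h.num, h.num_aux, h.arr, ?_, h.lst_aux, h.out⟩
    simp [compile, NumProg.eval, NumState.setLst, h.num, h.stack, eval]
  | get A e ih =>
    obtain ⟨z, hz⟩ := eval_seek A (ih h)
    simp only [compile, NumProg.eval.eq_9]
    rw [hz, eval_unseek]
    · have h' := ih h
      refine ⟨?_, ?_, ?_, ?_, ?_, ?_⟩
      · intro x
        simp [NumProg.eval, NumState.setNum, NumState.setLst, h'.num]
      · intro i
        fin_cases i <;> simp [NumProg.eval, NumState.setNum, NumState.setLst, h'.num_aux]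
      · intro B i
        by_cases hB : B = A
        · subst hB
          have := getD_splice (s.arr B) _ (h'.arr B) (eval s e) (s.arr B (eval s e)) i
          rw [Function.update_eq_self] at this
          rw [← this]
          have h2 := h'.arr B (eval s e)
          simp only [NumProg.eval, NumState.setNum, NumState.setLst]
          simp
          rw [← h2, headI_drop]
        · simpa [NumProg.eval, NumState.setNum, NumState.setLst, hB] using h'.arr B i
      · have h2 := h'.arr A (eval s e)
        simp [NumProg.eval, NumState.setNum, NumState.setLst, eval]
        rw [← h2, headI_drop]
      · simp
      · simpa [NumProg.eval, NumState.setNum, NumState.setLst] using h'.out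
    · simp [NumProg.eval, NumState.setNum, NumState.setLst, (ih h).num_aux]
    · simp [NumProg.eval, NumState.setNum, NumState.setLst]
  | sub e₁ e₂ ih₁ ih₂ =>
    have h' := ih₂ (ih₁ h)
    simp only [compile, NumProg.eval.eq_9]
    rw [eval_loop_dec _ _ (by simp)]
    refine ⟨?_, ?_, ?_, ?_, ?_, ?_⟩
    · intro x
      simp [NumProg.eval, NumState.setNum, NumState.setLst, h'.num]
    · intro i
      fin_cases i <;> simp [NumProg.eval, NumState.setNum, NumState.setLst, h'.num_aux]
    · intro B i
      simpa [NumProg.eval, NumState.setNum, NumState.setLst] using h'.arr B i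
    · simp [NumProg.eval, NumState.setNum, NumState.setLst, h'.stack, eval]
    · simp [NumProg.eval, NumState.setNum, NumState.setLst, h'.lst_aux]
    · simpa [NumProg.eval, NumState.setNum, NumState.setLst] using h'.out

end ArrayExpr

namespace ArrayProg

/-- The semantics of programs. The loop `loop c e p` runs `p` for the values `e - 1`, …, `0` of the
variable `c`, in this order. -/
def eval : ArrayProg V W → ArrayState V W → ArrayState V W
  | assign x e, s => s.setNum x (e.eval s)
  | set A i v, s => s.setArr A (i.eval s) (v.eval s)
  | emit e, s => { s with out := (e.eval s != 0) :: s.out }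
  | skip, s => s
  | ifle e₁ e₂ p q, s => if e₁.eval s ≤ e₂.eval s then eval p s else eval q s
  | loop c e p, s => countdown (fun i s => (eval p (s.setNum c i)).setNum c i) (e.eval s)
      (s.setNum c (e.eval s))
  | seq p q, s => eval q (eval p s)

/-- The implementation of a program. -/
def compile : ArrayProg V W → NumProg (V ⊕ Fin 3) (W ⊕ Fin 2)
  | assign x e => .seq e.compile (.pop (.inl x) (.inr 0))
  | set A i v => .seq v.compile (.seq i.compile (.seq (ArrayExpr.seek A)
      (.seq (.pop (.inr 2) (.inl A)) (.seq (.pop (.inr 2) (.inr 0))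
        (.seq (.push (.inl A) (.inr 2)) (ArrayExpr.unseek A))))))
  | emit e => .seq e.compile (.seq (.pop (.inr 0) (.inr 0))
      (.seq (.ifz (.inr 0) (.emit false) (.emit true)) (.copy (.inr 0) (.inr 1))))
  | skip => .skip
  | ifle e₁ e₂ p q => .seq (ArrayExpr.sub e₁ e₂).compile (.seq (.pop (.inr 0) (.inr 0))
      (.ifz (.inr 0) (compile p) (.seq (.copy (.inr 0) (.inr 1)) (compile q))))
  | loop c e p => .seq e.compile (.seq (.pop (.inl c) (.inr 0)) (.loop (.inl c) (compile p)))
  | seq p q => .seq (compile p) (compile q)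

omit [DecidableEq W] in
theorem repr_setNum {s : ArrayState V W} {l r} (h : s.Repr l r) (x : V) (v : ℕ) :
    (s.setNum x v).Repr l (r.setNum (.inl x) v) := by
  refine ⟨fun y => ?_, h.num_aux, h.arr, h.stack, h.lst_aux, h.out⟩
  by_cases hy : y = x
  · subst hy; simp [ArrayState.setNum, NumState.setNum]
  · simp [ArrayState.setNum, NumState.setNum, hy, h.num]

theorem repr_pop {s : ArrayState V W} {l v r} (h : s.Repr (v :: l) r) (x : V) :
    (s.setNum x v).Repr l (NumProg.eval (.pop (.inl x) (.inr 0)) r) := by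
  have h' := repr_setNum h x v
  refine ⟨?_, h'.num_aux, h'.arr, ?_, h'.lst_aux, h'.out⟩
  · simpa [NumProg.eval, h.stack] using! h'.num
  · simp [NumProg.eval, NumState.setLst, h.stack]

theorem repr_compile (p : ArrayProg V W) {s : ArrayState V W} {l r} (h : s.Repr l r) :
    (eval p s).Repr l (NumProg.eval (compile p) r) := by
  induction p generalizing s l r with
  | assign x e => exact repr_pop (e.repr_compile h) x
  | set A i v =>
    have h' := i.repr_compile (v.repr_compile h)
    obtain ⟨z, hz⟩ := ArrayExpr.eval_seek A h'
    simp only [compile, NumProg.eval.eq_9]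
    rw [hz, ArrayExpr.eval_unseek]
    · refine ⟨?_, ?_, ?_, ?_, ?_, ?_⟩
      · intro x
        simp [NumProg.eval, NumState.setNum, NumState.setLst, h'.num, eval, ArrayState.setArr]
      · intro i
        fin_cases i <;> simp [NumProg.eval, NumState.setNum, NumState.setLst, h'.num_aux]
      · intro B j
        by_cases hB : B = A
        · subst hB
          have := ArrayExpr.getD_splice (s.arr B) _ (h'.arr B) (i.eval s) (v.eval s) j
          simp only [eval, ArrayState.setArr, Function.update_self]
          rw [← this]
          simp [NumProg.eval, NumState.setNum, NumState.setLst]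
        · simpa [NumProg.eval, NumState.setNum, NumState.setLst, hB, eval, ArrayState.setArr]
            using h'.arr B j
      · simp [NumProg.eval, NumState.setNum, NumState.setLst]
      · simp
      · simpa [NumProg.eval, NumState.setNum, NumState.setLst, eval, ArrayState.setArr] using h'.out
    · simp [NumProg.eval, NumState.setNum, NumState.setLst, h'.num_aux]
    · simp [NumProg.eval, NumState.setNum, NumState.setLst]
  | emit e =>
    have h' := e.repr_compile h
    simp only [compile, NumProg.eval.eq_9]
    by_cases he : e.eval s = 0
    · have hz : (NumProg.eval (.pop (.inr 0) (.inr 0)) (NumProg.eval e.compile r)).num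
          (.inr 0) = 0 := by
        simp [NumProg.eval, NumState.setNum, NumState.setLst, h'.stack, he]
      rw [NumProg.eval.eq_7, if_pos hz]
      refine ⟨?_, ?_, ?_, ?_, ?_, ?_⟩
      · intro x
        simp [NumProg.eval, NumState.setNum, NumState.setLst, h'.num, eval]
      · intro i
        fin_cases i <;> simp [NumProg.eval, NumState.setNum, NumState.setLst, h'.num_aux]
      · intro B j
        simpa [NumProg.eval, NumState.setNum, NumState.setLst, eval] using h'.arr B j
      · simp [NumProg.eval, NumState.setNum, NumState.setLst, h'.stack]
      · simp [NumProg.eval, NumState.setNum, NumState.setLst, h'.lst_aux]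
      · simp [NumProg.eval, NumState.setNum, NumState.setLst, h'.out, eval, he]
    · have hz : (NumProg.eval (.pop (.inr 0) (.inr 0)) (NumProg.eval e.compile r)).num
          (.inr 0) ≠ 0 := by
        simp [NumProg.eval, NumState.setNum, NumState.setLst, h'.stack, he]
      rw [NumProg.eval.eq_7, if_neg hz]
      refine ⟨?_, ?_, ?_, ?_, ?_, ?_⟩
      · intro x
        simp [NumProg.eval, NumState.setNum, NumState.setLst, h'.num, eval]
      · intro i
        fin_cases i <;> simp [NumProg.eval, NumState.setNum, NumState.setLst, h'.num_aux]
      · intro B j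
        simpa [NumProg.eval, NumState.setNum, NumState.setLst, eval] using h'.arr B j
      · simp [NumProg.eval, NumState.setNum, NumState.setLst, h'.stack]
      · simp [NumProg.eval, NumState.setNum, NumState.setLst, h'.lst_aux]
      · simp [NumProg.eval, NumState.setNum, NumState.setLst, h'.out, eval, he]
  | skip => exact h
  | ifle e₁ e₂ p q hp hq =>
    have h' := (ArrayExpr.sub e₁ e₂).repr_compile h
    simp only [compile, NumProg.eval.eq_9, NumProg.eval.eq_7]
    have hz : (NumProg.eval (.pop (.inr 0) (.inr 0))
        (NumProg.eval (ArrayExpr.sub e₁ e₂).compile r)).num (.inr 0) =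
          e₁.eval s - e₂.eval s := by
      simp [NumProg.eval, NumState.setNum, NumState.setLst, h'.stack, ArrayExpr.eval]
    rw [hz, eval]
    by_cases he : e₁.eval s ≤ e₂.eval s
    · rw [if_pos he, if_pos (Nat.sub_eq_zero_of_le he)]
      refine hp ⟨?_, ?_, ?_, ?_, ?_, ?_⟩
      · intro x
        simp [NumProg.eval, NumState.setNum, NumState.setLst, h'.num]
      · intro i
        fin_cases i
        · exact hz.trans (Nat.sub_eq_zero_of_le he)
        · simp [NumProg.eval, NumState.setNum, NumState.setLst, h'.num_aux]
        · simp [NumProg.eval, NumState.setNum, NumState.setLst, h'.num_aux]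
      · intro B j
        simpa [NumProg.eval, NumState.setNum, NumState.setLst] using h'.arr B j
      · simp [NumProg.eval, NumState.setNum, NumState.setLst, h'.stack]
      · simp [NumProg.eval, NumState.setNum, NumState.setLst, h'.lst_aux]
      · simpa [NumProg.eval, NumState.setNum, NumState.setLst] using h'.out
    · rw [if_neg he, if_neg (by omega)]
      refine hq ⟨?_, ?_, ?_, ?_, ?_, ?_⟩
      · intro x
        simp [NumProg.eval, NumState.setNum, NumState.setLst, h'.num]
      · intro i
        fin_cases i <;> simp [NumProg.eval, NumState.setNum, NumState.setLst, h'.num_aux]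
      · intro B j
        simpa [NumProg.eval, NumState.setNum, NumState.setLst] using h'.arr B j
      · simp [NumProg.eval, NumState.setNum, NumState.setLst, h'.stack]
      · simp [NumProg.eval, NumState.setNum, NumState.setLst, h'.lst_aux]
      · simpa [NumProg.eval, NumState.setNum, NumState.setLst] using h'.out
  | loop c e p hp =>
    have h' := repr_pop (e.repr_compile h) c
    simp only [compile, NumProg.eval.eq_9]
    rw [NumProg.eval.eq_8, h'.num c, eval]
    simp only [ArrayState.setNum, Function.update_self]
    change ((s.setNum c (e.eval s)).Repr l _) at h'
    change ArrayState.Repr (countdown _ _ (s.setNum c (e.eval s))) l _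
    generalize s.setNum c (e.eval s) = s' at h' ⊢
    generalize NumProg.eval (.pop (.inl c) (.inr 0)) (NumProg.eval e.compile r) = r' at h' ⊢
    generalize e.eval s = n
    induction n generalizing s' r' with
    | zero => exact h'
    | succ n ih => exact ih _ _ (repr_setNum (hp (repr_setNum h' c n)) c n)
  | seq p q hp hq => exact hq (hp h)

/-- The initial memory for a given input list `l`, which is stored in `A`: the variable `x`
contains the length of the code of `l`, and the variable `y` contains `1`. -/
def initState (x y : V) (A : W) (l : List ℕ) : ArrayState V W where
  num := update (update (fun _ => 0) y 1) x (l.flatMap EmbeddedGraph.encodeNumber).length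
  arr := update (fun _ _ => 0) A fun i => l.getD i 0
  out := []

/-- The functions that are computed by programs with arrays can be computed in polynomial time. -/
theorem nonempty_computableInPolyTime [Fintype V] [Fintype W] {α : Type} (ea : α → List Bool)
    (la : α → List ℕ) (hla : ∀ a, ea a = (la a).flatMap EmbeddedGraph.encodeNumber)
    (p : ArrayProg V W) {x y : V} (hxy : x ≠ y) (A : W) :
    Nonempty (Turing.TM2ComputableInPolyTime ea id
      fun a => (eval p (initState x y A (la a))).out) := by
  have h := NumProg.nonempty_computableInPolyTime ea la hla (compile p)
    (x := (.inl x : V ⊕ Fin 3)) (y := .inl y) (by simpa using hxy) (.inl A : W ⊕ Fin 2)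
  convert h using 2
  funext a
  refine (repr_compile p (l := []) ?_).out.symm
  refine ⟨fun z => ?_, fun i => ?_, fun B i => ?_, ?_, ?_, rfl⟩
  · by_cases hzx : z = x
    · subst hzx; simp [initState, NumProg.initState]
    by_cases hzy : z = y
    · subst hzy; simp [initState, NumProg.initState, hzx]
    simp [initState, NumProg.initState, hzx, hzy]
  · simp [NumProg.initState]
  · by_cases hB : B = A
    · subst hB; simp [initState, NumProg.initState]
    · simp [initState, NumProg.initState, hB]
  · simp [NumProg.initState]
  · simp [NumProg.initState]

end ArrayProg

end

/-! ### Combinatorial maps -/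

/-! ### Removal of a point from a cycle, and merging of two cycles -/

namespace Equiv.Perm

variable {D : Type*}

/-- Only single steps need checking. Negative powers are covered by the symmetry of `SameCycle`, so
that no finiteness is required. -/
theorem SameCycle.map_of_forall {p p' : Equiv.Perm D} {g : D → D}
    (h : ∀ z, p'.SameCycle (g z) (g (p z))) {x y : D} (hxy : p.SameCycle x y) :
    p'.SameCycle (g x) (g y) := by
  obtain ⟨i, rfl⟩ := hxy
  induction i with
  | zero => exact .refl _ _
  | succ i ih =>
    rw [add_comm, zpow_add, zpow_one, Equiv.Perm.mul_apply]
    exact ih.trans (h _)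
  | pred i ih =>
    refine ih.trans ?_
    have := h ((p ^ (-(i : ℤ) - 1)) x)
    rw [← Equiv.Perm.mul_apply, ← zpow_one_add] at this
    convert this.symm using 4
    ring

open Classical in
/-- Remove `x` from its cycle. -/
noncomputable def skip (x : D) (p : Equiv.Perm D) : Equiv.Perm D := swap x (p x) * p

theorem skip_apply_self (x : D) (p : Equiv.Perm D) : skip x p x = x := by
  simp [skip]

theorem skip_apply_of_eq {x y : D} {p : Equiv.Perm D} (h : p y = x) : skip x p y = p x := by
  simp [skip, h]

theorem skip_apply_of_ne {x y : D} {p : Equiv.Perm D} (h : p y ≠ x) (hy : y ≠ x) :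
    skip x p y = p y := by
  classical
  rw [skip, Equiv.Perm.mul_apply, Equiv.swap_apply_of_ne_of_ne h (p.injective.ne hy)]

theorem skip_of_fixed {x : D} {p : Equiv.Perm D} (h : p x = x) : skip x p = p := by
  classical
  rw [skip, h, swap_self]
  rfl

theorem SameCycle.skip {x a b : D} {p : Equiv.Perm D} (h : p.SameCycle a b) (ha : a ≠ x)
    (hb : b ≠ x) : (skip x p).SameCycle a b := by
  classical
  by_cases hx : p x = x
  · rwa [skip_of_fixed hx]
  -- The map replaces `x` by its successor, which turns the step out of `x` into a trivial one and
  -- the step into `x` into a step of the shortened cycle.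
  have := h.map_of_forall (p' := Equiv.Perm.skip x p) (g := fun z => if z = x then p x else z)
    fun z => ?_
  · simpa [ha, hb] using this
  by_cases hz : z = x
  · subst hz
    simp [hx, SameCycle.refl]
  by_cases hz' : p z = x
  · simp only [hz, hz', if_true, if_false]
    rw [← skip_apply_of_eq hz']
    exact ⟨1, by simp⟩
  · simp only [hz, hz', if_false]
    rw [← skip_apply_of_ne hz' hz]
    exact ⟨1, by simp⟩

-- Only steps into `a` or `b` are altered. Starting at `a`, the new permutation therefore follows
-- `p` up to `p⁻¹ a`, because `b` is not on this cycle. So the cycle of `a` stays together, and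
-- likewise the one of `b`.
open Classical in
theorem swap_mul_sameCycle [Finite D] {p : Equiv.Perm D} {a b : D} (hab : ¬ p.SameCycle a b)
    {x y : D} (hxy : p.SameCycle x y) : (swap a b * p).SameCycle x y := by
  have key : ∀ a b : D, ¬ p.SameCycle a b → (swap a b * p).SameCycle a (p⁻¹ a) := by
    intro a b hab
    obtain ⟨n, hn⟩ := (show p.SameCycle a (p⁻¹ a) from ⟨-1, by simp⟩).exists_nat_pow_eq
    classical
    have hex : ∃ n : ℕ, (p ^ n) a = p⁻¹ a := ⟨n, hn⟩
    have hmin := fun {m} => Nat.find_min (m := m) hex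
    suffices ∀ j ≤ Nat.find hex, ((swap a b * p) ^ j) a = (p ^ j) a by
      have h := this _ le_rfl
      rw [Nat.find_spec hex] at h
      exact ⟨(Nat.find hex : ℕ), by rwa [zpow_natCast]⟩
    intro j hj
    induction j with
    | zero => rfl
    | succ j ih =>
      rw [pow_succ', pow_succ', Equiv.Perm.mul_apply, Equiv.Perm.mul_apply, ih (by omega),
        Equiv.Perm.mul_apply, swap_apply_of_ne_of_ne]
      · intro h
        exact hmin (show j < _ by omega) (by rw [Equiv.Perm.eq_inv_iff_eq, h])
      · intro h
        apply hab
        rw [← h]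
        exact ⟨(j + 1 : ℕ), by rw [zpow_natCast, pow_succ', Equiv.Perm.mul_apply]⟩
  refine hxy.map_of_forall (g := id) fun z => ?_
  simp only [id]
  have hp : ∀ z, (swap a b * p).SameCycle z (swap a b (p z)) := fun z => ⟨1, by simp⟩
  have ha := key a b hab
  have hb := key b a fun h => hab h.symm
  rw [swap_comm] at hb
  by_cases hza : p z = a
  · have hz : z = p⁻¹ a := by rw [Equiv.Perm.eq_inv_iff_eq, hza]
    rw [hza, hz]
    exact ha.symm
  by_cases hzb : p z = b
  · have hz : z = p⁻¹ b := by rw [Equiv.Perm.eq_inv_iff_eq, hzb]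
    rw [hzb, hz]
    exact hb.symm
  have := hp z
  rwa [swap_apply_of_ne_of_ne hza hzb] at this

-- The predecessor of `a` is now sent to `b`, which joins the two cycles.
open Classical in
theorem swap_mul_sameCycle_self [Finite D] {p : Equiv.Perm D} {a b : D}
    (hab : ¬ p.SameCycle a b) : (swap a b * p).SameCycle a b := by
  have h : p.SameCycle (p⁻¹ a) a := ⟨1, by simp⟩
  exact (swap_mul_sameCycle hab h).symm.trans ⟨1, by simp⟩

end Equiv.Perm

/-- An oriented combinatorial map: a graph with vertex set `V` and edge set `E`, embedded in an
oriented surface. The half-edges of the edge `e` are `(e, false)` and `(e, true)`. -/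
structure OrientedMap (V E : Type*) where
  /-- The vertex at which a half-edge starts. -/
  tail : E × Bool → V
  /-- The next half-edge around the vertex. -/
  rot : Equiv.Perm (E × Bool)
  sameCycle_iff : ∀ d d', rot.SameCycle d d' ↔ tail d = tail d'

/-- The other half-edge of the same edge. -/
def Equiv.flipDart (E : Type*) : Equiv.Perm (E × Bool) :=
  Equiv.prodCongr (Equiv.refl E) Equiv.boolNot

namespace OrientedMap

variable {V E : Type*}

local notation "flip" => Equiv.flipDart E

theorem flip_flip (d : E × Bool) : flip (flip d) = d := by
  rcases d with ⟨e, b⟩; simp [Equiv.flipDart]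

theorem flip_fst (d : E × Bool) : (flip d).1 = d.1 := rfl

theorem flip_ne (d : E × Bool) : flip d ≠ d := by
  rcases d with ⟨e, b⟩; simp [Equiv.flipDart]

theorem eq_or_eq_flip {d d' : E × Bool} (h : d.1 = d'.1) : d = d' ∨ d = flip d' := by
  rcases d with ⟨e, b⟩; rcases d' with ⟨e', b'⟩
  cases b <;> cases b' <;> simp_all [Equiv.flipDart]

theorem fst_ne_iff {d d' : E × Bool} : d.1 ≠ d'.1 ↔ d ≠ d' ∧ d ≠ flip d' := by
  constructor
  · intro h
    exact ⟨fun h' => h (by rw [h']), fun h' => h (by rw [h', flip_fst])⟩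
  · rintro ⟨h, h'⟩ h''
    rcases eq_or_eq_flip h'' with h1 | h1
    exacts [h h1, h' h1]

/-- If `d` is fixed by `p`, then removing `flip d` from `p` does not split cycles of `p ∘ flip`. -/
theorem sameCycle_skip_flip {p : Equiv.Perm (E × Bool)} {d x y : E × Bool} (hd : p d = d)
    (hx : x.1 ≠ d.1) (hy : y.1 ≠ d.1) (h : (p * flip).SameCycle x y) :
    (Equiv.Perm.skip (flip d) p * flip).SameCycle x y := by
  classical
  by_cases hw : p (flip d) = flip d
  · rwa [Equiv.Perm.skip_of_fixed hw]
  have hwd : p (flip d) ≠ d := fun h' => flip_ne d (p.injective (h'.trans hd.symm))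
  rw [fst_ne_iff] at hx hy
  -- In `p * flip` the half-edge `flip d` is followed by `d`, and `d` by `p (flip d)`. The map sends
  -- both to `p (flip d)`, so that cutting them out contracts two consecutive points of a cycle.
  have := h.map_of_forall (p' := Equiv.Perm.skip (flip d) p * flip)
    (g := fun z => if z = d ∨ z = flip d then p (flip d) else z) fun z => ?_
  · simpa [hx, hy] using this
  by_cases hz1 : z = d
  · subst hz1
    simp [hwd, hw, Equiv.Perm.SameCycle.refl]
  by_cases hz2 : z = flip d
  · subst hz2
    simp [flip_flip, hd, Equiv.Perm.SameCycle.refl]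
  have hz3 : flip z ≠ d := fun h' => hz2 (by rw [← h', flip_flip])
  have hz4 : flip z ≠ flip d := fun h' => hz1 ((flip).injective h')
  have hz5 : p (flip z) ≠ d := fun h' => hz3 (p.injective (h'.trans hd.symm))
  by_cases hz6 : p (flip z) = flip d
  · simp only [Equiv.Perm.mul_apply, hz6, hz1, hz2, or_true, or_false, if_true, if_false]
    exact ⟨1, by simp [Equiv.Perm.skip_apply_of_eq hz6]⟩
  · simp only [Equiv.Perm.mul_apply, hz6, hz1, hz2, hz5, or_false, if_false]
    exact ⟨1, by simp [Equiv.Perm.skip_apply_of_ne hz6 hz4]⟩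

end OrientedMap

/-- On a finite type a cycle is a forward orbit, so closure of `T` under `p` alone suffices. -/
theorem Equiv.Perm.SameCycle.mem_of_forall {D : Type*} [Finite D] {p : Equiv.Perm D} {T : Set D}
    (hT : ∀ z ∈ T, p z ∈ T) {x y : D} (h : p.SameCycle x y) (hx : x ∈ T) : y ∈ T := by
  obtain ⟨n, rfl⟩ := h.exists_nat_pow_eq
  induction n with
  | zero => exact hx
  | succ n ih =>
    rw [pow_succ', Equiv.Perm.mul_apply]
    exact hT _ (ih ⟨n, by simp⟩)

/-! ### Contractions of maps and their invariants -/

namespace OrientedMap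

variable {V E : Type*}

local notation "flip" => Equiv.flipDart E

/-- The permutation whose orbits are the facial walks. -/
def facePerm (M : OrientedMap V E) : Equiv.Perm (E × Bool) := M.rot * flip

/-- The face to which a half-edge belongs. -/
def face (M : OrientedMap V E) (d : E × Bool) :
    Quotient (Equiv.Perm.SameCycle.setoid M.facePerm) := Quotient.mk _ d

theorem face_eq_iff {M : OrientedMap V E} {x y : E × Bool} :
    M.face x = M.face y ↔ M.facePerm.SameCycle x y := Quotient.eq

/-- The edges with exactly one end in `U`. -/
def cut (M : OrientedMap V E) (U : Set V) : Set E :=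
  {e | ∃ d : E × Bool, d.1 = e ∧ M.tail d ∈ U ∧ M.tail (flip d) ∉ U}

/-- The edge set `T` contains a cycle. -/
def HasCycle (M : OrientedMap V E) (T : Set E) : Prop :=
  ∃ n : ℕ, 1 ≤ n ∧ ∃ (x : ZMod n → V) (d : ZMod n → E × Bool),
    Function.Injective x ∧ Function.Injective (fun i => (d i).1) ∧
      ∀ i, (d i).1 ∈ T ∧ M.tail (d i) = x i ∧ M.tail (flip (d i)) = x (i + 1)

/-- The vertices `v` and `w` are connected by edges of `T`. -/
def Reach (M : OrientedMap V E) (T : Set E) : V → V → Prop :=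
  Relation.ReflTransGen fun v w => ∃ d : E × Bool, d.1 ∈ T ∧ M.tail d = v ∧ M.tail (flip d) = w

theorem Reach.symm {M : OrientedMap V E} {T : Set E} {v w : V} (h : M.Reach T v w) :
    M.Reach T w v := by
  induction h with
  | refl => exact .refl
  | tail h h' ih =>
    obtain ⟨d, hd, rfl, rfl⟩ := h'
    exact .head ⟨flip d, hd, rfl, by rw [flip_flip]⟩ ih

theorem Reach.mono {M : OrientedMap V E} {T T' : Set E} (hT : T ⊆ T') {v w : V}
    (h : M.Reach T v w) : M.Reach T' v w :=
  Relation.ReflTransGen.mono (fun _ _ ⟨d, hd, h⟩ => ⟨d, hT hd, h⟩) _ _ h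

/-- A partial contraction of a map: the face permutation of the live edges (which fixes the other
half-edges), labels for the vertices after the contraction, and the contracted edges. The edges
that are neither live nor contracted have been deleted. -/
structure Contraction (V E : Type*) where
  next : Equiv.Perm (E × Bool)
  live : Set E
  lab : V → ℕ
  sel : Set E

namespace Contraction

/-- The other edges of `S` when the edge of `d` is contracted or deleted. -/
noncomputable def remove (S : Contraction V E) (d : E × Bool) : Contraction V E :=
  { S with
    next := Equiv.Perm.skip (flip d) (Equiv.Perm.skip d S.next)
    live := S.live \ {d.1} }

/-- The contraction of the edge of `d`. -/
noncomputable def contract (M : OrientedMap V E) (S : Contraction V E) (d : E × Bool) :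
    Contraction V E :=
  { S.remove d with
    lab := fun v => if S.lab v = S.lab (M.tail d) then S.lab (M.tail (flip d)) else S.lab v
    sel := insert d.1 S.sel }

/-- The number of vertices of the contracted graph. -/
noncomputable def numVerts (S : Contraction V E) : ℕ := (Set.range S.lab).ncard

/-- The number of faces that contain live half-edges. -/
noncomputable def numFaces (M : OrientedMap V E) (S : Contraction V E) : ℕ :=
  (M.face '' {d | d.1 ∈ S.live}).ncard

/-- The properties of the contractions that arise when edges are contracted, and loops that bound a
face are deleted. -/
structure Good (M : OrientedMap V E) (S : Contraction V E) : Prop where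
  next_of_dead : ∀ d, d.1 ∉ S.live → S.next d = d
  lab_of_dead : ∀ d, d.1 ∉ S.live → S.lab (M.tail d) = S.lab (M.tail (flip d))
  lab_next : ∀ d, S.lab (M.tail (S.next d)) = S.lab (M.tail (flip d))
  sameCycle_of_lab : ∀ x y, x.1 ∈ S.live → y.1 ∈ S.live →
    S.lab (M.tail x) = S.lab (M.tail y) → (S.next * flip).SameCycle x y
  face_next : ∀ d, M.face (S.next d) = M.face d
  sameCycle_of_face : ∀ x y, x.1 ∈ S.live → y.1 ∈ S.live →
    M.face x = M.face y → S.next.SameCycle x y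
  sel_dead : ∀ e ∈ S.sel, e ∉ S.live
  reach : ∀ v w, S.lab v = S.lab w → M.Reach S.sel v w
  card : S.sel.ncard + S.numVerts = Nat.card V
  acyclic : ¬ M.HasCycle S.sel

variable {M : OrientedMap V E} {S : Contraction V E} {d : E × Bool}

/-- The trivial contraction. -/
def init (M : OrientedMap V E) (lab : V → ℕ) : Contraction V E where
  next := M.facePerm
  live := Set.univ
  lab := lab
  sel := ∅

/-- As `flip` is an involution, `facePerm * flip` is the rotation, whose cycles are the vertices. -/
theorem good_init {lab : V → ℕ} (hlab : Function.Injective lab) : Good M (init M lab) where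
  next_of_dead d hd := (hd trivial).elim
  lab_of_dead d hd := (hd trivial).elim
  lab_next d := by
    change lab _ = lab _
    congr 1
    rw [eq_comm, ← M.sameCycle_iff]
    exact ⟨1, by simp [init, facePerm]⟩
  sameCycle_of_lab x y _ _ h := by
    have : M.facePerm * flip = M.rot := by
      ext1 z; simp [facePerm, flip_flip]
    change (M.facePerm * flip).SameCycle x y
    rw [this, M.sameCycle_iff]
    exact hlab h
  face_next d := face_eq_iff.2 (Equiv.Perm.SameCycle.symm ⟨1, by simp [init]⟩)
  sameCycle_of_face x y _ _ h := face_eq_iff.1 h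
  sel_dead e he := he.elim
  reach v w h := by
    rw [hlab h]
    exact .refl
  card := by
    simp only [init, numVerts, Set.ncard_empty, zero_add]
    rw [← Set.image_univ, Set.ncard_image_of_injective _ hlab, Set.ncard_univ]
  acyclic := by
    rintro ⟨n, hn, x, d, -, -, h⟩
    exact (h 0).1

theorem next_remove_of_mem (hd : d.1 ∉ S.live → S.next d = d) {y : E × Bool}
    (hy : y.1 = d.1) : (S.remove d).next y = y := by
  rcases eq_or_eq_flip hy with rfl | rfl
  · have h1 := Equiv.Perm.skip_apply_self y S.next
    change Equiv.Perm.skip (flip y) (Equiv.Perm.skip y S.next) y = y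
    rw [Equiv.Perm.skip_apply_of_ne, h1]
    · rw [h1]; exact (flip_ne y).symm
    · exact (flip_ne y).symm
  · exact Equiv.Perm.skip_apply_self _ _

/-- The predecessor of `x` is now followed by `p x`. This half-edge starts at the label of the head
of `x`, which by `hx` is the label of the tail of `x`. -/
theorem lab_skip {lab : V → ℕ} {p : Equiv.Perm (E × Bool)}
    (h : ∀ y, lab (M.tail (p y)) = lab (M.tail (flip y))) {x : E × Bool}
    (hx : lab (M.tail x) = lab (M.tail (flip x))) (y : E × Bool) :
    lab (M.tail (p.skip x y)) = lab (M.tail (flip y)) := by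
  by_cases hy : y = x
  · subst hy; rw [Equiv.Perm.skip_apply_self, hx]
  by_cases hy' : p y = x
  · rw [Equiv.Perm.skip_apply_of_eq hy', h, ← hx, ← hy', h]
  · rw [Equiv.Perm.skip_apply_of_ne hy' hy, h]

theorem face_skip {p : Equiv.Perm (E × Bool)} (h : ∀ y, M.face (p y) = M.face y)
    (x y : E × Bool) : M.face (p.skip x y) = M.face y := by
  by_cases hy : y = x
  · subst hy; rw [Equiv.Perm.skip_apply_self]
  by_cases hy' : p y = x
  · rw [Equiv.Perm.skip_apply_of_eq hy', h, ← hy', h]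
  · rw [Equiv.Perm.skip_apply_of_ne hy' hy, h]

theorem Good.next_remove (hS : Good M S) (hd : d.1 ∈ S.live) (y : E × Bool)
    (hy : y.1 ∉ S.live \ {d.1}) : (S.remove d).next y = y := by
  by_cases h : y.1 = d.1
  · exact next_remove_of_mem (fun h => (h hd).elim) h
  · have hy' := hS.next_of_dead y fun h' => hy ⟨h', h⟩
    rw [← ne_eq, fst_ne_iff] at h
    change Equiv.Perm.skip (flip d) (Equiv.Perm.skip d S.next) y = y
    have h1 : Equiv.Perm.skip d S.next y = y := by
      rw [Equiv.Perm.skip_apply_of_ne (by rw [hy']; exact h.1) h.1, hy']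
    rw [Equiv.Perm.skip_apply_of_ne (by rw [h1]; exact h.2) h.2, h1]

theorem Good.sameCycle_remove (hS : Good M S) (x y : E × Bool) (hx : x.1 ∈ S.live \ {d.1})
    (hy : y.1 ∈ S.live \ {d.1}) (hxy : M.face x = M.face y) :
    (S.remove d).next.SameCycle x y := by
  have hx' := fst_ne_iff.1 (show x.1 ≠ d.1 from hx.2)
  have hy' := fst_ne_iff.1 (show y.1 ≠ d.1 from hy.2)
  exact ((hS.sameCycle_of_face x y hx.1 hy.1 hxy).skip hx'.1 hy'.1).skip hx'.2 hy'.2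

/-- The permutation `next * flip` is the vertex rotation of the contracted graph, and by `lab_next`
each of its steps preserves the label of the tail. -/
theorem Good.lab_eq_of_sameCycle [Finite E] (hS : Good M S) {x y : E × Bool}
    (h : (S.next * flip).SameCycle x y) : S.lab (M.tail y) = S.lab (M.tail x) := by
  refine h.mem_of_forall (T := {z | S.lab (M.tail z) = S.lab (M.tail x)}) (fun z hz => ?_) rfl
  simp only [Set.mem_ofPred_eq, Equiv.Perm.mul_apply] at hz ⊢
  rw [hS.lab_next, flip_flip, hz]

/-- A half-edge that forms a face on its own is a loop, so no labels have to be merged. As `d` is a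
fixed point of `next`, only `flip d` is really removed, which by `sameCycle_skip_flip` does not
split a vertex rotation. -/
theorem Good.prune (hS : Good M S) (hd : d.1 ∈ S.live) (hdd : S.next d = d) :
    Good M (S.remove d) := by
  have hl : S.lab (M.tail d) = S.lab (M.tail (flip d)) := by
    rw [← hS.lab_next, hdd]
  exact {
    next_of_dead := hS.next_remove hd
    lab_of_dead := fun y hy => by
      by_cases h : y.1 = d.1
      · rcases eq_or_eq_flip h with rfl | rfl
        · exact hl
        · rw [flip_flip]; exact hl.symm
      · exact hS.lab_of_dead y fun h' => hy ⟨h', h⟩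
    lab_next := lab_skip (lab_skip hS.lab_next hl) (by rw [flip_flip]; exact hl.symm)
    sameCycle_of_lab := fun x y hx hy hxy => by
      have := hS.sameCycle_of_lab x y hx.1 hy.1 hxy
      change (Equiv.Perm.skip (flip d) (Equiv.Perm.skip d S.next) * flip).SameCycle x y
      rw [Equiv.Perm.skip_of_fixed hdd]
      exact sameCycle_skip_flip hdd hx.2 hy.2 this
    face_next := face_skip (face_skip hS.face_next d) (flip d)
    sameCycle_of_face := hS.sameCycle_remove
    sel_dead := fun e he h => hS.sel_dead e he h.1
    reach := hS.reach
    card := hS.card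
    acyclic := hS.acyclic }

theorem lab_contract_of_eq {v w : V} (h : S.lab v = S.lab w) :
    (S.contract M d).lab v = (S.contract M d).lab w := by
  simp [contract, h]

theorem lab_contract_self :
    (S.contract M d).lab (M.tail d) = (S.contract M d).lab (M.tail (flip d)) := by
  simp [contract]

theorem lab_contract_cases {v w : V} (h : (S.contract M d).lab v = (S.contract M d).lab w) :
    S.lab v = S.lab w ∨
      ((S.lab v = S.lab (M.tail d) ∨ S.lab v = S.lab (M.tail (flip d))) ∧
        (S.lab w = S.lab (M.tail d) ∨ S.lab w = S.lab (M.tail (flip d)))) := by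
  simp only [contract] at h
  split_ifs at h with h1 h2 h2 <;> simp_all

theorem range_lab_contract (hd : S.lab (M.tail d) ≠ S.lab (M.tail (flip d))) :
    Set.range (S.contract M d).lab = Set.range S.lab \ {S.lab (M.tail d)} := by
  ext n
  constructor
  · rintro ⟨v, rfl⟩
    simp only [contract]
    split_ifs with h
    · exact ⟨⟨_, rfl⟩, hd.symm⟩
    · exact ⟨⟨_, rfl⟩, h⟩
  · rintro ⟨⟨v, rfl⟩, h⟩
    exact ⟨v, if_neg h⟩

theorem numVerts_contract [Finite V] (hd : S.lab (M.tail d) ≠ S.lab (M.tail (flip d))) :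
    (S.contract M d).numVerts + 1 = S.numVerts := by
  rw [numVerts, range_lab_contract hd]
  exact Set.ncard_sdiff_singleton_add_one ⟨_, rfl⟩ (Set.finite_range _)

/-- Removing `d` from its face multiplies the vertex rotation by the transposition of `d` and `next
d`. These belong to the rotations at the two ends of `d`, which are different since `d` is not a
loop, so that the two cycles merge. Afterwards `d` is fixed, and `flip d` can be removed without
splitting a cycle. -/
theorem Good.sameCycle_contract [Finite E] (hS : Good M S) (hd : d.1 ∈ S.live)
    (hl : S.lab (M.tail d) ≠ S.lab (M.tail (flip d))) (x y : E × Bool)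
    (hx : x.1 ∈ S.live \ {d.1}) (hy : y.1 ∈ S.live \ {d.1})
    (hxy : (S.contract M d).lab (M.tail x) = (S.contract M d).lab (M.tail y)) :
    ((S.remove d).next * flip).SameCycle x y := by
  classical
  set σ := S.next * flip with hσ
  have hσ' : Equiv.Perm.skip d S.next * flip = Equiv.swap d (S.next d) * σ := by
    rw [hσ, ← mul_assoc]
    congr 1
    rw [Equiv.Perm.skip]
    congr!
  have hfd : σ.SameCycle (flip d) (S.next d) := ⟨1, by simp [hσ, flip_flip]⟩
  have hab : ¬ σ.SameCycle d (S.next d) := fun h =>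
    hl (hS.lab_eq_of_sameCycle (h.trans hfd.symm)).symm
  have h1 : (Equiv.Perm.skip d S.next * flip).SameCycle x y := by
    rw [hσ']
    have hdd : (Equiv.swap d (S.next d) * σ).SameCycle d (flip d) := by
      have h := Equiv.Perm.swap_mul_sameCycle_self hab
      have h' := Equiv.Perm.swap_mul_sameCycle hab hfd.symm
      convert h.trans h'
    have hsub {z w : E × Bool} (h : σ.SameCycle z w) :
        (Equiv.swap d (S.next d) * σ).SameCycle z w := by
      convert Equiv.Perm.swap_mul_sameCycle hab h
    have hto {z : E × Bool} (hz : z.1 ∈ S.live) (h : S.lab (M.tail z) = S.lab (M.tail d) ∨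
        S.lab (M.tail z) = S.lab (M.tail (flip d))) :
        (Equiv.swap d (S.next d) * σ).SameCycle z d := by
      rcases h with h | h
      · exact hsub (hS.sameCycle_of_lab z d hz hd h)
      · exact (hsub (hS.sameCycle_of_lab z (flip d) hz hd h)).trans hdd.symm
    rcases lab_contract_cases hxy with h | ⟨h, h'⟩
    · exact hsub (hS.sameCycle_of_lab x y hx.1 hy.1 h)
    · exact (hto hx.1 h).trans (hto hy.1 h').symm
  exact sameCycle_skip_flip (Equiv.Perm.skip_apply_self _ _) hx.2 hy.2 h1

/-- A cycle through the new edge has all its other edges in `S.sel`, and these join vertices of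
equal label. Going round the cycle, the two ends of the new edge would have equal labels. -/
theorem Good.acyclic_contract (hS : Good M S)
    (hl : S.lab (M.tail d) ≠ S.lab (M.tail (flip d))) :
    ¬ M.HasCycle (insert d.1 S.sel) := by
  rintro ⟨n, hn, x, c, hx, hc, h⟩
  have : NeZero n := ⟨by omega⟩
  by_cases hex : ∃ i, (c i).1 = d.1
  · obtain ⟨i₀, hi₀⟩ := hex
    have hstep (i) (hi : i ≠ i₀) : S.lab (x (i + 1)) = S.lab (x i) := by
      obtain ⟨h1, h2, h3⟩ := h i
      rw [← h2, ← h3]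
      rcases h1 with h1 | h1
      · exact (hi (hc (h1.trans hi₀.symm))).elim
      · exact (hS.lab_of_dead _ (hS.sel_dead _ h1)).symm
    have hall (j : ℕ) (hj : j < n) : S.lab (x (i₀ + 1 + j)) = S.lab (x (i₀ + 1)) := by
      induction j with
      | zero => simp
      | succ j ih =>
        rw [← ih (by omega), ← hstep (i₀ + 1 + j)]
        · congr 2; push_cast; ring
        · intro h'
          have : ((j + 1 : ℕ) : ZMod n) = 0 := by
            have h'' : i₀ + 1 + (j : ZMod n) - i₀ = 0 := by rw [h', sub_self]
            rw [← h'']; push_cast; ring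
          rw [ZMod.natCast_eq_zero_iff] at this
          exact absurd (Nat.le_of_dvd (by omega) this) (by omega)
    -- From `i₀ + 1`, the vertex `i₀` is reached after `n - 1` steps.
    have hlast := hall (n - 1) (by omega)
    have hi : i₀ + 1 + ((n - 1 : ℕ) : ZMod n) = i₀ := by
      have : ((n - 1 : ℕ) : ZMod n) + 1 = 0 := by
        rw [← Nat.cast_succ, Nat.succ_eq_add_one, Nat.sub_add_cancel hn, ZMod.natCast_self]
      rw [add_assoc, add_comm 1, this, add_zero]
    rw [hi] at hlast
    obtain ⟨-, h2, h3⟩ := h i₀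
    rw [← h2, ← h3] at hlast
    rcases eq_or_eq_flip hi₀ with h' | h'
    · rw [h'] at hlast; exact hl hlast
    · rw [h', flip_flip] at hlast; exact hl hlast.symm
  · push Not at hex
    exact hS.acyclic ⟨n, hn, x, c, hx, hc, fun i => ⟨((h i).1).resolve_left (hex i), (h i).2⟩⟩

theorem Good.contract [Finite V] [Finite E] (hS : Good M S) (hd : d.1 ∈ S.live)
    (hl : S.lab (M.tail d) ≠ S.lab (M.tail (flip d))) :
    Good M (S.contract M d) := by
  exact {
    next_of_dead := hS.next_remove hd
    lab_of_dead := fun y hy => by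
      by_cases h : y.1 = d.1
      · rcases eq_or_eq_flip h with rfl | rfl
        · exact lab_contract_self
        · rw [flip_flip]; exact lab_contract_self.symm
      · exact lab_contract_of_eq (hS.lab_of_dead y fun h' => hy ⟨h', h⟩)
    lab_next := lab_skip (lab_skip (fun y => lab_contract_of_eq (hS.lab_next y))
      lab_contract_self) (by rw [flip_flip]; exact lab_contract_self.symm)
    sameCycle_of_lab := hS.sameCycle_contract hd hl
    face_next := face_skip (face_skip hS.face_next d) (flip d)
    sameCycle_of_face := hS.sameCycle_remove
    sel_dead := by
      rintro e (rfl | he)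
      · exact fun h => h.2 rfl
      · exact fun h => hS.sel_dead e he h.1
    reach := fun v w h => by
      have hsub {v w : V} (h : S.lab v = S.lab w) : M.Reach (insert d.1 S.sel) v w :=
        (hS.reach v w h).mono (Set.subset_insert _ _)
      have hdd : M.Reach (insert d.1 S.sel) (M.tail d) (M.tail (flip d)) :=
        .single ⟨d, Set.mem_insert _ _, rfl, rfl⟩
      have hto {v : V} (h : S.lab v = S.lab (M.tail d) ∨ S.lab v = S.lab (M.tail (flip d))) :
          M.Reach (insert d.1 S.sel) v (M.tail d) := by
        rcases h with h | h
        · exact hsub h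
        · exact (hsub h).trans hdd.symm
      rcases lab_contract_cases h with h | ⟨h, h'⟩
      · exact hsub h
      · exact (hto h).trans (hto h').symm
    card := by
      have h1 := numVerts_contract (S := S) hl
      have h2 : (insert d.1 S.sel).ncard = S.sel.ncard + 1 :=
        Set.ncard_insert_of_notMem (fun h => hS.sel_dead _ h hd) (Set.toFinite _)
      have h3 := hS.card
      change (insert d.1 S.sel).ncard + _ = _
      omega
    acyclic := hS.acyclic_contract hl }

end Contraction

end OrientedMap

/-! ### Digons, the Euler characteristic, and edges with long arms -/

namespace OrientedMap

variable {V E : Type*}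

local notation "flip" => Equiv.flipDart E

/-- Every cut with two non-empty sides contains at least `k` edges. -/
def IsEdgeConnected (M : OrientedMap V E) (k : ℕ) : Prop :=
  ∀ U : Set V, U.Nonempty → U ≠ Set.univ → k ≤ (M.cut U).ncard

namespace Contraction

/-- If the face of the half-edge `y` is a digon, then this is the parallel half-edge. -/
def across (S : Contraction V E) (y : E × Bool) : E × Bool := flip (S.next y)

/-- There are `r` further edges in a sequence of digons that starts at `d`. -/
def HasArm (S : Contraction V E) (d : E × Bool) (r : ℕ) : Prop :=
  ∀ s < r, S.next (S.next (S.across^[s] d)) = S.across^[s] d ∧ (S.across^[s + 1] d).1 ≠ d.1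

/-- There are `r` further edges in sequences of digons on both sides of `d`. -/
def HasArms (S : Contraction V E) (d : E × Bool) (r : ℕ) : Prop :=
  S.HasArm d r ∧ S.HasArm (flip d) r

/-- The edge of `d` is a loop of the contracted graph. -/
def IsLoop (M : OrientedMap V E) (S : Contraction V E) (d : E × Bool) : Prop :=
  S.lab (M.tail d) = S.lab (M.tail (flip d))

/-- No live half-edge is a face on its own. -/
def Leafless (S : Contraction V E) : Prop := ∀ y : E × Bool, y.1 ∈ S.live → S.next y ≠ y

/-- The steps of the algorithm: if possible, delete a loop that bounds a face, or else contract an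
edge in the middle of a longest sequence of digons. -/
inductive Step (M : OrientedMap V E) (S : Contraction V E) : Contraction V E → Prop
  | prune (d : E × Bool) (hd : d.1 ∈ S.live) (h : S.next d = d) : Step M S (S.remove d)
  | contract (d : E × Bool) (hd : d.1 ∈ S.live) (hl : ¬ S.IsLoop M d) (h : S.Leafless)
      (hmax : ∀ r < Nat.card E, (∃ d', d'.1 ∈ S.live ∧ ¬ S.IsLoop M d' ∧ S.HasArms d' r) →
        S.HasArms d r) : Step M S (S.contract M d)
  | idle (h : S.Leafless) (hl : ∀ d, d.1 ∈ S.live → S.IsLoop M d) : Step M S S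

variable {M : OrientedMap V E} {S S' : Contraction V E} {d : E × Bool}

theorem Step.good [Finite V] [Finite E] (h : Step M S S') (hS : Good M S) : Good M S' := by
  cases h with
  | prune d hd h => exact hS.prune hd h
  | contract d hd hl => exact hS.contract hd hl
  | idle => exact hS

theorem across_injective (S : Contraction V E) : Function.Injective S.across :=
  (flip).injective.comp S.next.injective

theorem flip_across (y : E × Bool) : flip (S.across y) = S.next y := flip_flip _

theorem Good.next_mem_live (hS : Good M S) (hd : d.1 ∈ S.live) : (S.next d).1 ∈ S.live := by
  by_contra h
  have := S.next.injective (hS.next_of_dead _ h)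
  rw [this] at h
  exact h hd

theorem Good.across_mem_live (hS : Good M S) (hd : d.1 ∈ S.live) : (S.across d).1 ∈ S.live :=
  hS.next_mem_live hd

theorem Good.lab_flip_across (hS : Good M S) (y : E × Bool) :
    S.lab (M.tail (flip (S.across y))) = S.lab (M.tail (flip y)) := by
  rw [flip_across, hS.lab_next]

theorem Good.lab_across (hS : Good M S) {y : E × Bool} (hy : S.next (S.next y) = y) :
    S.lab (M.tail (S.across y)) = S.lab (M.tail y) := by
  rw [across, ← hS.lab_next, hy]

/-- If a live edge forms a component of the contracted graph, then there are no vertices other than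
its ends. -/
theorem Good.lab_of_isolated [Finite E] (hS : Good M S) (hM : M.IsEdgeConnected 1)
    {x : E × Bool} (hx : x.1 ∈ S.live) (h1 : (S.next (flip x)).1 = x.1) (h2 : (S.next x).1 = x.1)
    (v : V) : S.lab v = S.lab (M.tail x) ∨ S.lab v = S.lab (M.tail (flip x)) := by
  set U : Set V := {v | S.lab v = S.lab (M.tail x) ∨ S.lab v = S.lab (M.tail (flip x))} with hU
  by_contra hv
  have hU1 : U.Nonempty := ⟨M.tail x, Or.inl rfl⟩
  have hU2 : U ≠ Set.univ := fun h => hv (by rw [Set.eq_univ_iff_forall] at h; exact h v)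
  -- An edge leaving `U` is live, because dead edges join equal labels. It occurs in the rotation at
  -- an end of `x`, but by `h1` and `h2` these rotations contain only the half-edges of `x`.
  obtain ⟨_, z, rfl, hz1, hz2⟩ : (M.cut U).Nonempty :=
    (Set.ncard_pos (Set.toFinite _)).1 (hM U hU1 hU2)
  have hz : z.1 ∈ S.live := by
    by_contra h
    have := hS.lab_of_dead z h
    simp only [hU, Set.mem_ofPred_eq] at hz1 hz2
    rw [← this] at hz2
    exact hz2 hz1
  have hT : ∀ y ∈ {y : E × Bool | y.1 = x.1}, (S.next * flip) y ∈ {y : E × Bool | y.1 = x.1} := by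
    intro y hy
    rcases eq_or_eq_flip hy with rfl | rfl
    · exact h1
    · simpa [flip_flip] using h2
  have hzx : z.1 = x.1 := by
    rcases hz1 with h | h
    · exact (hS.sameCycle_of_lab x z hx hz h.symm).mem_of_forall hT rfl
    · exact (hS.sameCycle_of_lab (flip x) z hx hz h.symm).mem_of_forall hT rfl
  rcases eq_or_eq_flip hzx with rfl | rfl
  · exact hz2 (Or.inr rfl)
  · rw [flip_flip] at hz2; exact hz2 (Or.inl rfl)

theorem numVerts_le_one (h : ∀ v w, S.lab v = S.lab w) : S.numVerts ≤ 1 := by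
  have hs : (Set.range S.lab).Subsingleton := by
    rintro _ ⟨v, rfl⟩ _ ⟨w, rfl⟩
    exact h v w
  exact (Set.ncard_le_one hs.finite).2 fun a ha b hb => hs ha hb

/-- A face is counted as long as it contains a live half-edge, so it suffices that each face along
the removed edge has another one. -/
theorem numFaces_remove [Finite E] {T : Contraction V E}
    (hT : T.live = S.live \ {d.1}) (h : ∀ y : E × Bool, y.1 = d.1 →
      ∃ z : E × Bool, z.1 ∈ S.live ∧ z.1 ≠ d.1 ∧ M.face z = M.face y) : S.numFaces M ≤ T.numFaces M := by
  refine Set.ncard_le_ncard ?_ (Set.toFinite _)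
  rintro _ ⟨y, hy, rfl⟩
  by_cases hyd : y.1 = d.1
  · obtain ⟨z, hz, hzd, hzy⟩ := h y hyd
    exact ⟨z, by rw [Set.mem_ofPred_eq, hT]; exact ⟨hz, hzd⟩, hzy⟩
  · exact ⟨y, by rw [Set.mem_ofPred_eq, hT]; exact ⟨hy, hyd⟩, rfl⟩

/-- The Euler characteristic does not decrease. -/
theorem Step.euler_le [Finite V] [Finite E] (h : Step M S S') (hS : Good M S)
    (hM : M.IsEdgeConnected 1) (hn : 2 ≤ S'.numVerts) :
    (S.numVerts : ℤ) - S.live.ncard + S.numFaces M ≤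
      S'.numVerts - S'.live.ncard + S'.numFaces M := by
  cases h with
  | idle => exact le_rfl
  | prune d hd h =>
    have h1 : (S.live \ {d.1}).ncard + 1 = S.live.ncard :=
      Set.ncard_sdiff_singleton_add_one hd (Set.toFinite _)
    -- Only the face of `d` can be lost. The successor of `flip d` lies on another edge, since
    -- otherwise the loop would be a component of its own, and a single vertex would be left,
    -- contrary to `hn`.
    have h2 : S.numFaces M ≤ (S.remove d).numFaces M + 1 := by
      rw [numFaces, ← Set.ncard_singleton (M.face d)]
      refine (Set.ncard_le_ncard ?_ (Set.toFinite _)).trans (Set.ncard_union_le _ _)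
      rintro _ ⟨y, hy, rfl⟩
      by_cases hyd : y.1 = d.1
      · rcases eq_or_eq_flip hyd with rfl | rfl
        · exact Or.inr rfl
        · have hne : (S.next (flip d)).1 ≠ d.1 := by
            intro h'
            have := hS.lab_of_isolated hM hd h' (by rw [h])
            have hl : S.lab (M.tail d) = S.lab (M.tail (flip d)) := by rw [← hS.lab_next, h]
            rw [← hl] at this
            simp only [or_self] at this
            have := numVerts_le_one fun v w => (this v).trans (this w).symm
            exact absurd (hn.trans this) (by omega)
          exact Or.inl ⟨S.next (flip d), ⟨hS.next_mem_live hy, hne⟩, hS.face_next _⟩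
      · exact Or.inl ⟨y, ⟨hy, hyd⟩, rfl⟩
    change (S.numVerts : ℤ) - _ + _ ≤ S.numVerts - ((S.live \ {d.1}).ncard : ℕ) + _
    omega
  | contract d hd hl h =>
    have h1 : (S.live \ {d.1}).ncard + 1 = S.live.ncard :=
      Set.ncard_sdiff_singleton_add_one hd (Set.toFinite _)
    have h2 : S.numFaces M ≤ (S.contract M d).numFaces M := by
      refine numFaces_remove (d := d) rfl fun y hyd => ?_
      have hy : y.1 ∈ S.live := by rwa [hyd]
      by_cases hy1 : (S.next y).1 = d.1
      · by_cases hy2 : (S.next (S.next y)).1 = d.1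
        -- If the next two half-edges of the face belong to the same edge, then this edge is a whole
        -- component, and its contraction would leave a single vertex.
        · exfalso
          have hyf : S.next y = flip y :=
            (eq_or_eq_flip (hy1.trans hyd.symm)).resolve_left (h y hy)
          have h3 : (S.next (flip y)).1 = y.1 := by rw [← hyf, hy2, hyd]
          have := hS.lab_of_isolated hM hy h3 (hy1.trans hyd.symm)
          have h4 : (S.contract M d).lab (M.tail y) = (S.contract M d).lab (M.tail (flip y)) := by
            rcases eq_or_eq_flip hyd with rfl | rfl
            · exact lab_contract_self
            · rw [flip_flip]; exact lab_contract_self.symm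
          have h5 (v : V) : (S.contract M d).lab v = (S.contract M d).lab (M.tail y) := by
            rcases this v with h' | h'
            · exact lab_contract_of_eq h'
            · rw [h4]; exact lab_contract_of_eq h'
          have := numVerts_le_one fun v w => (h5 v).trans (h5 w).symm
          omega
        · exact ⟨_, hS.next_mem_live (hS.next_mem_live hy), hy2, by rw [hS.face_next, hS.face_next]⟩
      · exact ⟨_, hS.next_mem_live hy, hy1, hS.face_next _⟩
    have h3 := numVerts_contract (S := S) (M := M) hl
    have h4 : (S.contract M d).live = S.live \ {d.1} := rfl
    rw [h4]
    omega

/-- Double counting of the half-edges in faces. -/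
theorem Good.six_mul_numFaces_le [Finite E] (hS : Good M S) (h : S.Leafless) :
    6 * S.numFaces M + {y : E × Bool | y.1 ∈ S.live ∧ S.next (S.next y) ≠ y}.ncard ≤
      6 * S.live.ncard := by
  classical
  have := Fintype.ofFinite E
  set Y : Finset (E × Bool) := {y | y.1 ∈ S.live} with hY
  -- The weights sum up to 6 for each live edge minus 1 for each half-edge outside digons. Every
  -- face receives at least 6: a digon 3 + 3, a longer face at least 2 + 2 + 2.
  set w : E × Bool → ℕ := fun y => if S.next (S.next y) = y then 3 else 2 with hw
  have hF : S.numFaces M = (Y.image M.face).card := by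
    rw [numFaces, ← Set.ncard_coe_finset]
    congr 1
    ext; simp [hY]
  have hT : {y : E × Bool | y.1 ∈ S.live ∧ S.next (S.next y) ≠ y}.ncard =
      (Y.filter fun y => S.next (S.next y) ≠ y).card := by
    rw [← Set.ncard_coe_finset]
    congr 1
    ext; simp [hY]
  have hL : Y.card = 2 * S.live.ncard := by
    have : Y = (Finset.univ.filter (· ∈ S.live)) ×ˢ Finset.univ := by
      ext; simp [hY]
    rw [this, Finset.card_product, ← Set.ncard_coe_finset]
    simp [mul_comm]
  have h1 : ∑ y ∈ Y, w y + (Y.filter fun y => S.next (S.next y) ≠ y).card = 3 * Y.card := by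
    rw [Finset.card_filter, ← Finset.sum_add_distrib, mul_comm, ← smul_eq_mul, ← Finset.sum_const]
    refine Finset.sum_congr rfl fun y _ => ?_
    simp only [hw]
    split_ifs <;> simp_all
  have h2 : (Y.image M.face).card • 6 ≤ ∑ f ∈ Y.image M.face, ∑ y ∈ Y with M.face y = f, w y := by
    refine Finset.card_nsmul_le_sum _ _ _ fun f hf => ?_
    obtain ⟨y, hy, rfl⟩ := Finset.mem_image.1 hf
    have hyl : y.1 ∈ S.live := by simpa [hY] using hy
    have hn1 := h y hyl
    have hyl1 := hS.next_mem_live hyl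
    have hn2 := h _ hyl1
    have hyl2 := hS.next_mem_live hyl1
    by_cases hyy : S.next (S.next y) = y
    · have hsub : ({y, S.next y} : Finset (E × Bool)) ⊆ Y.filter (M.face · = M.face y) := by
        intro z hz
        simp only [Finset.mem_insert, Finset.mem_singleton] at hz
        rcases hz with rfl | rfl <;> simp [hY, hyl, hyl1, hS.face_next]
      refine le_trans ?_ (Finset.sum_le_sum_of_subset hsub)
      rw [Finset.sum_pair hn1.symm]
      simp [hw, hyy]
    · have hsub : ({y, S.next y, S.next (S.next y)} : Finset (E × Bool)) ⊆
          Y.filter (M.face · = M.face y) := by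
        intro z hz
        simp only [Finset.mem_insert, Finset.mem_singleton] at hz
        rcases hz with rfl | rfl | rfl <;> simp [hY, hyl, hyl1, hyl2, hS.face_next]
      refine le_trans ?_ (Finset.sum_le_sum_of_subset hsub)
      have hw2 (z) : 2 ≤ w z := by simp only [hw]; split_ifs <;> omega
      rw [Finset.sum_insert (by simp [hn1.symm, Ne.symm hyy]), Finset.sum_pair hn2.symm]
      linarith [hw2 y, hw2 (S.next y), hw2 (S.next (S.next y))]
  rw [Finset.sum_fiberwise_of_maps_to (fun y hy => Finset.mem_image_of_mem _ hy)] at h2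
  rw [hF, hT]
  rw [smul_eq_mul] at h2
  omega

theorem Good.iterate_across (hS : Good M S) {x : E × Bool} (hx : x.1 ∈ S.live) {n : ℕ}
    (h : ∀ s < n, S.next (S.next (S.across^[s] x)) = S.across^[s] x) {s : ℕ} (hs : s ≤ n) :
    (S.across^[s] x).1 ∈ S.live ∧ S.lab (M.tail (S.across^[s] x)) = S.lab (M.tail x) ∧
      S.lab (M.tail (flip (S.across^[s] x))) = S.lab (M.tail (flip x)) := by
  induction s with
  | zero => exact ⟨hx, rfl, rfl⟩
  | succ s ih =>
    obtain ⟨h1, h2, h3⟩ := ih (by omega)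
    rw [Function.iterate_succ_apply']
    exact ⟨hS.across_mem_live h1, (hS.lab_across (h s (by omega))).trans h2,
      (hS.lab_flip_across _).trans h3⟩

/-- A vertex of the contracted graph with few ends of sequences of digons is the end of an edge that
is not a loop and at which a long sequence of digons starts. -/
theorem Good.exists_long_sequence [Finite V] [Finite E] (hS : Good M S) (hl : S.Leafless) {k : ℕ}
    (hM : M.IsEdgeConnected k) (hn : 2 ≤ S.numVerts) {γ : ℕ}
    (hχ : (2 : ℤ) - 2 * γ ≤ S.numVerts - S.live.ncard + S.numFaces M) {D : ℕ}
    (hD : 6 * S.numVerts + 12 * γ < 12 + S.numVerts * (D + 1)) {l : ℕ} (hlk : D * l < k) :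
    ∃ x : E × Bool, x.1 ∈ S.live ∧ ¬ S.IsLoop M x ∧
      (∀ s < l, S.next (S.next (S.across^[s] x)) = S.across^[s] x) ∧
      k ≤ {y : E × Bool | y.1 ∈ S.live ∧ S.lab (M.tail y) = S.lab (M.tail x)}.ncard := by
  classical
  have := Fintype.ofFinite E
  set T : Finset (E × Bool) := {y | y.1 ∈ S.live ∧ S.next (S.next y) ≠ y} with hT
  have hfin : (Set.range S.lab).Finite := Set.finite_range _
  set C : Finset ℕ := hfin.toFinset with hC
  have hCn : C.card = S.numVerts := by
    rw [numVerts, Set.ncard_eq_toFinset_card _ hfin]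
  have hTcard : T.card < C.card * (D + 1) := by
    have h1 := hS.six_mul_numFaces_le hl
    have h2 : {y : E × Bool | y.1 ∈ S.live ∧ S.next (S.next y) ≠ y}.ncard = T.card := by
      rw [← Set.ncard_coe_finset]
      congr 1
      ext; simp [hT]
    rw [h2] at h1
    rw [hCn]
    zify at *
    linarith
  -- By Euler's formula the average number of half-edges in `T` per vertex is less than `D + 1`, so
  -- some vertex `c` has at most `D` of them.
  obtain ⟨c, hc, hcD⟩ := Finset.exists_card_fiber_lt_of_card_lt_mul
    (f := fun y : E × Bool => S.lab (M.tail y)) hTcard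
  set N : Finset (E × Bool) := {y | y.1 ∈ S.live ∧ S.lab (M.tail y) = c ∧
    S.lab (M.tail (flip y)) ≠ c} with hN
  have hkN : k ≤ N.card := by
    refine (hM {v | S.lab v = c} ?_ ?_).trans ?_
    · obtain ⟨v, hv⟩ := hfin.mem_toFinset.1 hc
      exact ⟨v, hv⟩
    · intro h
      rw [Set.eq_univ_iff_forall] at h
      have := numVerts_le_one fun v w => (h v).trans (h w).symm
      omega
    · refine le_trans ?_ (Finset.card_image_le (s := N) (f := Prod.fst))
      rw [← Set.ncard_coe_finset]
      refine Set.ncard_le_ncard ?_ (Set.toFinite _)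
      rintro _ ⟨z, rfl, hz1, hz2⟩
      simp only [Finset.coe_image, Set.mem_image, Finset.mem_coe]
      refine ⟨z, ?_, rfl⟩
      simp only [hN, Finset.mem_filter, Finset.mem_univ, true_and]
      refine ⟨?_, hz1, hz2⟩
      by_contra h
      have := hS.lab_of_dead z h
      exact hz2 (this.symm.trans hz1)
  obtain ⟨x, hx, hxl⟩ : ∃ x ∈ N, ∀ s < l, S.next (S.next (S.across^[s] x)) = S.across^[s] x := by
    -- If each half-edge of `N` reached a half-edge of `T` in fewer than `l` crossings, then it
    -- would be determined by that half-edge and the number of crossings, as `across` is injective.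
    -- Crossing a digon does not change the tail, so there are at most `D * l < k` such pairs.
    by_contra! hcon
    choose! h hh1 hh2 using fun x hx => (⟨Nat.find (hcon x hx), Nat.find_spec (hcon x hx),
      fun m hm => Nat.find_min (hcon x hx) hm⟩ : ∃ s, (s < l ∧
        S.next (S.next (S.across^[s] x)) ≠ S.across^[s] x) ∧ ∀ m < s, ¬ (m < l ∧
        S.next (S.next (S.across^[m] x)) ≠ S.across^[m] x))
    have hcard := Finset.card_le_card_of_injOn (s := N)
      (t := (T.filter fun y => S.lab (M.tail y) = c) ×ˢ Finset.range l)
      (fun x => (S.across^[h x] x, h x)) ?_ ?_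
    · rw [Finset.card_product, Finset.card_range] at hcard
      have : (T.filter fun y => S.lab (M.tail y) = c).card * l ≤ D * l :=
        Nat.mul_le_mul_right _ (by omega)
      omega
    · intro x hx
      obtain ⟨h1, h2⟩ := hh1 x hx
      have hxN := hx
      simp only [hN, Finset.mem_coe, Finset.mem_filter, Finset.mem_univ, true_and] at hxN
      have h3 := hS.iterate_across hxN.1 (n := h x) (fun s hs => by
        have := hh2 x hx s hs
        push Not at this
        exact this (hs.trans h1)) le_rfl
      simp only [Finset.coe_product, Set.mem_prod, Finset.mem_coe, Finset.mem_filter,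
        Finset.mem_range, hT, Finset.mem_univ, true_and]
      exact ⟨⟨⟨h3.1, h2⟩, h3.2.1.trans hxN.2.1⟩, h1⟩
    · intro x _ y _ hxy
      simp only [Prod.mk.injEq] at hxy
      rw [hxy.2] at hxy
      exact S.across_injective.iterate _ hxy.1
  simp only [hN, Finset.mem_filter, Finset.mem_univ, true_and] at hx
  refine ⟨x, hx.1, fun h => hx.2.2 (h.symm.trans hx.2.1), hxl, hkN.trans ?_⟩
  rw [← Set.ncard_coe_finset]
  refine Set.ncard_le_ncard ?_ (Set.toFinite _)
  intro y hy
  simp only [hN, Finset.coe_filter, Finset.mem_univ, true_and, Set.mem_ofPred_eq] at hy ⊢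
  exact ⟨hy.1, hy.2.1.trans hx.2.1.symm⟩

/-- The middle of a sequence of digons has arms of about half its length. -/
theorem Good.hasArms_iterate [Finite E] (hS : Good M S) {x : E × Bool} (hx : x.1 ∈ S.live)
    (hxl : ¬ S.IsLoop M x) {r : ℕ}
    (h : ∀ s < 2 * r, S.next (S.next (S.across^[s] x)) = S.across^[s] x)
    (hr : r < {y : E × Bool | y.1 ∈ S.live ∧ S.lab (M.tail y) = S.lab (M.tail x)}.ncard) :
    S.HasArms (S.across^[r] x) r := by
  -- On these digons `next * flip` undoes `across`. If `across` returned to `x` after `p` crossings,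
  -- then the rotation at the tail of `x` would consist of `p ≤ r` half-edges, which contradicts
  -- `hr`.
  have hper : ∀ p, 1 ≤ p → p ≤ r → S.across^[p] x ≠ x := by
    intro p hp1 hp h0
    refine hr.not_ge ?_
    have hT : ∀ y ∈ (fun s => S.across^[s] x) '' (Finset.range p : Set ℕ),
        (S.next * flip) y ∈ (fun s => S.across^[s] x) '' (Finset.range p : Set ℕ) := by
      have key (s : ℕ) (hs : s < p) :
          (S.next * flip) (S.across^[s + 1] x) = S.across^[s] x := by
        rw [Function.iterate_succ_apply', Equiv.Perm.mul_apply, flip_across, h s (by omega)]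
      rintro _ ⟨s, hs, rfl⟩
      rcases s with _ | s
      · refine ⟨p - 1, by simp; omega, ?_⟩
        have := key (p - 1) (by omega)
        rw [Nat.sub_add_cancel hp1, h0] at this
        exact this.symm
      · simp only [Finset.coe_range, Set.mem_Iio] at hs
        exact ⟨s, by simp; omega, (key s (by omega)).symm⟩
    calc _ ≤ ((fun s => S.across^[s] x) '' (Finset.range p : Set ℕ)).ncard := by
          refine Set.ncard_le_ncard ?_ (Set.toFinite _)
          rintro y ⟨hy, hyx⟩
          exact (hS.sameCycle_of_lab x y hx hy hyx.symm).mem_of_forall hT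
            ⟨0, by simp; omega, rfl⟩
      _ ≤ (Finset.range p : Set ℕ).ncard := Set.ncard_image_le (Set.toFinite _)
      _ ≤ r := by rw [Set.ncard_coe_finset, Finset.card_range]; exact hp
  -- Two equal half-edges would give a period of at most `r`; two opposite ones would make `x` a
  -- loop.
  have hne : ∀ s t, s < t → t ≤ 2 * r → t ≤ s + r →
      (S.across^[s] x).1 ≠ (S.across^[t] x).1 := by
    intro s t hst ht htr he
    rcases eq_or_eq_flip he with he | he
    · obtain ⟨p, rfl⟩ := Nat.exists_eq_add_of_lt hst
      rw [add_assoc, Function.iterate_add_apply] at he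
      exact hper _ (by omega) (by omega) (S.across_injective.iterate _ he).symm
    · have h1 := (hS.iterate_across hx h (show s ≤ 2 * r by omega)).2.1
      have h2 := (hS.iterate_across hx h ht).2.2
      rw [← he, h1] at h2
      exact hxl h2
  constructor
  · intro s hs
    rw [← Function.iterate_add_apply, ← Function.iterate_add_apply]
    exact ⟨h _ (by omega), (hne r (s + 1 + r) (by omega) (by omega) (by omega)).symm⟩
  -- Starting from the other half of the middle edge, `across` retraces the sequence towards `x`.
  · have hback : ∀ s ≤ r, S.across^[s] (flip (S.across^[r] x)) = flip (S.across^[r - s] x) := by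
      intro s hs
      induction s with
      | zero => rfl
      | succ s ih =>
        obtain ⟨j, hj⟩ : ∃ j, r - s = j + 1 := ⟨r - s - 1, by omega⟩
        rw [Function.iterate_succ_apply', ih (by omega), hj, Function.iterate_succ_apply',
          flip_across, across, h j (by omega), show r - (s + 1) = j by omega]
    intro s hs
    rw [hback s (by omega), hback (s + 1) (by omega)]
    obtain ⟨j, hj⟩ : ∃ j, r - s = j + 1 := ⟨r - s - 1, by omega⟩
    rw [show r - (s + 1) = j by omega, hj]
    refine ⟨?_, hne j r (by omega) (by omega) (by omega)⟩
    rw [Function.iterate_succ_apply', flip_across, h j (by omega)]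

/-- There is an edge with long arms. -/
theorem Good.exists_hasArms [Finite V] [Finite E] (hS : Good M S) (hl : S.Leafless) {k : ℕ}
    (hk : 0 < k) (hM : M.IsEdgeConnected k) (hn : 2 ≤ S.numVerts) {γ : ℕ}
    (hχ : (2 : ℤ) - 2 * γ ≤ S.numVerts - S.live.ncard + S.numFaces M) {D : ℕ} (hD0 : 0 < D)
    (hD : 6 * S.numVerts + 12 * γ < 12 + S.numVerts * (D + 1)) :
    ∃ r < Nat.card E, k ≤ 2 * (r + 1) * D ∧
      ∃ d : E × Bool, d.1 ∈ S.live ∧ ¬ S.IsLoop M d ∧ S.HasArms d r := by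
  -- This is the largest `l` with `D * l < k`. Arms of length `r = l / 2` then satisfy `k ≤ D * (l +
  -- 1) ≤ 2 * (r + 1) * D`.
  obtain ⟨l, hld⟩ : ∃ l, l = (k - 1) / D := ⟨_, rfl⟩
  have hlk : D * l < k := by
    rw [hld]
    exact (Nat.mul_div_le _ _).trans_lt (by omega)
  have hlk' : k ≤ D * (l + 1) := by
    have := Nat.lt_mul_div_succ (k - 1) hD0
    rw [← hld] at this
    omega
  have hl' : l < k := lt_of_le_of_lt (Nat.le_mul_of_pos_left _ hD0) hlk
  obtain ⟨x, hx, hxl, hxs, hxk⟩ := hS.exists_long_sequence hl hM hn hχ hD hlk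
  refine ⟨l / 2, ?_, ?_, _, ?_, ?_,
    hS.hasArms_iterate hx hxl (r := l / 2) (fun s hs => hxs s (by omega)) (by omega)⟩
  -- The algorithm only tries lengths below the number of edges; here `l < k` is bounded by the size
  -- of a cut.
  · have hU1 : {v | S.lab v = S.lab (M.tail x)}.Nonempty := ⟨M.tail x, rfl⟩
    have hU2 : {v | S.lab v = S.lab (M.tail x)} ≠ Set.univ := fun h => by
      rw [Set.eq_univ_iff_forall] at h
      exact hxl (h (M.tail (flip x))).symm
    have := hM _ hU1 hU2
    have h2 := Set.ncard_le_card (M.cut {v | S.lab v = S.lab (M.tail x)})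
    omega
  · refine hlk'.trans ?_
    rw [mul_comm D]
    exact Nat.mul_le_mul_right _ (by omega)
  · exact (hS.iterate_across hx hxs (show l / 2 ≤ l by omega)).1
  · have h1 := (hS.iterate_across hx hxs (show l / 2 ≤ l by omega)).2
    unfold IsLoop
    rw [h1.1, h1.2]
    exact hxl

end Contraction

end OrientedMap

/-! ### Cuts as cycles in the dual, and thinness of the contracted edges -/

namespace OrientedMap

variable {V E : Type*}

local notation "flip" => Equiv.flipDart E

theorem tail_facePerm (M : OrientedMap V E) (d : E × Bool) :
    M.tail (M.facePerm d) = M.tail (flip d) := by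
  rw [eq_comm, ← M.sameCycle_iff]
  exact ⟨1, by simp [facePerm]⟩

theorem face_facePerm (M : OrientedMap V E) (d : E × Bool) :
    M.face (M.facePerm d) = M.face d :=
  face_eq_iff.2 (Equiv.Perm.SameCycle.symm ⟨1, by simp⟩)

/-- The half-edges that leave `U`. -/
def outDarts (M : OrientedMap V E) (U : Set V) : Set (E × Bool) :=
  {d | M.tail d ∈ U ∧ M.tail (flip d) ∉ U}

/-- Each face leaves `U` as often as it enters `U`. -/
theorem card_outDarts_face [Finite E] (M : OrientedMap V E) (U : Set V)
    (F : Quotient (Equiv.Perm.SameCycle.setoid M.facePerm)) :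
    Nat.card {d : E × Bool // d ∈ M.outDarts U ∧ M.face d = F} =
      Nat.card {d : E × Bool // flip d ∈ M.outDarts U ∧ M.face d = F} := by
  -- The face permutation maps the half-edges of `F` with head in `U` onto those with tail in `U`.
  -- Discarding the half-edges with both ends in `U` from the two sets leaves those that enter and
  -- those that leave `U`.
  have h1 : {d | M.tail (flip d) ∈ U ∧ M.face d = F}.ncard =
      {d | M.tail d ∈ U ∧ M.face d = F}.ncard := by
    rw [← Set.ncard_image_of_injective _ M.facePerm.injective]
    congr 1
    ext d
    constructor
    · rintro ⟨d, ⟨h, h'⟩, rfl⟩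
      exact ⟨by rwa [tail_facePerm], by rwa [face_facePerm]⟩
    · rintro ⟨h, h'⟩
      obtain ⟨d, rfl⟩ := M.facePerm.surjective d
      rw [tail_facePerm] at h
      rw [face_facePerm] at h'
      exact ⟨d, ⟨h, h'⟩, rfl⟩
  have h2 (A B : Set (E × Bool)) : (A \ B).ncard + (A ∩ B).ncard = A.ncard := by
    rw [add_comm, Set.ncard_inter_add_ncard_sdiff_eq_ncard _ _ (Set.toFinite _)]
  have h3 := h2 {d | M.tail (flip d) ∈ U ∧ M.face d = F} {d | M.tail d ∈ U ∧ M.face d = F}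
  have h4 := h2 {d | M.tail d ∈ U ∧ M.face d = F} {d | M.tail (flip d) ∈ U ∧ M.face d = F}
  rw [Set.inter_comm] at h4
  have h5 : {d | d ∈ M.outDarts U ∧ M.face d = F} =
      {d | M.tail d ∈ U ∧ M.face d = F} \ {d | M.tail (flip d) ∈ U ∧ M.face d = F} := by
    ext d
    simp only [outDarts, Set.mem_ofPred_eq, Set.mem_sdiff]
    tauto
  have h6 : {d | flip d ∈ M.outDarts U ∧ M.face d = F} =
      {d | M.tail (flip d) ∈ U ∧ M.face d = F} \ {d | M.tail d ∈ U ∧ M.face d = F} := by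
    ext d
    simp only [outDarts, Set.mem_ofPred_eq, Set.mem_sdiff, flip_flip]
    tauto
  change Set.ncard {d | d ∈ M.outDarts U ∧ M.face d = F} =
    Set.ncard {d | flip d ∈ M.outDarts U ∧ M.face d = F}
  rw [h5, h6]
  omega

/-- The half-edges that leave `U` can be arranged in cycles such that consecutive half-edges lie in
a common face. -/
theorem exists_outDarts_perm [Finite E] (M : OrientedMap V E) (U : Set V) :
    ∃ g : M.outDarts U → M.outDarts U, Function.Injective g ∧
      ∀ d, M.face (flip (g d).1) = M.face d.1 := by
  -- In each face, outgoing half-edges are matched with incoming ones. Reversing the partner gives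
  -- an outgoing half-edge on the other side of its edge.
  let ε := fun F => Classical.choice (Finite.card_eq.1 (M.card_outDarts_face U F))
  refine ⟨fun d => ⟨flip (ε (M.face d.1) ⟨d.1, d.2, rfl⟩).1, (ε (M.face d.1) ⟨d.1, d.2, rfl⟩).2.1⟩,
    ?_, fun d => ?_⟩
  · rintro ⟨d, hd⟩ ⟨d', hd'⟩ h
    have h := (flip).injective (congrArg Subtype.val h)
    dsimp only at h
    have hf : M.face d = M.face d' := by
      rw [← (ε (M.face d) ⟨d, hd, rfl⟩).2.2, h, (ε (M.face d') ⟨d', hd', rfl⟩).2.2]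
    have key : ∀ F F' (h1 : M.face d = F) (h2 : M.face d' = F'), F = F' →
        (ε F ⟨d, hd, h1⟩).1 = (ε F' ⟨d', hd', h2⟩).1 → d = d' := by
      rintro F _ h1 h2 rfl h3
      simpa using (ε F).injective (Subtype.ext h3)
    exact Subtype.ext (key _ _ rfl rfl hf h)
  · dsimp only
    rw [flip_flip]
    exact (ε (M.face d.1) ⟨d.1, d.2, rfl⟩).2.2

/-- A sequence of half-edges of length `t` such that consecutive ones lie in a common face. -/
def IsTrail (M : OrientedMap V E) (x : ℕ → E × Bool) (t : ℕ) : Prop :=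
  ∀ s < t, M.face (flip (x (s + 1))) = M.face (x s) ∧ flip (x (s + 1)) ≠ x s

theorem IsTrail.reverse {M : OrientedMap V E} {x : ℕ → E × Bool} {t : ℕ} (h : M.IsTrail x t) :
    M.IsTrail (fun s => flip (x (t - s))) t := by
  intro s hs
  have := h (t - (s + 1)) (by omega)
  rw [show t - (s + 1) + 1 = t - s by omega] at this
  dsimp only
  rw [flip_flip]
  exact ⟨this.1.symm, this.2.symm⟩

namespace Contraction

variable {M : OrientedMap V E} {S S' : Contraction V E} {d : E × Bool} {r : ℕ}

/-- Steps that contract only edges with arms of length `r`. -/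
inductive ArmStep (M : OrientedMap V E) (r : ℕ) (S : Contraction V E) : Contraction V E → Prop
  | prune (d : E × Bool) (hd : d.1 ∈ S.live) (h : S.next d = d) : ArmStep M r S (S.remove d)
  | contract (d : E × Bool) (hd : d.1 ∈ S.live) (hl : ¬ S.IsLoop M d) (h : S.HasArms d r) :
      ArmStep M r S (S.contract M d)
  | idle : ArmStep M r S S

/-- The edge of `d` is contracted, or it may be contracted later. -/
def Selectable (M : OrientedMap V E) (S : Contraction V E) (d : E × Bool) : Prop :=
  d.1 ∈ S.sel ∨ d.1 ∈ S.live ∧ ¬ S.IsLoop M d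

theorem IsLoop.flip {x : E × Bool} (h : S.IsLoop M x) : S.IsLoop M (flip x) := by
  unfold IsLoop at *
  rw [flip_flip]
  exact h.symm

theorem ArmStep.sel_subset (h : ArmStep M r S S') : S.sel ⊆ S'.sel := by
  cases h with
  | prune d hd h => exact subset_rfl
  | contract d hd hl => exact Set.subset_insert _ _
  | idle => exact subset_rfl

/-- Selectability is never gained: live edges only disappear, labels only merge, and a contracted
edge was live and not a loop before. -/
theorem ArmStep.selectable (h : ArmStep M r S S') {x : E × Bool} (hx : S'.Selectable M x) :
    S.Selectable M x := by
  cases h with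
  | prune d hd h => exact hx.imp_right fun h => ⟨h.1.1, h.2⟩
  | contract d hd hl =>
    rcases hx with (hx | hx) | ⟨hx, hx'⟩
    · right
      refine ⟨by rwa [hx], ?_⟩
      rcases eq_or_eq_flip hx with rfl | rfl
      · exact hl
      · intro h
        have := h.flip
        rw [flip_flip] at this
        exact hl this
    · exact Or.inl hx
    · exact Or.inr ⟨hx.1, fun h => hx' (lab_contract_of_eq h)⟩
  | idle => exact hx

/-- Of the edges close to each other in a trail only one can be contracted. -/
def Spread (M : OrientedMap V E) (r : ℕ) (S : Contraction V E) : Prop :=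
  ∀ x t, 0 < t → t ≤ r → M.IsTrail x t → (∀ s, 0 < s → s < t → (x s).1 ∉ S.sel) →
    S.Selectable M (x 0) → S.Selectable M (x t) → ∀ s ≤ t, (x s).1 ∈ S.live

/-- Along an arm each face is a digon with only two live half-edges, so a trail of live edges has no
choice but to follow `across`. Hence `x t` is parallel to `d` and becomes a loop. It is not the edge
of `d` itself, since the definition of `HasArm` excludes a return to `d`. -/
theorem Good.not_selectable_contract [Finite E] (hS : Good M S) (h : S.HasArms d r)
    {x : ℕ → E × Bool} {t : ℕ} (ht : 0 < t) (htr : t ≤ r) (hx : M.IsTrail x t)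
    (hxl : ∀ s ≤ t, (x s).1 ∈ S.live) (h0 : (x 0).1 = d.1) :
    ¬ (S.contract M d).Selectable M (x t) := by
  have harm : S.HasArm (x 0) r := by
    rcases eq_or_eq_flip h0 with h0 | h0 <;> rw [h0]
    exacts [h.1, h.2]
  have hxs : ∀ s ≤ t, x s = S.across^[s] (x 0) ∧ S.lab (M.tail (x s)) = S.lab (M.tail (x 0)) ∧
      S.lab (M.tail (flip (x s))) = S.lab (M.tail (flip (x 0))) := by
    intro s hs
    induction s with
    | zero => exact ⟨rfl, rfl, rfl⟩
    | succ s ih =>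
      obtain ⟨ih1, ih2, ih3⟩ := ih (by omega)
      obtain ⟨hf, hne⟩ := hx s (by omega)
      have hnn : S.next (S.next (x s)) = x s := by
        rw [ih1]; exact (harm s (by omega)).1
      have hcyc := hS.sameCycle_of_face _ _ (hxl s (by omega))
        (show (flip (x (s + 1))).1 ∈ S.live from hxl _ hs) hf.symm
      have hmem := hcyc.mem_of_forall (T := {z | z = x s ∨ z = S.next (x s)})
        (by rintro z (rfl | rfl)
            · exact Or.inr rfl
            · exact Or.inl hnn) (Or.inl rfl)
      have hxx : x (s + 1) = S.across (x s) := by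
        rw [across, ← hmem.resolve_left hne, flip_flip]
      refine ⟨?_, ?_, ?_⟩
      · rw [Function.iterate_succ_apply', ← ih1, hxx]
      · rw [hxx, hS.lab_across hnn, ih2]
      · rw [hxx, hS.lab_flip_across, ih3]
  obtain ⟨h1, h2, h3⟩ := hxs t le_rfl
  have hne : (x t).1 ≠ d.1 := by
    obtain ⟨j, rfl⟩ := Nat.exists_eq_add_of_lt ht
    rw [zero_add] at *
    rw [h1, ← h0]
    exact (harm j (by omega)).2
  rintro ((h | h) | ⟨-, h⟩)
  · exact hne h
  · exact hS.sel_dead _ h (hxl t le_rfl)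
  · apply h
    unfold IsLoop
    rw [lab_contract_of_eq h2, lab_contract_of_eq h3]
    rcases eq_or_eq_flip h0 with h0 | h0 <;> rw [h0]
    · exact lab_contract_self
    · rw [flip_flip]; exact lab_contract_self.symm

theorem Selectable.flip {x : E × Bool} (h : S.Selectable M x) : S.Selectable M (flip x) := by
  refine h.imp_right fun h => ⟨h.1, fun h' => h.2 ?_⟩
  have := h'.flip
  rwa [flip_flip] at this

/-- By the invariant for `S`, the trail consists of edges that were live before the step, so only
the removed edge matters. A pruned half-edge is alone among the live half-edges of its face, so a
trail cannot pass it, and at an end it is not selectable. A contracted edge is excluded from the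
interior by hypothesis, and at one end it makes the other end unselectable. -/
theorem ArmStep.spread [Finite E] (h : ArmStep M r S S') (hS : Good M S) (hsp : S.Spread M r) :
    S'.Spread M r := by
  intro x t ht htr hx hint hx0 hxt
  have hl := hsp x t ht htr hx (fun s h1 h2 h3 => hint s h1 h2 (h.sel_subset h3))
    (h.selectable hx0) (h.selectable hxt)
  cases h with
  | prune d hd h =>
    -- Among the live half-edges, the face of the pruned half-edge `d` contains `d` alone.
    have hfix (z : E × Bool) (hz : z.1 ∈ S.live) (hf : M.face d = M.face z) : z = d :=
      (hS.sameCycle_of_face d z hd hz hf).mem_of_forall (T := {d}) (by rintro _ rfl; exact h) rfl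
    have hns {z : E × Bool} (hz : z.1 = d.1) : ¬ (S.remove d).Selectable M z := by
      rintro (h' | ⟨h', -⟩)
      · exact hS.sel_dead _ h' (by rwa [hz])
      · exact h'.2 hz
    intro s hs
    refine ⟨hl s hs, fun hsd => ?_⟩
    rcases eq_or_eq_flip hsd with hsd | hsd
    · rcases hs.eq_or_lt with rfl | hs
      · exact hns (by rw [hsd]) hxt
      · have := hfix _ (show (flip (x (s + 1))).1 ∈ S.live from hl _ hs)
          (by rw [(hx s hs).1, hsd])
        exact (hx s hs).2 (by rw [this, hsd])
    · rcases s with _ | s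
      · exact hns (by rw [hsd]; rfl) hx0
      · have hd' : flip (x (s + 1)) = d := by rw [hsd, flip_flip]
        obtain ⟨h1, h2⟩ := hx s (by omega)
        rw [hd'] at h1 h2
        exact h2 (hfix _ (hl s (by omega)) h1).symm
  | contract d hd hnl h =>
    intro s hs
    refine ⟨hl s hs, fun hsd => ?_⟩
    rcases Nat.eq_zero_or_pos s with rfl | hs0
    · exact hS.not_selectable_contract h ht htr hx hl hsd hxt
    rcases hs.eq_or_lt with rfl | hs
    · refine hS.not_selectable_contract h ht htr hx.reverse
        (fun j hj => hl _ (by omega)) hsd ?_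
      simpa using hx0.flip
    · exact hint s hs0 hs (Or.inl hsd)
  | idle => exact hl

/-- The set of contracted edges is thin. -/
theorem Spread.thin [Finite E] (hsp : S.Spread M r) (hS : Good M S) (U : Set V) :
    (r + 1) * (S.sel ∩ M.cut U).ncard ≤ (M.cut U).ncard := by
  obtain ⟨g, hg, hgf⟩ := M.exists_outDarts_perm U
  -- Up to the first return to a contracted edge the orbit of `g` is a trail without contracted
  -- edges in its interior, so `Spread` would make the contracted edge `d` live. The case `g^[t] d =
  -- d` is included, so that cycles of length at most `r` contain no contracted edge.
  have hfar : ∀ t, 0 < t → t ≤ r → ∀ d : M.outDarts U, d.1.1 ∈ S.sel →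
      (g^[t] d).1.1 ∉ S.sel := by
    intro t
    induction t using Nat.strong_induction_on with
    | _ t ih =>
      intro ht htr d hd hgd
      refine hS.sel_dead _ hd (hsp (fun s => (g^[s] d).1) t ht htr ?_ ?_ (Or.inl hd) (Or.inl hgd) 0
        (Nat.zero_le _))
      · intro s hs
        dsimp only
        rw [Function.iterate_succ_apply', hgf]
        refine ⟨rfl, fun h => ?_⟩
        have h1 := (g (g^[s] d)).2.2
        rw [h] at h1
        exact h1 (g^[s] d).2.1
      · intro s hs0 hs
        exact ih s hs hs0 (by omega) d hd
  have hinj : Set.InjOn (fun d : E × Bool => d.1) (M.outDarts U) := by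
    intro d hd d' hd' h
    rcases eq_or_eq_flip h with h | h
    · exact h
    · exact (hd'.2 (by rw [← h]; exact hd.1)).elim
  have himg : (fun d : E × Bool => d.1) '' M.outDarts U = M.cut U := by
    ext e
    constructor
    · rintro ⟨d, hd, rfl⟩
      exact ⟨d, rfl, hd⟩
    · rintro ⟨d, rfl, hd⟩
      exact ⟨d, hd, rfl⟩
  have hcut : (M.cut U).ncard = Nat.card (M.outDarts U) := by
    rw [← himg, hinj.ncard_image]
    rfl
  have hselcut : (S.sel ∩ M.cut U).ncard = Nat.card {d : M.outDarts U // d.1.1 ∈ S.sel} := by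
    have : S.sel ∩ M.cut U =
        (fun d : {d : M.outDarts U // d.1.1 ∈ S.sel} => d.1.1.1) '' Set.univ := by
      rw [← himg]
      ext e
      constructor
      · rintro ⟨he, d, hd, rfl⟩
        exact ⟨⟨⟨d, hd⟩, he⟩, trivial, rfl⟩
      · rintro ⟨d, -, rfl⟩
        exact ⟨d.2, d.1.1, d.1.2, rfl⟩
    rw [this, Set.ncard_image_of_injective, Set.ncard_univ]
    intro d d' h
    exact Subtype.ext (Subtype.ext (hinj d.1.2 d'.1.2 h))
  rw [hcut, hselcut]
  have : (r + 1) * Nat.card {d : M.outDarts U // d.1.1 ∈ S.sel} =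
      Nat.card (Fin (r + 1) × {d : M.outDarts U // d.1.1 ∈ S.sel}) := by
    rw [Nat.card_prod, Nat.card_fin]
  rw [this]
  -- The images of the contracted half-edges under `g^[0]`, …, `g^[r]` are pairwise disjoint.
  refine Nat.card_le_card_of_injective (fun p => g^[p.1] p.2.1) ?_
  have key : ∀ s s' : ℕ, s ≤ s' → s' ≤ r → ∀ d d' : {d : M.outDarts U // d.1.1 ∈ S.sel},
      g^[s] d.1 = g^[s'] d'.1 → s = s' ∧ d = d' := by
    intro s s' hss hs' d d' h
    obtain ⟨j, rfl⟩ := Nat.exists_eq_add_of_le hss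
    rw [Function.iterate_add_apply] at h
    have h := hg.iterate s h
    rcases Nat.eq_zero_or_pos j with rfl | hj
    · exact ⟨rfl, Subtype.ext h⟩
    · refine (hfar j hj (by omega) d'.1 d'.2 ?_).elim
      rw [← h]
      exact d.2
  rintro ⟨s, d⟩ ⟨s', d'⟩ h
  have hs := s.2
  have hs' := s'.2
  rcases le_total s.1 s'.1 with hle | hle
  · obtain ⟨h1, h2⟩ := key _ _ hle (by omega) _ _ h
    exact Prod.ext (Fin.ext h1) h2
  · obtain ⟨h1, h2⟩ := key _ _ hle (by omega) _ _ h.symm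
    exact Prod.ext (Fin.ext h1.symm) h2.symm

theorem spread_init (lab : V → ℕ) : (init M lab).Spread M r :=
  fun _ _ _ _ _ _ _ _ _ _ => trivial

end Contraction

end OrientedMap

/-! ### The greedy process ends with a thin spanning tree -/

namespace OrientedMap

variable {V E : Type*}

local notation "flip" => Equiv.flipDart E

theorem IsEdgeConnected.mono {M : OrientedMap V E} {k l : ℕ} (h : M.IsEdgeConnected k)
    (hl : l ≤ k) : M.IsEdgeConnected l :=
  fun U h1 h2 => hl.trans (h U h1 h2)

namespace Contraction

variable {M : OrientedMap V E} {S S' : Contraction V E} {d : E × Bool} {r : ℕ}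

theorem HasArms.mono {s : ℕ} (h : S.HasArms d r) (hs : s ≤ r) : S.HasArms d s :=
  ⟨fun i hi => h.1 i (by omega), fun i hi => h.2 i (by omega)⟩

theorem exists_step (M : OrientedMap V E) (S : Contraction V E) : ∃ S', Step M S S' := by
  classical
  by_cases hleaf : S.Leafless
  swap
  · unfold Leafless at hleaf
    push Not at hleaf
    obtain ⟨d, hd, h⟩ := hleaf
    exact ⟨_, .prune d hd h⟩
  by_cases hl : ∀ d : E × Bool, d.1 ∈ S.live → S.IsLoop M d
  · exact ⟨_, .idle hleaf hl⟩
  push Not at hl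
  obtain ⟨d₀, hd₀, hl₀⟩ := hl
  obtain ⟨d, hd, hl, h⟩ := Nat.findGreatest_spec
    (P := fun r => ∃ d : E × Bool, d.1 ∈ S.live ∧ ¬ S.IsLoop M d ∧ S.HasArms d r) (m := 0)
    (Nat.zero_le (Nat.card E))
    ⟨d₀, hd₀, hl₀, fun i hi => (Nat.not_lt_zero _ hi).elim, fun i hi => (Nat.not_lt_zero _ hi).elim⟩
  exact ⟨_, .contract d hd hl hleaf fun r hr hex => h.mono (Nat.le_findGreatest hr.le hex)⟩

/-- The contracted edge has longest arms, so they are at least as long as those given by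
`Good.exists_hasArms`. The inequality `k ≤ 2 * (r + 1) * D` turns into `(k - 1) / (2 * D) ≤ r`. -/
theorem Step.armStep [Finite V] [Finite E] (h : Step M S S') (hS : Good M S) {k : ℕ}
    (hk : 0 < k) (hM : M.IsEdgeConnected k) (hn : 2 ≤ S.numVerts) {γ : ℕ}
    (hχ : (2 : ℤ) - 2 * γ ≤ S.numVerts - S.live.ncard + S.numFaces M) {D : ℕ} (hD0 : 0 < D)
    (hD : 6 * S.numVerts + 12 * γ < 12 + S.numVerts * (D + 1)) :
    ArmStep M ((k - 1) / (2 * D)) S S' := by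
  cases h with
  | prune d hd h => exact .prune d hd h
  | contract d hd hl hleaf hmax =>
    obtain ⟨r, hr, hkr, hex⟩ := hS.exists_hasArms hleaf hk hM hn hχ hD0 hD
    refine .contract d hd hl ((hmax r hr hex).mono ?_)
    rw [← Nat.lt_succ_iff, Nat.div_lt_iff_lt_mul (by omega)]
    calc k - 1 < k := by omega
      _ ≤ 2 * (r + 1) * D := hkr
      _ = _ := by rw [Nat.succ_eq_add_one]; ring
  | idle => exact .idle

theorem Step.sel_subset (h : Step M S S') : S.sel ⊆ S'.sel := by
  cases h with
  | prune d hd h => exact subset_rfl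
  | contract d hd hl => exact Set.subset_insert _ _
  | idle => exact subset_rfl

/-- Every step that is not idle removes a live edge, and once all live edges are loops this remains
so. Thus as many steps as there are edges suffice. -/
theorem Step.progress [Finite E] (h : Step M S S') {m : ℕ}
    (hS : S.live.ncard ≤ m + 1 ∨ ∀ d, d.1 ∈ S.live → S.IsLoop M d) :
    S'.live.ncard ≤ m ∨ ∀ d, d.1 ∈ S'.live → S'.IsLoop M d := by
  cases h with
  | prune d hd h =>
    refine hS.imp (fun hS => ?_) fun hS y hy => hS y hy.1
    have := Set.ncard_sdiff_singleton_add_one hd (Set.toFinite _)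
    change (S.live \ {d.1}).ncard ≤ m
    omega
  | contract d hd hl =>
    rcases hS with hS | hS
    · left
      have := Set.ncard_sdiff_singleton_add_one hd (Set.toFinite _)
      change (S.live \ {d.1}).ncard ≤ m
      omega
    · exact (hl (hS d hd)).elim
  | idle h hl => exact Or.inr hl

/-- All edges, live or dead, now join equal labels, so the set of vertices with a given label has an
empty cut. -/
theorem Good.lab_const (hS : Good M S) [Finite E] (hM : M.IsEdgeConnected 1)
    (h : ∀ d, d.1 ∈ S.live → S.IsLoop M d) (v w : V) : S.lab v = S.lab w := by
  by_contra hvw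
  obtain ⟨_, d, rfl, h1, h2⟩ := (Set.ncard_pos (Set.toFinite _)).1
    (hM {u | S.lab u = S.lab w} ⟨w, rfl⟩ fun h => by
      rw [Set.eq_univ_iff_forall] at h; exact hvw (h v))
  have hd : S.IsLoop M d := by
    by_cases hd : d.1 ∈ S.live
    · exact h d hd
    · exact hS.lab_of_dead d hd
  exact h2 (by rw [Set.mem_ofPred_eq, ← show _ = _ from hd]; exact h1)

/-- The algorithm finds thin spanning trees. -/
theorem isThin_of_step [Finite V] [Finite E] [Nonempty V] {lab : V → ℕ}
    (hlab : Function.Injective lab) {S : ℕ → Contraction V E} (h0 : S 0 = init M lab)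
    (hstep : ∀ i < Nat.card E, Step M (S i) (S (i + 1))) {k γ : ℕ} (hk : 0 < k)
    (hM : M.IsEdgeConnected k)
    (hχ : 2 ≤ Nat.card V → (2 : ℤ) - 2 * γ ≤ Nat.card V - Nat.card E +
      Nat.card (Quotient (Equiv.Perm.SameCycle.setoid M.facePerm))) :
    (∀ v w, M.Reach (S (Nat.card E)).sel v w) ∧ ¬ M.HasCycle (S (Nat.card E)).sel ∧
      ∀ U, k * ((S (Nat.card E)).sel ∩ M.cut U).ncard ≤
        (10 + 25 * Nat.sqrt γ) * (M.cut U).ncard := by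
  have hM1 := hM.mono (show 1 ≤ k from hk)
  set q := Nat.sqrt γ with hq
  -- With `n` vertices left, `hD` of `Step.armStep` requires `6 n + 12 γ < 12 + n (6 + 12 q)`. This
  -- follows from `γ ≤ q n`, which holds for `n ≥ q + 2` because of `γ ≤ q (q + 2)`.
  set D := 5 + 12 * q with hD
  set r := (k - 1) / (2 * D) with hr
  have hγ : γ ≤ q * (q + 2) := by
    have := Nat.sqrt_le_add γ
    rw [← hq] at this
    linarith
  have hkr : k ≤ 2 * D * (r + 1) := by
    have := Nat.lt_mul_div_succ (k - 1) (show 0 < 2 * D by omega)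
    rw [← hr] at this
    omega
  -- `Spread` is maintained while at least `q + 2` vertices are left. When there are fewer, the set
  -- `F` of the edges contracted so far is frozen as the thin part.
  have main : ∀ i ≤ Nat.card E, Good M (S i) ∧
      (2 ≤ (S i).numVerts → (2 : ℤ) - 2 * γ ≤ (S i).numVerts - (S i).live.ncard +
        (S i).numFaces M) ∧
      ((S i).live.ncard ≤ Nat.card E - i ∨ ∀ d, d.1 ∈ (S i).live → (S i).IsLoop M d) ∧
      ((S i).Spread M r ∨ ∃ F ⊆ (S i).sel,
        (∀ U, (r + 1) * (F ∩ M.cut U).ncard ≤ (M.cut U).ncard) ∧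
          Nat.card V ≤ F.ncard + q + 1) := by
    intro i
    induction i with
    | zero =>
      intro _
      rw [h0]
      have hg := good_init (M := M) hlab
      have hc := hg.card
      have hl : (init M lab).live.ncard = Nat.card E := Set.ncard_univ _
      simp only [init, Set.ncard_empty, zero_add] at hc
      refine ⟨hg, fun h => ?_, Or.inl hl.le, Or.inl (spread_init lab)⟩
      have hc' : (init M lab).numVerts = Nat.card V := hc
      have hf : (init M lab).numFaces M =
          Nat.card (Quotient (Equiv.Perm.SameCycle.setoid M.facePerm)) := by
        rw [numFaces, ← Set.ncard_univ]
        congr 1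
        refine Set.eq_univ_of_forall fun F => ?_
        induction F using Quotient.inductionOn with
        | _ d => exact ⟨d, trivial, rfl⟩
      rw [hc', hl, hf]
      exact hχ (by omega)
    | succ i ih =>
      intro hi
      obtain ⟨hg, he, hp, hs⟩ := ih (by omega)
      have hst := hstep i (by omega)
      refine ⟨hst.good hg, fun h => ?_, hst.progress ?_, ?_⟩
      · have := hst.euler_le hg hM1 h
        have hle : (S (i + 1)).numVerts ≤ (S i).numVerts := by
          have h1 := hg.card
          have h2 := (hst.good hg).card
          have h3 := Set.ncard_le_ncard hst.sel_subset (Set.toFinite _)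
          omega
        have := he (by omega)
        omega
      · rwa [show Nat.card E - (i + 1) + 1 = Nat.card E - i by omega]
      · rcases hs with hs | ⟨F, hF, hF'⟩
        swap
        · exact Or.inr ⟨F, hF.trans hst.sel_subset, hF'⟩
        by_cases hn : (S i).numVerts ≤ q + 1
        · exact Or.inr ⟨_, hst.sel_subset, hs.thin hg, by have := hg.card; omega⟩
        · left
          refine (hst.armStep hg hk hM (by omega) (he (by omega)) (by omega) ?_).spread hg hs
          have : γ ≤ q * (S i).numVerts := hγ.trans (Nat.mul_le_mul_left _ (by omega))
          rw [hD]
          linarith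
  obtain ⟨hg, -, hp, hs⟩ := main _ le_rfl
  set T := S (Nat.card E)
  have hloop : ∀ d, d.1 ∈ T.live → T.IsLoop M d := by
    refine hp.elim (fun h d hd => ?_) id
    rw [Nat.sub_self, Nat.le_zero, Set.ncard_eq_zero (Set.toFinite _)] at h
    rw [h] at hd
    exact hd.elim
  have hconst := hg.lab_const hM1 hloop
  have hn1 := numVerts_le_one hconst
  have hn0 : 0 < T.numVerts := (Set.ncard_pos (Set.toFinite _)).2 (Set.range_nonempty _)
  have hcard := hg.card
  refine ⟨fun v w => hg.reach v w (hconst v w), hg.acyclic, fun U => ?_⟩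
  obtain ⟨F, hF, hthin, hFq⟩ : ∃ F ⊆ T.sel,
        (∀ U, (r + 1) * (F ∩ M.cut U).ncard ≤ (M.cut U).ncard) ∧
          Nat.card V ≤ F.ncard + q + 1 :=
    hs.elim (fun hs => ⟨_, subset_rfl, hs.thin hg, by omega⟩) id
  by_cases hU : (M.cut U).ncard = 0
  · rw [Set.ncard_eq_zero (Set.toFinite _)] at hU
    simp [hU]
  have hkU : k ≤ (M.cut U).ncard := by
    obtain ⟨_, d, rfl, h1, h2⟩ := (Set.ncard_pos (Set.toFinite _)).1 (Nat.pos_of_ne_zero hU)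
    exact hM U ⟨_, h1⟩ fun h => h2 (by rw [h]; trivial)
  -- The tree has one edge less than there are vertices, so at most `q` of its edges are outside
  -- `F`.
  have h1 : (T.sel ∩ M.cut U).ncard ≤ (F ∩ M.cut U).ncard + q := by
    have h2 : (T.sel \ F).ncard ≤ q := by
      have := Set.ncard_sdiff_add_ncard_of_subset hF (Set.toFinite _)
      omega
    calc _ ≤ ((F ∩ M.cut U) ∪ (T.sel \ F)).ncard := by
          refine Set.ncard_le_ncard (fun e he => ?_) (Set.toFinite _)
          by_cases heF : e ∈ F
          · exact Or.inl ⟨heF, he.2⟩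
          · exact Or.inr ⟨he.1, heF⟩
      _ ≤ _ := (Set.ncard_union_le _ _).trans (by omega)
  -- The late edges are paid for by `k ≤ |δ(U)|`, the early ones by `k ≤ 2 * D * (r + 1)`. The sum
  -- is `2 * D + q = 10 + 25 * q`.
  calc k * (T.sel ∩ M.cut U).ncard ≤ k * ((F ∩ M.cut U).ncard + q) := Nat.mul_le_mul_left _ h1
    _ = k * (F ∩ M.cut U).ncard + k * q := mul_add _ _ _
    _ ≤ 2 * D * (r + 1) * (F ∩ M.cut U).ncard + (M.cut U).ncard * q := by gcongr
    _ = 2 * D * ((r + 1) * (F ∩ M.cut U).ncard) + (M.cut U).ncard * q := by ring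
    _ ≤ 2 * D * (M.cut U).ncard + (M.cut U).ncard * q := by gcongr; exact hthin U
    _ = _ := by rw [hD]; ring

theorem exists_steps (M : OrientedMap V E) (S₀ : Contraction V E) :
    ∃ S : ℕ → Contraction V E, S 0 = S₀ ∧ ∀ i, Step M (S i) (S (i + 1)) := by
  choose g hg using exists_step M
  exact ⟨fun i => g^[i] S₀, rfl, fun i => by
    dsimp only
    rw [Function.iterate_succ_apply']
    exact hg _⟩

end Contraction

end OrientedMap

/-! ### The algorithm -/

section

open Function (update)

namespace ArrayProg

variable {V W : Type} [DecidableEq V] [DecidableEq W]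

/-- If the expressions are equal, then `p`, else `q`. -/
def ifeq (e₁ e₂ : ArrayExpr V W) (p q : ArrayProg V W) : ArrayProg V W :=
  .ifle e₁ e₂ (.ifle e₂ e₁ p q) q

theorem eval_ifeq (e₁ e₂ : ArrayExpr V W) (p q : ArrayProg V W) (s : ArrayState V W) :
    eval (ifeq e₁ e₂ p q) s = if e₁.eval s = e₂.eval s then eval p s else eval q s := by
  simp only [ifeq, eval]
  split_ifs <;> first | rfl | omega

theorem eval_ifeq_cases {e₁ e₂ : ArrayExpr V W} {p q : ArrayProg V W} {s : ArrayState V W}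
    {P : Prop} (h : e₁.eval s = e₂.eval s ↔ P) :
    P ∧ eval (ifeq e₁ e₂ p q) s = eval p s ∨ ¬ P ∧ eval (ifeq e₁ e₂ p q) s = eval q s := by
  rw [eval_ifeq, ← h]
  split_ifs with h'
  exacts [Or.inl ⟨h', rfl⟩, Or.inr ⟨h', rfl⟩]

theorem eval_ifle_cases {e₁ e₂ : ArrayExpr V W} {p q : ArrayProg V W} {s : ArrayState V W}
    {P : Prop} (h : e₁.eval s ≤ e₂.eval s ↔ P) :
    P ∧ eval (.ifle e₁ e₂ p q) s = eval p s ∨ ¬ P ∧ eval (.ifle e₁ e₂ p q) s = eval q s := by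
  rw [eval, ← h]
  split_ifs with h'
  exacts [Or.inl ⟨h', rfl⟩, Or.inr ⟨h', rfl⟩]

/-- The invariant is indexed by the current value of the counter, which descends to 0, and `I n` may
describe the rounds with values at least `n` as done. -/
theorem eval_loop_induction {c : V} {e : ArrayExpr V W} {p : ArrayProg V W} {s : ArrayState V W}
    (I : ℕ → ArrayState V W → Prop) (h0 : I (e.eval s) (s.setNum c (e.eval s)))
    (hs : ∀ n < e.eval s, ∀ s, I (n + 1) s → I n ((eval p (s.setNum c n)).setNum c n)) :
    I 0 (eval (loop c e p) s) := by
  rw [eval]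
  generalize s.setNum c (e.eval s) = s' at h0 ⊢
  generalize e.eval s = n at h0 hs ⊢
  induction n generalizing s' with
  | zero => exact h0
  | succ n ih => exact ih _ (hs n (by omega) _ h0) fun i hi => hs i (by omega)

end ArrayProg

namespace ArrayState

variable {V W : Type}

/-- The memories `s` and `s'` differ only in the number variables from `T`. -/
structure Agree (T : List V) (s s' : ArrayState V W) : Prop where
  arr : s'.arr = s.arr
  out : s'.out = s.out
  num : ∀ x ∉ T, s'.num x = s.num x

theorem Agree.refl (T : List V) (s : ArrayState V W) : Agree T s s := ⟨rfl, rfl, fun _ _ => rfl⟩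

theorem Agree.trans {T : List V} {s s' s'' : ArrayState V W} (h : Agree T s s')
    (h' : Agree T s' s'') : Agree T s s'' :=
  ⟨h'.arr.trans h.arr, h'.out.trans h.out, fun x hx => (h'.num x hx).trans (h.num x hx)⟩

theorem Agree.setNum [DecidableEq V] {T : List V} {s s' : ArrayState V W} (h : Agree T s s') {x : V} (hx : x ∈ T)
    (v : ℕ) : Agree T s (s'.setNum x v) :=
  ⟨h.arr, h.out, fun y hy => by
    rw [← h.num y hy]
    exact Function.update_of_ne (fun h => hy (by rwa [h])) _ _⟩

theorem Agree.mono {T T' : List V} {s s' : ArrayState V W} (h : Agree T s s')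
    (hT : ∀ x ∈ T, x ∈ T') : Agree T' s s' :=
  ⟨h.arr, h.out, fun x hx => h.num x fun h => hx (hT x h)⟩

end ArrayState

namespace ThinTree

set_option linter.constructorNameAsVariable false

open ArrayProg ArrayState OrientedMap

/-- The number variables of the algorithm. -/
inductive Var
  | N | one | m | dd | i | r | s | d | x | v | a | b | found | best | ok | y
  deriving DecidableEq

instance : Fintype Var :=
  ⟨{.N, .one, .m, .dd, .i, .r, .s, .d, .x, .v, .a, .b, .found, .best, .ok, .y},
    fun x => by cases x <;> decide⟩

/-- The array variables of the algorithm. -/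
inductive Arr
  | inp | next | lab | dead | sel | other
  deriving DecidableEq

instance : Fintype Arr :=
  ⟨{.inp, .next, .lab, .dead, .sel, .other}, fun A => by cases A <;> decide⟩

abbrev Expr := ArrayExpr Var Arr
abbrev Prog := ArrayProg Var Arr
abbrev Mem := ArrayState Var Arr

/-- The language has no numerals. -/
def zero : Expr := .sub (.var .one) (.var .one)

/-- The sum of two expressions (provided that it is at most `N`). -/
def add (e₁ e₂ : Expr) : Expr := .sub (.var .N) (.sub (.sub (.var .N) e₁) e₂)

/-- The test whether there is a sequence of `r` digons that starts at the half-edge `y`, which is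
`d` or its other half. -/
def armTest : Prog :=
  .loop .s (.var .r) <|
    .seq (ifeq (.get .next (.get .next (.var .y))) (.var .y) .skip (.assign .ok zero)) <|
    .seq (.assign .y (.get .other (.get .next (.var .y)))) <|
    .seq (ifeq (.var .y) (.var .d) (.assign .ok zero) .skip)
      (ifeq (.var .y) (.get .other (.var .d)) (.assign .ok zero) .skip)

/-- Record the half-edge `d`. -/
def record : Prog := .seq (.assign .found (.var .one)) (.assign .best (.var .d))

/-- Search for a live half-edge that is a face on its own. -/
def findLeaf : Prog :=
  .loop .d (.var .dd) <| .ifle (.get .dead (.var .d)) zero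
    (ifeq (.get .next (.var .d)) (.var .d) record .skip) .skip

/-- Search for an edge which is not a loop and has arms of length `r`. -/
def findArms : Prog :=
  .loop .d (.var .dd) <| .ifle (.get .dead (.var .d)) zero
    (ifeq (.get .lab (.var .d)) (.get .lab (.get .other (.var .d))) .skip <|
      .seq (.assign .ok (.var .one)) <|
      .seq (.assign .y (.var .d)) <|
      .seq armTest <|
      .seq (.assign .y (.get .other (.var .d))) <|
      .seq armTest <|
      .ifle (.var .ok) zero .skip record)
    .skip

/-- Search for an edge which is not a loop and has arms of maximum length. -/
def findLongest : Prog :=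
  .loop .r (.var .m) <| .ifle (.var .found) zero findArms .skip

/-- Merge the vertices `a` and `b`. -/
def relabel : Prog :=
  .loop .d (.var .dd) <|
    ifeq (.get .lab (.var .d)) (.var .a) (.set .lab (.var .d) (.var .b)) .skip

/-- Remove the half-edge `x` from its face. -/
def removeDart : Prog :=
  .seq (.assign .v (.get .next (.var .x))) <|
  .seq (.loop .d (.var .dd) <|
    ifeq (.get .next (.var .d)) (.var .x) (.set .next (.var .d) (.var .v)) .skip) <|
  .seq (.set .next (.var .x) (.var .x)) (.set .dead (.var .x) (.var .one))

/-- Contract the recorded edge, or delete it if it is a loop. -/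
def removeBest : Prog :=
  .seq (.assign .a (.get .lab (.var .best))) <|
  .seq (.assign .b (.get .lab (.get .other (.var .best)))) <|
  .seq relabel <|
  .seq (.assign .x (.var .best)) <|
  .seq removeDart <|
  .seq (.assign .x (.get .other (.var .best))) removeDart

/-- Select the recorded edge. -/
def selectBest : Prog :=
  .seq (.set .sel (.var .best) (.var .one)) (.set .sel (.get .other (.var .best)) (.var .one))

/-- A step of the algorithm. -/
def step : Prog :=
  .seq (.assign .found zero) <|
  .seq findLeaf <|
  .ifle (.var .found) zero
    (.seq findLongest <| .ifle (.var .found) zero .skip <| .seq selectBest removeBest)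
    removeBest

def double (x : Var) : Expr := add (.var x) (.var x)

/-- Read the input. -/
def start : Prog :=
  .seq (.assign .m (.get .inp (.var .one))) <|
  .seq (.assign .dd (double .m)) <|
  .seq (.loop .d (.var .m) <|
    .seq (.set .other (double .d) (add (double .d) (.var .one)))
      (.set .other (add (double .d) (.var .one)) (double .d))) <|
  .seq (.loop .d (.var .dd) <|
    .set .lab (.var .d) (.get .inp (add (double .one) (double .d)))) <|
  .loop .d (.var .dd) <|
    .seq (.assign .x (.get .other (.var .d)))
      (.set .next (.var .d) (.get .inp (add (add (double .one) (.var .one)) (double .x))))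

/-- The algorithm. -/
def main : Prog :=
  .seq start <| .seq (.loop .i (.var .m) step) <|
    .loop .d (.var .m) (.emit (.get .sel (double .d)))

/-! ### Simulation of contractions in memory: the searches -/

variable {V E : Type*} {n : ℕ} (ι : E ≃ Fin n)

/-- The number of a half-edge. -/
def code (d : E × Bool) : ℕ := 2 * ι d.1 + d.2.toNat

local notation "flip" => Equiv.flipDart E

theorem code_injective : Function.Injective (code ι) := by
  rintro ⟨e, b⟩ ⟨e', b'⟩ h
  simp only [code] at h
  have h1 := Bool.toNat_le b
  have h2 := Bool.toNat_le b'
  have h3 : b.toNat = b'.toNat := by omega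
  have h4 : ι e = ι e' := Fin.ext (by omega)
  rw [ι.injective h4]
  cases b <;> cases b' <;> simp_all

theorem code_lt (d : E × Bool) : code ι d < 2 * n := by
  have h1 := Bool.toNat_le d.2
  have h2 := (ι d.1).2
  simp only [code]
  omega

theorem exists_code {j : ℕ} (hj : j < 2 * n) : ∃ d, code ι d = j := by
  rcases Nat.even_or_odd' j with ⟨i, rfl | rfl⟩
  · exact ⟨(ι.symm ⟨i, by omega⟩, false), by simp [code]⟩
  · exact ⟨(ι.symm ⟨i, by omega⟩, true), by simp [code]⟩

theorem code_eq_iff {d d' : E × Bool} : code ι d = code ι d' ↔ d = d' := (code_injective ι).eq_iff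

/-- The memory `s` represents the contraction `S`. -/
structure Sim (M : OrientedMap V E) (s : Mem) (S : Contraction V E) : Prop where
  N : 2 * n ≤ s.num .N
  one : s.num .one = 1
  m : s.num .m = n
  dd : s.num .dd = 2 * n
  other : ∀ d, s.arr .other (code ι d) = code ι (flip d)
  next : ∀ d, s.arr .next (code ι d) = code ι (S.next d)
  lab : ∀ d, s.arr .lab (code ι d) = S.lab (M.tail d)
  dead : ∀ d : E × Bool, s.arr .dead (code ι d) = 0 ↔ d.1 ∈ S.live
  sel : ∀ d : E × Bool, s.arr .sel (code ι d) = 0 ↔ d.1 ∉ S.sel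

variable {ι} {M : OrientedMap V E} {S : Contraction V E} {s s' : Mem}

theorem Sim.agree {T : List Var} (h : Sim ι M s S) (h' : s.Agree T s')
    (hT : ∀ x ∈ [Var.N, .one, .m, .dd], x ∉ T) : Sim ι M s' S where
  N := by rw [h'.num _ (hT _ (by simp))]; exact h.N
  one := by rw [h'.num _ (hT _ (by simp))]; exact h.one
  m := by rw [h'.num _ (hT _ (by simp))]; exact h.m
  dd := by rw [h'.num _ (hT _ (by simp))]; exact h.dd
  other := by rw [h'.arr]; exact h.other
  next := by rw [h'.arr]; exact h.next
  lab := by rw [h'.arr]; exact h.lab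
  dead := by rw [h'.arr]; exact h.dead
  sel := by rw [h'.arr]; exact h.sel

theorem eval_assign (x : Var) (e : Expr) (s : Mem) :
    eval (.assign x e) s = s.setNum x (e.eval s) := rfl

theorem eval_seq (p q : Prog) (s : Mem) : eval (.seq p q) s = eval q (eval p s) := rfl

theorem setNum_num_self (s : Mem) (x : Var) (v : ℕ) : (s.setNum x v).num x = v :=
  Function.update_self _ _ _

theorem setNum_num_of_ne {x y : Var} (h : y ≠ x) (s : Mem) (v : ℕ) :
    (s.setNum x v).num y = s.num y :=
  Function.update_of_ne h _ _

theorem eval_zero (s : Mem) : ArrayExpr.eval s zero = 0 := Nat.sub_self _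

theorem failIfEq_spec (e₁ e₂ : Expr) (s : Mem) :
    s.Agree [.ok] (eval (ifeq e₁ e₂ (.assign .ok zero) .skip) s) ∧
      ((eval (ifeq e₁ e₂ (.assign .ok zero) .skip) s).num .ok ≠ 0 ↔
        s.num .ok ≠ 0 ∧ e₁.eval s ≠ e₂.eval s) := by
  rw [eval_ifeq]
  split_ifs with h
  · rw [eval_assign]
    exact ⟨(Agree.refl _ _).setNum (by simp) _, by simp [setNum_num_self, eval_zero, h]⟩
  · exact ⟨.refl _ _, by simp [eval, h]⟩

theorem failIfNe_spec (e₁ e₂ : Expr) (s : Mem) :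
    s.Agree [.ok] (eval (ifeq e₁ e₂ .skip (.assign .ok zero)) s) ∧
      ((eval (ifeq e₁ e₂ .skip (.assign .ok zero)) s).num .ok ≠ 0 ↔
        s.num .ok ≠ 0 ∧ e₁.eval s = e₂.eval s) := by
  rw [eval_ifeq]
  split_ifs with h
  · exact ⟨.refl _ _, by simp [eval, h]⟩
  · rw [eval_assign]
    exact ⟨(Agree.refl _ _).setNum (by simp) _, by simp [setNum_num_self, eval_zero, h]⟩

/-- One round of `armTest`. -/
theorem armTest_round (h : Sim ι M s S) {d z : E × Bool} (hd : s.num .d = code ι d)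
    (hz : s.num .y = code ι z) {p : Prog} (hp : p =
      .seq (ifeq (.get .next (.get .next (.var .y))) (.var .y) .skip (.assign .ok zero))
      (.seq (.assign .y (.get .other (.get .next (.var .y))))
      (.seq (ifeq (.var .y) (.var .d) (.assign .ok zero) .skip)
        (ifeq (.var .y) (.get .other (.var .d)) (.assign .ok zero) .skip)))) :
    s.Agree [.s, .y, .ok] (eval p s) ∧ (eval p s).num .y = code ι (S.across z) ∧
      ((eval p s).num .ok ≠ 0 ↔ s.num .ok ≠ 0 ∧ S.next (S.next z) = z ∧ (S.across z).1 ≠ d.1) := by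
  rw [hp, eval_seq, eval_seq, eval_seq, eval_assign]
  obtain ⟨h1, h1'⟩ := failIfNe_spec (.get .next (.get .next (.var .y))) (.var .y) s
  generalize eval (ifeq _ _ .skip (.assign .ok zero)) s = s₁ at *
  have hy₁ : s₁.num .y = code ι z := by rw [h1.num _ (by simp), hz]
  have hS₁ := h.agree h1 (by simp)
  have he : ArrayExpr.eval s₁ (.get .other (.get .next (.var .y))) = code ι (S.across z) := by
    simp [ArrayExpr.eval, hy₁, hS₁.next, hS₁.other, Contraction.across]
  rw [he]
  have h2 := (h1.mono (T' := [.s, .y, .ok]) (by simp)).setNum (x := .y) (by simp)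
    (code ι (S.across z))
  have hok : (s₁.setNum .y (code ι (S.across z))).num .ok = s₁.num .ok :=
    setNum_num_of_ne (by simp) _ _
  have hy₂ := setNum_num_self s₁ .y (code ι (S.across z))
  generalize s₁.setNum .y (code ι (S.across z)) = s₂ at *
  have hd₂ : s₂.num .d = code ι d := by rw [h2.num _ (by simp), hd]
  obtain ⟨h3, h3'⟩ := failIfEq_spec (.var .y) (.var .d) s₂
  generalize eval (ifeq _ _ (.assign .ok zero) .skip) s₂ = s₃ at *
  have hy₃ : s₃.num .y = code ι (S.across z) := by rw [h3.num _ (by simp), hy₂]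
  have hd₃ : s₃.num .d = code ι d := by rw [h3.num _ (by simp), hd₂]
  have h3'' := h2.trans (h3.mono (by simp))
  have hS₃ := h.agree h3'' (by simp)
  obtain ⟨h4, h4'⟩ := failIfEq_spec (.var .y) (.get .other (.var .d)) s₃
  refine ⟨h3''.trans (h4.mono (by simp)), by rw [h4.num _ (by simp), hy₃], ?_⟩
  rw [h4', h3', hok, h1', fst_ne_iff]
  simp only [ArrayExpr.eval, hz, h.next, hy₂, hd₂, hy₃, hd₃, hS₃.other, code_eq_iff, ne_eq]
  tauto

/-- After `j` rounds, `y` is the half-edge `across^[j] z`, and `ok` has survived exactly if there is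
an arm of length `j`. By `hzd`, comparison with the edge of `d` tests for a return to the edge of
`z`. -/
theorem armTest_spec (h : Sim ι M s S) {d z : E × Bool} (hd : s.num .d = code ι d)
    (hz : s.num .y = code ι z) (hzd : z.1 = d.1) :
    s.Agree [.s, .y, .ok] (eval armTest s) ∧
      ((eval armTest s).num .ok ≠ 0 ↔ s.num .ok ≠ 0 ∧ S.HasArm z (s.num .r)) := by
  suffices ∃ j, s.num .r = 0 + j ∧ s.Agree [.s, .y, .ok] (eval armTest s) ∧
      (eval armTest s).num .y = code ι (S.across^[j] z) ∧
      ((eval armTest s).num .ok ≠ 0 ↔ s.num .ok ≠ 0 ∧ S.HasArm z j) by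
    obtain ⟨j, hj, h1, h2, h3⟩ := this
    rw [zero_add] at hj
    subst hj
    exact ⟨h1, h3⟩
  refine eval_loop_induction (fun l s' => ∃ j, s.num .r = l + j ∧ s.Agree [.s, .y, .ok] s' ∧
    s'.num .y = code ι (S.across^[j] z) ∧ (s'.num .ok ≠ 0 ↔ s.num .ok ≠ 0 ∧ S.HasArm z j)) ?_ ?_
  · refine ⟨0, rfl, (Agree.refl _ _).setNum (by simp) _, ?_, ?_⟩
    · rw [setNum_num_of_ne (by simp)]; exact hz
    · rw [setNum_num_of_ne (by simp)]; simp [Contraction.HasArm]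
  · rintro l hl s₁ ⟨j, hj, h1, h2, h3⟩
    have h1' := h1.setNum (x := .s) (by simp) l
    obtain ⟨h4, h5, h6⟩ := armTest_round (s := s₁.setNum .s l) (h.agree h1' (by simp)) (d := d)
      (z := S.across^[j] z) (by rw [h1'.num _ (by simp), hd])
      (by rw [setNum_num_of_ne (by simp), h2]) rfl
    refine ⟨j + 1, by omega, (h1'.trans h4).setNum (by simp) _, ?_, ?_⟩
    · rw [setNum_num_of_ne (by simp), h5, Function.iterate_succ_apply']
    · rw [setNum_num_of_ne (by simp), h6, setNum_num_of_ne (by simp), h3, ← hzd, and_assoc,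
        ← Function.iterate_succ_apply' S.across j z]
      exact and_congr_right fun _ => Nat.forall_lt_succ_right.symm

/-- A search through all half-edges. -/
theorem search_spec (h : Sim ι M s S) {P : E × Bool → Prop} {T : List Var} {p : Prog}
    (hd : Var.d ∈ T)
    (hp : ∀ s', s.Agree T s' → ∀ d, s'.num .d = code ι d →
      s'.Agree T (eval p s') ∧
      (P d → (eval p s').num .found ≠ 0 ∧ (eval p s').num .best = code ι d) ∧
      (¬ P d → (eval p s').num .found = s'.num .found ∧ (eval p s').num .best = s'.num .best))
    (hs : s.num .found = 0) {p' : Prog} (hp' : p' = .loop .d (.var .dd) p) :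
    s.Agree T (eval p' s) ∧
    ((eval p' s).num .found ≠ 0 → ∃ d, (eval p' s).num .best = code ι d ∧ P d) ∧
    ((eval p' s).num .found = 0 → ∀ d, ¬ P d) := by
  suffices s.Agree T (eval p' s) ∧
      ((eval p' s).num .found ≠ 0 → ∃ d, (eval p' s).num .best = code ι d ∧ P d) ∧
      ((eval p' s).num .found = 0 → ∀ d, 0 ≤ code ι d → ¬ P d) from
    ⟨this.1, this.2.1, fun h d => this.2.2 h d (Nat.zero_le _)⟩
  subst hp'
  refine eval_loop_induction (fun l s' => s.Agree T s' ∧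
    (s'.num .found ≠ 0 → ∃ d, s'.num .best = code ι d ∧ P d) ∧
    (s'.num .found = 0 → ∀ d, l ≤ code ι d → ¬ P d)) ?_ ?_
  · refine ⟨(Agree.refl _ _).setNum hd _, fun h' => ?_, fun _ d hd' => ?_⟩
    · rw [setNum_num_of_ne (by simp)] at h'
      exact (h' hs).elim
    · have := code_lt ι d
      simp only [ArrayExpr.eval, h.dd] at hd'
      omega
  · rintro l hl s₁ ⟨h1, h2, h3⟩
    simp only [ArrayExpr.eval, h.dd] at hl
    obtain ⟨d, rfl⟩ := exists_code ι hl
    obtain ⟨h4, h5, h6⟩ := hp _ (h1.setNum hd (code ι d)) d (setNum_num_self _ _ _)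
    simp only [setNum_num_of_ne (show Var.found ≠ .d by simp),
      setNum_num_of_ne (show Var.best ≠ .d by simp)] at h5 h6 ⊢
    refine ⟨((h1.setNum hd _).trans h4).setNum hd _, fun hf => ?_, fun hf d' hd' => ?_⟩
    · by_cases hP : P d
      · exact ⟨d, (h5 hP).2, hP⟩
      · obtain ⟨h7, h8⟩ := h6 hP
        rw [h7] at hf
        rw [h8]
        exact h2 hf
    · have hP : ¬ P d := fun hP => (h5 hP).1 hf
      rcases hd'.eq_or_lt with he | hlt
      · rwa [← (code_injective ι) he]
      · exact h3 ((h6 hP).1.symm.trans hf) d' hlt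

theorem record_spec (s : Mem) : s.Agree [.found, .best] (eval record s) ∧
    (eval record s).num .found = s.num .one ∧ (eval record s).num .best = s.num .d := by
  rw [record, eval_seq, eval_assign, eval_assign]
  refine ⟨((Agree.refl _ _).setNum (by simp) _).setNum (by simp) _, ?_, ?_⟩
  · rw [setNum_num_of_ne (by simp), setNum_num_self]; rfl
  · rw [setNum_num_self]
    exact setNum_num_of_ne (by simp) _ _

theorem dead_le_zero (h : Sim ι M s S) {d : E × Bool} (hd : s.num .d = code ι d) :
    ArrayExpr.eval s (.get .dead (.var .d)) ≤ ArrayExpr.eval s zero ↔ d.1 ∈ S.live := by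
  rw [eval_zero, Nat.le_zero, ← h.dead, ← hd]
  rfl

theorem findLeaf_spec (h : Sim ι M s S) (hs : s.num .found = 0) :
    s.Agree [.d, .found, .best] (eval findLeaf s) ∧
    ((eval findLeaf s).num .found ≠ 0 →
      ∃ d, (eval findLeaf s).num .best = code ι d ∧ d.1 ∈ S.live ∧ S.next d = d) ∧
    ((eval findLeaf s).num .found = 0 → S.Leafless) := by
  refine And.imp_right (And.imp_right fun h3 h d hd hdd => h3 h d ⟨hd, hdd⟩)
    (search_spec h (P := fun d => d.1 ∈ S.live ∧ S.next d = d) (T := [.d, .found, .best]) (by simp)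
      (fun s' h1 d hd => ?_) hs rfl)
  have hS := h.agree h1 (by simp)
  obtain ⟨r1, r2, r3⟩ := record_spec s'
  have r1' := r1.mono (T' := [.d, .found, .best]) (by simp)
  rcases eval_ifle_cases (dead_le_zero hS hd) with ⟨c1, he⟩ | ⟨c1, he⟩ <;> rw [he]
  swap
  · exact ⟨.refl _ _, fun h => (c1 h.1).elim, fun _ => ⟨rfl, rfl⟩⟩
  have hn : ArrayExpr.eval s' (.get .next (.var .d)) = ArrayExpr.eval s' (.var .d) ↔
      S.next d = d := by
    simp only [ArrayExpr.eval, hd, hS.next, code_eq_iff]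
  rcases eval_ifeq_cases hn with ⟨c2, he⟩ | ⟨c2, he⟩ <;> rw [he]
  · exact ⟨r1', fun _ => ⟨by rw [r2, hS.one]; simp, by rw [r3, hd]⟩, fun h => (h ⟨c1, c2⟩).elim⟩
  · exact ⟨.refl _ _, fun h => (c2 h.2).elim, fun _ => ⟨rfl, rfl⟩⟩

theorem findArms_spec (h : Sim ι M s S) (hs : s.num .found = 0) :
    s.Agree [.d, .found, .best, .s, .y, .ok] (eval findArms s) ∧
    ((eval findArms s).num .found ≠ 0 → ∃ d, (eval findArms s).num .best = code ι d ∧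
      d.1 ∈ S.live ∧ ¬ S.IsLoop M d ∧ S.HasArms d (s.num .r)) ∧
    ((eval findArms s).num .found = 0 →
      ∀ d, ¬ (d.1 ∈ S.live ∧ ¬ S.IsLoop M d ∧ S.HasArms d (s.num .r))) := by
  refine search_spec h (T := [.d, .found, .best, .s, .y, .ok]) (by simp)
    (fun s' h1 d hd => ?_) hs rfl
  have hS := h.agree h1 (by simp)
  rcases eval_ifle_cases (dead_le_zero hS hd) with ⟨c1, he⟩ | ⟨c1, he⟩ <;> rw [he]
  swap
  · exact ⟨.refl _ _, fun h => (c1 h.1).elim, fun _ => ⟨rfl, rfl⟩⟩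
  have hn : ArrayExpr.eval s' (.get .lab (.var .d)) =
      ArrayExpr.eval s' (.get .lab (.get .other (.var .d))) ↔ S.IsLoop M d := by
    simp only [ArrayExpr.eval, hd, hS.lab, hS.other, Contraction.IsLoop]
  rcases eval_ifeq_cases hn with ⟨c2, he⟩ | ⟨c2, he⟩ <;> rw [he]
  · exact ⟨.refl _ _, fun h => (h.2.1 c2).elim, fun _ => ⟨rfl, rfl⟩⟩
  have hP : (d.1 ∈ S.live ∧ ¬ S.IsLoop M d ∧ S.HasArms d (s.num .r)) ↔
      S.HasArms d (s.num .r) := ⟨fun h => h.2.2, fun h => ⟨c1, c2, h⟩⟩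
  rw [hP]
  simp only [eval_seq, eval_assign, ArrayExpr.eval]
  set T : List Var := [.d, .found, .best, .s, .y, .ok]
  have a1 := ((Agree.refl T s').setNum (x := .ok) (by simp [T]) (s'.num .one)).setNum (x := .y)
    (by simp [T]) ((s'.setNum .ok (s'.num .one)).num .d)
  have hok : ((s'.setNum .ok (s'.num .one)).setNum .y
      ((s'.setNum .ok (s'.num .one)).num .d)).num .ok ≠ 0 := by
    rw [setNum_num_of_ne (by simp), setNum_num_self, hS.one]; simp
  have hy : ((s'.setNum .ok (s'.num .one)).setNum .y
      ((s'.setNum .ok (s'.num .one)).num .d)).num .y = code ι d := by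
    rw [setNum_num_self, setNum_num_of_ne (by simp), hd]
  have hd₁ : ((s'.setNum .ok (s'.num .one)).setNum .y
      ((s'.setNum .ok (s'.num .one)).num .d)).num .d = code ι d := by
    rw [setNum_num_of_ne (by simp), setNum_num_of_ne (by simp), hd]
  have hf₁ : ((s'.setNum .ok (s'.num .one)).setNum .y
      ((s'.setNum .ok (s'.num .one)).num .d)).num .found = s'.num .found := by
    rw [setNum_num_of_ne (by simp), setNum_num_of_ne (by simp)]
  have hb₁ : ((s'.setNum .ok (s'.num .one)).setNum .y
      ((s'.setNum .ok (s'.num .one)).num .d)).num .best = s'.num .best := by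
    rw [setNum_num_of_ne (by simp), setNum_num_of_ne (by simp)]
  generalize (s'.setNum .ok (s'.num .one)).setNum .y
    ((s'.setNum .ok (s'.num .one)).num .d) = s₁ at *
  have hS₁ := hS.agree a1 (by simp [T])
  have hr₁ : s₁.num .r = s.num .r := by
    rw [a1.num _ (by simp [T]), h1.num _ (by simp [T])]
  obtain ⟨a2, hok₂⟩ := armTest_spec hS₁ hd₁ hy rfl
  generalize eval armTest s₁ = s₂ at *
  have a2' := a1.trans (a2.mono (by simp [T]))
  have hS₂ := hS.agree a2' (by simp [T])
  have hd₂ : s₂.num .d = code ι d := by rw [a2.num _ (by simp), hd₁]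
  rw [hd₂, hS₂.other]
  have hy₃ := setNum_num_self s₂ .y (code ι (flip d))
  have a3 := a2.setNum (x := .y) (by simp) (code ι (flip d))
  have hok₃ : (s₂.setNum .y (code ι (flip d))).num .ok = s₂.num .ok :=
    setNum_num_of_ne (by simp) _ _
  generalize s₂.setNum .y (code ι (flip d)) = s₃ at *
  have a3' := a1.trans (a3.mono (by simp [T]))
  have hS₃ := hS.agree a3' (by simp [T])
  obtain ⟨a4, hok₄⟩ := armTest_spec hS₃ (d := d) (by rw [a3.num _ (by simp), hd₁]) hy₃ rfl
  generalize eval armTest s₃ = s₄ at *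
  have a5 := a3.trans a4
  have a5' := a1.trans (a5.mono (by simp [T]))
  rw [hok₃, hok₂, a3.num .r (by simp), hr₁] at hok₄
  have hok₅ : s₄.num .ok ≠ 0 ↔ S.HasArms d (s.num .r) := by
    rw [hok₄, Contraction.HasArms]
    tauto
  have hf₄ : s₄.num .found = s'.num .found := by rw [a5.num _ (by simp), hf₁]
  have hb₄ : s₄.num .best = s'.num .best := by rw [a5.num _ (by simp), hb₁]
  have hd₄ : s₄.num .d = code ι d := by rw [a5.num _ (by simp), hd₁]
  obtain ⟨r1, r2, r3⟩ := record_spec s₄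
  have hn : ArrayExpr.eval s₄ (.var .ok) ≤ ArrayExpr.eval s₄ zero ↔ s₄.num .ok = 0 := by
    rw [eval_zero, Nat.le_zero]; rfl
  rcases eval_ifle_cases hn with ⟨c3, he⟩ | ⟨c3, he⟩ <;> rw [he]
  · exact ⟨a5', fun h => (hok₅.2 h c3).elim, fun _ => ⟨hf₄, hb₄⟩⟩
  · refine ⟨a5'.trans (r1.mono (by simp [T])), fun h => ⟨?_, ?_⟩, fun h => (h (hok₅.1 c3)).elim⟩
    · rw [r2, a5'.num _ (by simp [T]), hS.one]; simp
    · rw [r3, hd₄]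

end ThinTree

end

/-! ### Correctness of a step of the program -/

section

open Function (update)

namespace ThinTree

set_option linter.constructorNameAsVariable false

open ArrayProg ArrayState OrientedMap

variable {V E : Type*} {n : ℕ} {ι : E ≃ Fin n}

local notation "flip" => Equiv.flipDart E

variable {M : OrientedMap V E} {S : Contraction V E} {s s' : Mem}

theorem card_eq (ι : E ≃ Fin n) : Nat.card E = n := by
  rw [Nat.card_congr ι, Nat.card_fin]

theorem hasArms_zero (S : Contraction V E) (d : E × Bool) : S.HasArms d 0 :=
  ⟨fun _ h => (Nat.not_lt_zero _ h).elim, fun _ h => (Nat.not_lt_zero _ h).elim⟩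

theorem found_le_zero (s : Mem) :
    ArrayExpr.eval s (.var .found) ≤ ArrayExpr.eval s zero ↔ s.num .found = 0 := by
  rw [eval_zero, Nat.le_zero]; rfl

/-- Lengths are tried in decreasing order and nothing is searched after the first success, so the
arms found are longest. Every edge has arms of length 0, so failure means that all live edges are
loops. -/
theorem findLongest_spec (h : Sim ι M s S) (hs : s.num .found = 0) :
    s.Agree [.r, .d, .found, .best, .s, .y, .ok] (eval findLongest s) ∧
    ((eval findLongest s).num .found ≠ 0 → ∃ d, (eval findLongest s).num .best = code ι d ∧
      d.1 ∈ S.live ∧ ¬ S.IsLoop M d ∧ ∀ r < n,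
        (∃ d', d'.1 ∈ S.live ∧ ¬ S.IsLoop M d' ∧ S.HasArms d' r) → S.HasArms d r) ∧
    ((eval findLongest s).num .found = 0 → ∀ d, d.1 ∈ S.live → S.IsLoop M d) := by
  set T : List Var := [.r, .d, .found, .best, .s, .y, .ok] with hT
  suffices s.Agree T (eval findLongest s) ∧
    ((eval findLongest s).num .found ≠ 0 → ∃ d, (eval findLongest s).num .best = code ι d ∧
      d.1 ∈ S.live ∧ ¬ S.IsLoop M d ∧ ∀ r < n,
        (∃ d', d'.1 ∈ S.live ∧ ¬ S.IsLoop M d' ∧ S.HasArms d' r) → S.HasArms d r) ∧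
    ((eval findLongest s).num .found = 0 → ∀ r, 0 ≤ r → r < n → ∀ d,
      ¬ (d.1 ∈ S.live ∧ ¬ S.IsLoop M d ∧ S.HasArms d r)) by
    refine ⟨this.1, this.2.1, fun hf d hd => ?_⟩
    by_contra hl
    exact this.2.2 hf 0 le_rfl ((Nat.zero_le _).trans_lt (ι d.1).2) d ⟨hd, hl, hasArms_zero S d⟩
  refine eval_loop_induction (fun l s' => s.Agree T s' ∧
    (s'.num .found ≠ 0 → ∃ d, s'.num .best = code ι d ∧
      d.1 ∈ S.live ∧ ¬ S.IsLoop M d ∧ ∀ r < n,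
        (∃ d', d'.1 ∈ S.live ∧ ¬ S.IsLoop M d' ∧ S.HasArms d' r) → S.HasArms d r) ∧
    (s'.num .found = 0 → ∀ r, l ≤ r → r < n → ∀ d,
      ¬ (d.1 ∈ S.live ∧ ¬ S.IsLoop M d ∧ S.HasArms d r))) ?_ ?_
  · refine ⟨(Agree.refl _ _).setNum (by simp [T]) _, fun h' => ?_, fun _ r hr hr' => ?_⟩
    · rw [setNum_num_of_ne (by simp)] at h'
      exact (h' hs).elim
    · simp only [ArrayExpr.eval, h.m] at hr
      omega
  · rintro l hl s₁ ⟨h1, h2, h3⟩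
    have h1' := h1.setNum (x := .r) (by simp [T]) l
    simp only [setNum_num_of_ne (show Var.found ≠ .r by simp),
      setNum_num_of_ne (show Var.best ≠ .r by simp)]
    have hf : (s₁.setNum .r l).num .found = s₁.num .found := setNum_num_of_ne (by simp) _ _
    have hb : (s₁.setNum .r l).num .best = s₁.num .best := setNum_num_of_ne (by simp) _ _
    have hr := setNum_num_self s₁ .r l
    rw [← hf, ← hb] at h2
    rw [← hf] at h3
    generalize s₁.setNum .r l = s₂ at *
    rcases eval_ifle_cases (found_le_zero s₂) with ⟨c, he⟩ | ⟨c, he⟩ <;> rw [he]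
    · obtain ⟨h4, h5, h6⟩ := findArms_spec (h.agree h1' (by simp [T])) c
      rw [hr] at h5 h6
      refine ⟨(h1'.trans (h4.mono (by simp [T]))).setNum (by simp [T]) _, fun hf => ?_,
        fun hf r hlr hrn d => ?_⟩
      · obtain ⟨d, hd, hd1, hd2, hd3⟩ := h5 hf
        refine ⟨d, hd, hd1, hd2, fun r hr' hex => ?_⟩
        by_cases hrl : r ≤ l
        · exact hd3.mono hrl
        · obtain ⟨d', hd'⟩ := hex
          exact (h3 c r (by omega) hr' d' hd').elim
      · rcases hlr.eq_or_lt with rfl | hlr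
        · exact h6 hf d
        · exact h3 c r hlr hrn d
    · exact ⟨h1'.setNum (by simp [T]) _, h2, fun hf => (c hf).elim⟩

/-- The memories `s` and `s'` differ only in the number variables from `T` and the arrays from
`B`. -/
structure Change (T : List Var) (B : List Arr) (s s' : Mem) : Prop where
  arr : ∀ A ∉ B, s'.arr A = s.arr A
  out : s'.out = s.out
  num : ∀ x ∉ T, s'.num x = s.num x

namespace Change

variable {T T' : List Var} {B B' : List Arr} {s'' : Mem}

theorem refl (T : List Var) (B : List Arr) (s : Mem) : Change T B s s :=
  ⟨fun _ _ => rfl, rfl, fun _ _ => rfl⟩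

theorem trans (h : Change T B s s') (h' : Change T B s' s'') : Change T B s s'' :=
  ⟨fun x hx => (h'.arr x hx).trans (h.arr x hx), h'.out.trans h.out,
    fun x hx => (h'.num x hx).trans (h.num x hx)⟩

theorem setNum (h : Change T B s s') {x : Var} (hx : x ∈ T) (v : ℕ) :
    Change T B s (s'.setNum x v) :=
  ⟨h.arr, h.out, fun y hy => by
    rw [setNum_num_of_ne (fun h => hy (by rwa [h])), h.num y hy]⟩

theorem setArr (h : Change T B s s') {A : Arr} (hA : A ∈ B) (i v : ℕ) :
    Change T B s (s'.setArr A i v) :=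
  ⟨fun A' hA' => by
    rw [← h.arr A' hA']
    exact Function.update_of_ne (fun h => hA' (by rwa [h])) _ _, h.out, h.num⟩

theorem mono (h : Change T B s s') (hT : ∀ x ∈ T, x ∈ T') (hB : ∀ x ∈ B, x ∈ B') :
    Change T' B' s s' :=
  ⟨fun x hx => h.arr x fun h => hx (hB x h), h.out, fun x hx => h.num x fun h => hx (hT x h)⟩

end Change

theorem _root_.ArrayState.Agree.change {T : List Var} (h : s.Agree T s') (B : List Arr) :
    Change T B s s' :=
  ⟨fun _ _ => by rw [h.arr], h.out, h.num⟩

theorem setArr_arr_self (s : Mem) (A : Arr) (i v : ℕ) :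
    (s.setArr A i v).arr A = update (s.arr A) i v := Function.update_self _ _ _

theorem setArr_arr_of_ne {A B : Arr} (h : B ≠ A) (s : Mem) (i v : ℕ) :
    (s.setArr A i v).arr B = s.arr B := Function.update_of_ne h _ _

theorem eval_set (A : Arr) (e₁ e₂ : Expr) (s : Mem) :
    eval (.set A e₁ e₂) s = s.setArr A (e₁.eval s) (e₂.eval s) := rfl

/-- A loop that computes all entries of an array. -/
theorem map_spec (ι : E ≃ Fin n) (hdd : s.num .dd = 2 * n) {T : List Var} (hd : Var.d ∈ T) {A : Arr}
    {f : E × Bool → ℕ} {p : Prog}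
    (hp : ∀ s', Change T [A] s s' → ∀ d, s'.num .d = code ι d →
      s'.arr A (code ι d) = s.arr A (code ι d) →
      Change T [A] s' (eval p s') ∧ (eval p s').arr A = update (s'.arr A) (code ι d) (f d))
    {p' : Prog} (hp' : p' = .loop .d (.var .dd) p) :
    Change T [A] s (eval p' s) ∧ ∀ d, (eval p' s).arr A (code ι d) = f d := by
  suffices Change T [A] s (eval p' s) ∧
      (∀ d, code ι d < 0 → (eval p' s).arr A (code ι d) = s.arr A (code ι d)) ∧
      ∀ d, 0 ≤ code ι d → (eval p' s).arr A (code ι d) = f d from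
    ⟨this.1, fun d => this.2.2 d (Nat.zero_le _)⟩
  subst hp'
  refine eval_loop_induction (fun l s' => Change T [A] s s' ∧
    (∀ d, code ι d < l → s'.arr A (code ι d) = s.arr A (code ι d)) ∧
    ∀ d, l ≤ code ι d → s'.arr A (code ι d) = f d) ?_ ?_
  · refine ⟨(Change.refl _ _ _).setNum hd _, fun d _ => rfl, fun d hd => ?_⟩
    have := code_lt ι d
    simp only [ArrayExpr.eval, hdd] at hd
    omega
  · rintro l hl s₁ ⟨h1, h2, h3⟩
    simp only [ArrayExpr.eval, hdd] at hl
    obtain ⟨d, rfl⟩ := exists_code ι hl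
    obtain ⟨h4, h5⟩ := hp (s₁.setNum .d (code ι d)) (h1.setNum hd _) d (setNum_num_self _ _ _)
      (h2 d (Nat.lt_succ_self _))
    refine ⟨((h1.setNum hd _).trans h4).setNum hd _, fun d' hd' => ?_, fun d' hd' => ?_⟩
    · change (eval p _).arr A _ = _
      rw [h5, Function.update_of_ne (by omega)]
      exact h2 d' (by omega)
    · change (eval p _).arr A _ = _
      rw [h5]
      rcases hd'.eq_or_lt with he | hlt
      · rw [← code_injective ι he, Function.update_self]
      · rw [Function.update_of_ne (by omega)]
        exact h3 d' hlt

theorem relabel_spec (ι : E ≃ Fin n) (hdd : s.num .dd = 2 * n) :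
    Change [.d] [.lab] s (eval relabel s) ∧ ∀ d, (eval relabel s).arr .lab (code ι d) =
      if s.arr .lab (code ι d) = s.num .a then s.num .b else s.arr .lab (code ι d) := by
  refine map_spec ι hdd (by simp) (fun s' h d hd hA => ?_) rfl
  have hn : ArrayExpr.eval s' (.get .lab (.var .d)) = ArrayExpr.eval s' (.var .a) ↔
      s.arr .lab (code ι d) = s.num .a := by
    simp only [ArrayExpr.eval, hd, hA, h.num .a (by simp)]
  rcases eval_ifeq_cases hn with ⟨c, he⟩ | ⟨c, he⟩ <;> rw [he]
  · rw [if_pos c, eval_set]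
    refine ⟨(Change.refl _ _ _).setArr (by simp) _ _, ?_⟩
    rw [setArr_arr_self]
    simp only [ArrayExpr.eval, hd, h.num .b (by simp)]
  · rw [if_neg c, ← hA, Function.update_eq_self]
    exact ⟨.refl _ _ _, rfl⟩

/-- Redirecting every pointer to `z` to the successor of `z`, and then making `z` point to itself,
is `Equiv.Perm.skip`. -/
theorem removeDart_spec {p : Equiv.Perm (E × Bool)} {z : E × Bool} (hdd : s.num .dd = 2 * n)
    (hx : s.num .x = code ι z) (hp : ∀ d, s.arr .next (code ι d) = code ι (p d)) :
    Change [.d, .v] [.next, .dead] s (eval removeDart s) ∧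
      (∀ d, (eval removeDart s).arr .next (code ι d) = code ι (Equiv.Perm.skip z p d)) ∧
      (eval removeDart s).arr .dead = update (s.arr .dead) (code ι z) (s.num .one) := by
  rw [removeDart, eval_seq, eval_seq, eval_seq, eval_assign]
  have hv : ArrayExpr.eval s (.get .next (.var .x)) = code ι (p z) := by
    simp only [ArrayExpr.eval, hx, hp]
  rw [hv]
  have h1 := (Change.refl [.d, .v] [.next, .dead] s).setNum (x := .v) (by simp) (code ι (p z))
  have h1' : (s.setNum .v (code ι (p z))).arr = s.arr := rfl
  have hv₁ := setNum_num_self s .v (code ι (p z))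
  generalize s.setNum .v (code ι (p z)) = s₁ at *
  have hx₁ : s₁.num .x = code ι z := by rw [h1.num _ (by simp), hx]
  obtain ⟨h2, h2'⟩ := map_spec (s := s₁) ι (by rw [h1.num _ (by simp), hdd]) (T := [.d]) (A := .next)
    (by simp) (f := fun d => if code ι (p d) = code ι z then code ι (p z) else code ι (p d)) (fun s' h d hd hA => by
      rw [h1', hp] at hA
      have hn : ArrayExpr.eval s' (.get .next (.var .d)) = ArrayExpr.eval s' (.var .x) ↔
          code ι (p d) = code ι z := by
        simp only [ArrayExpr.eval, hd, hA, h.num .x (by simp), hx₁]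
      rcases eval_ifeq_cases hn (p := .set .next (.var .d) (.var .v)) (q := .skip)
        with ⟨c, he⟩ | ⟨c, he⟩ <;> rw [he]
      · rw [if_pos c, eval_set]
        refine ⟨(Change.refl _ _ _).setArr (by simp) _ _, ?_⟩
        rw [setArr_arr_self]
        simp only [ArrayExpr.eval, hd, h.num .v (by simp), hv₁]
      · rw [if_neg c, ← hA, Function.update_eq_self]
        exact ⟨.refl _ _ _, rfl⟩) rfl
  generalize eval (.loop .d (.var .dd) _) s₁ = s₂ at *
  have hx₂ : s₂.num .x = code ι z := by rw [h2.num _ (by simp), hx₁]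
  have ho₂ : s₂.num .one = s.num .one := by rw [h2.num _ (by simp), h1.num _ (by simp)]
  rw [eval_set, eval_set]
  simp only [ArrayExpr.eval, hx₂]
  have h3 := ((h1.trans (h2.mono (by simp) (by simp))).setArr (A := .next) (by simp) (code ι z)
    (code ι z)).setArr (A := .dead) (by simp) (code ι z) (s.num .one)
  have hx₃ : (s₂.setArr .next (code ι z) (code ι z)).num .x = code ι z := hx₂
  have ho₃ : (s₂.setArr .next (code ι z) (code ι z)).num .one = s.num .one := ho₂
  rw [hx₃, ho₃]
  refine ⟨h3, fun d => ?_, ?_⟩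
  · rw [setArr_arr_of_ne (by simp), setArr_arr_self]
    by_cases hd : d = z
    · rw [hd, Function.update_self, Equiv.Perm.skip_apply_self]
    · rw [Function.update_of_ne (by rwa [Ne, code_eq_iff]), h2']
      split_ifs with c <;> rw [code_eq_iff] at c
      · rw [Equiv.Perm.skip_apply_of_eq c]
      · rw [Equiv.Perm.skip_apply_of_ne c hd]
  · rw [setArr_arr_self, setArr_arr_of_ne (by simp), h2.arr _ (by simp), h1']

/-- The form with merged labels serves both kinds of steps: after `selectBest` it is a contraction,
and for a loop the merging changes nothing. The two labels are copied to `a` and `b` first, since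
`relabel` overwrites the array. -/
theorem removeBest_spec (h : Sim ι M s S) {d : E × Bool} (hb : s.num .best = code ι d) :
    Sim ι M (eval removeBest s) { S.remove d with
      lab := fun v => if S.lab v = S.lab (M.tail d) then S.lab (M.tail (flip d)) else S.lab v } := by
  rw [removeBest, eval_seq, eval_seq, eval_seq, eval_seq, eval_seq, eval_seq]
  set T : List Var := [.a, .b, .d, .x, .v] with hT
  rw [eval_assign, eval_assign, eval_assign, eval_assign]
  have he : ArrayExpr.eval s (.get .lab (.var .best)) = S.lab (M.tail d) := by
    simp only [ArrayExpr.eval, hb, h.lab]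
  rw [he]
  have he : ArrayExpr.eval (s.setNum .a (S.lab (M.tail d))) (.get .lab (.get .other (.var .best))) =
      S.lab (M.tail (flip d)) := by
    have h1 : (s.setNum .a (S.lab (M.tail d))).arr = s.arr := rfl
    simp only [ArrayExpr.eval, setNum_num_of_ne (show Var.best ≠ .a by simp), hb, h1, h.other, h.lab]
  rw [he]
  have h1 := ((Agree.refl T s).setNum (x := .a) (by simp [T]) (S.lab (M.tail d))).setNum
    (x := .b) (by simp [T]) (S.lab (M.tail (flip d)))
  have ha₁ : ((s.setNum .a (S.lab (M.tail d))).setNum .b (S.lab (M.tail (flip d)))).num .a =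
      S.lab (M.tail d) := by
    rw [setNum_num_of_ne (by simp), setNum_num_self]
  have hb₁ : ((s.setNum .a (S.lab (M.tail d))).setNum .b (S.lab (M.tail (flip d)))).num .b =
      S.lab (M.tail (flip d)) := setNum_num_self _ _ _
  generalize (s.setNum .a (S.lab (M.tail d))).setNum .b (S.lab (M.tail (flip d))) = s₁ at *
  have hS₁ := h.agree h1 (by simp [T])
  obtain ⟨h2, h2'⟩ := relabel_spec (s := s₁) ι hS₁.dd
  generalize eval relabel s₁ = s₂ at *
  have c2 : Change T [.next, .dead, .lab] s s₂ :=
    (h1.change _).trans (h2.mono (by simp [T]) (by simp))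
  have hbest₂ : s₂.num .best = code ι d := by rw [c2.num _ (by simp [T]), hb]
  have he : ArrayExpr.eval s₂ (.var .best) = code ι d := hbest₂
  rw [he]
  have c3 := c2.setNum (x := .x) (by simp [T]) (code ι d)
  have hx₃ := setNum_num_self s₂ .x (code ι d)
  have ha₃ : (s₂.setNum .x (code ι d)).arr = s₂.arr := rfl
  generalize s₂.setNum .x (code ι d) = s₃ at *
  obtain ⟨h4, h4', h4''⟩ := removeDart_spec (s := s₃) (ι := ι) (p := S.next)
    (by rw [c3.num _ (by simp [T]), h.dd]) hx₃ fun y => by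
      rw [ha₃, h2.arr _ (by simp), hS₁.next]
  generalize eval removeDart s₃ = s₄ at *
  have c4 := c3.trans (h4.mono (by simp [T]) (by simp))
  have he : ArrayExpr.eval s₄ (.get .other (.var .best)) = code ι (flip d) := by
    simp only [ArrayExpr.eval, c4.num .best (by simp [T]), hb, c4.arr .other (by simp), h.other]
  rw [he]
  have c5 := c4.setNum (x := .x) (by simp [T]) (code ι (flip d))
  have hx₅ := setNum_num_self s₄ .x (code ι (flip d))
  have ha₅ : (s₄.setNum .x (code ι (flip d))).arr = s₄.arr := rfl
  generalize s₄.setNum .x (code ι (flip d)) = s₅ at *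
  obtain ⟨h6, h6', h6''⟩ := removeDart_spec (s := s₅) (ι := ι) (p := S.next.skip d)
    (by rw [c5.num _ (by simp [T]), h.dd]) hx₅ fun y => by rw [ha₅, h4']
  generalize eval removeDart s₅ = s₆ at *
  have c6 := c5.trans (h6.mono (by simp [T]) (by simp))
  exact {
    N := by rw [c6.num _ (by simp [T])]; exact h.N
    one := by rw [c6.num _ (by simp [T])]; exact h.one
    m := by rw [c6.num _ (by simp [T])]; exact h.m
    dd := by rw [c6.num _ (by simp [T])]; exact h.dd
    other := by rw [c6.arr _ (by simp)]; exact h.other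
    next := h6'
    lab := fun y => by
      rw [h6.arr _ (by simp), ha₅, h4.arr _ (by simp), ha₃, h2', ha₁, hb₁, hS₁.lab]
    dead := fun y => by
      rw [h6'', ha₅, h4'', ha₃, h2.arr _ (by simp), c5.num _ (by simp [T]), c3.num _ (by simp [T]),
        h.one]
      by_cases hy : y.1 = d.1
      · have : y.1 ∉ S.live \ {d.1} := fun h => h.2 hy
        refine iff_of_false ?_ this
        rcases eq_or_eq_flip hy with rfl | rfl
        · rw [Function.update_of_ne (by rw [Ne, code_eq_iff]; exact (flip_ne y).symm),
            Function.update_self]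
          simp
        · rw [Function.update_self]
          simp
      · obtain ⟨hy1, hy2⟩ := fst_ne_iff.1 hy
        rw [Function.update_of_ne (by rwa [Ne, code_eq_iff]),
          Function.update_of_ne (by rwa [Ne, code_eq_iff]), hS₁.dead]
        exact ⟨fun h => ⟨h, hy⟩, fun h => h.1⟩
    sel := by rw [c6.arr _ (by simp)]; exact h.sel }

theorem selectBest_spec (h : Sim ι M s S) {d : E × Bool} (hb : s.num .best = code ι d) :
    (eval selectBest s).num .best = code ι d ∧
      Sim ι M (eval selectBest s) { S with sel := insert d.1 S.sel } := by
  rw [selectBest, eval_seq, eval_set, eval_set]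
  have he : ArrayExpr.eval (s.setArr .sel (ArrayExpr.eval s (.var .best))
      (ArrayExpr.eval s (.var .one))) (.get .other (.var .best)) = code ι (flip d) := by
    have h1 : (s.setArr .sel (ArrayExpr.eval s (.var .best)) (ArrayExpr.eval s (.var .one))).num =
      s.num := rfl
    simp only [ArrayExpr.eval] at h1 ⊢
    rw [h1, setArr_arr_of_ne (by simp), hb, h.other]
  rw [he]
  have h1 : ArrayExpr.eval s (.var .best) = code ι d := hb
  have h2 : ArrayExpr.eval s (.var .one) = 1 := h.one
  have h3 : ArrayExpr.eval (s.setArr .sel (code ι d) 1) (.var .one) = 1 := h.one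
  rw [h1, h2, h3]
  have c := ((Change.refl [] [.sel] s).setArr (A := .sel) (by simp) (code ι d) 1).setArr (A := .sel)
    (by simp) (code ι (flip d)) 1
  refine ⟨hb, h.N, h.one, h.m, h.dd, ?_, ?_, ?_, ?_, fun y => ?_⟩
  · rw [c.arr _ (by simp)]; exact h.other
  · rw [c.arr _ (by simp)]; exact h.next
  · rw [c.arr _ (by simp)]; exact h.lab
  · rw [c.arr _ (by simp)]; exact h.dead
  · rw [setArr_arr_self, setArr_arr_self]
    by_cases hy : y.1 = d.1
    · refine iff_of_false ?_ fun h => h (Or.inl hy)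
      rcases eq_or_eq_flip hy with rfl | rfl
      · rw [Function.update_of_ne (by rw [Ne, code_eq_iff]; exact (flip_ne y).symm),
          Function.update_self]
        simp
      · rw [Function.update_self]
        simp
    · obtain ⟨hy1, hy2⟩ := fst_ne_iff.1 hy
      rw [Function.update_of_ne (by rwa [Ne, code_eq_iff]),
        Function.update_of_ne (by rwa [Ne, code_eq_iff]), h.sel]
      simp only [Set.mem_insert_iff, hy, false_or]

theorem step_spec (h : Sim ι M s S) (hS : Contraction.Good M S) :
    ∃ S', Contraction.Step M S S' ∧ Sim ι M (eval step s) S' := by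
  rw [step, eval_seq, eval_seq, eval_assign, eval_zero]
  have h1 := (Agree.refl [.found] s).setNum (x := .found) (by simp) 0
  have hf₁ := setNum_num_self s .found 0
  generalize s.setNum .found 0 = s₁ at *
  have hS₁ := h.agree h1 (by simp)
  obtain ⟨h2, h2a, h2b⟩ := findLeaf_spec hS₁ hf₁
  generalize eval findLeaf s₁ = s₂ at *
  have hS₂ := hS₁.agree h2 (by simp)
  rcases eval_ifle_cases (found_le_zero s₂) with ⟨c, he⟩ | ⟨c, he⟩ <;> rw [he]
  · rw [eval_seq]
    obtain ⟨h3, h3a, h3b⟩ := findLongest_spec hS₂ c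
    generalize eval findLongest s₂ = s₃ at *
    have hS₃ := hS₂.agree h3 (by simp)
    rcases eval_ifle_cases (found_le_zero s₃) with ⟨c', he⟩ | ⟨c', he⟩ <;> rw [he]
    · exact ⟨S, .idle (h2b c) (h3b c'), hS₃⟩
    · obtain ⟨d, hd, hd1, hd2, hd3⟩ := h3a c'
      rw [eval_seq]
      obtain ⟨h4a, h4b⟩ := selectBest_spec hS₃ hd
      exact ⟨S.contract M d, .contract d hd1 hd2 (h2b c)
        (by rwa [card_eq ι]), removeBest_spec h4b h4a⟩
  · obtain ⟨d, hd, hd1, hd2⟩ := h2a c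
    refine ⟨S.remove d, .prune d hd1 hd2, ?_⟩
    have hl : S.lab (M.tail d) = S.lab (M.tail (flip d)) := by rw [← hS.lab_next, hd2]
    convert removeBest_spec hS₂ hd using 1
    have : (fun v => if S.lab v = S.lab (M.tail d) then S.lab (M.tail (flip d)) else S.lab v) =
        S.lab := by
      funext v
      split_ifs with hv
      · rw [hv, hl]
      · rfl
    rw [this]
    rfl

end ThinTree

end

/-! ### Input, output, and the whole run -/

section

open Function (update)

namespace ThinTree

set_option linter.constructorNameAsVariable false

open ArrayProg ArrayState OrientedMap

variable {V E : Type*} {n : ℕ} {ι : E ≃ Fin n}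

local notation "flip" => Equiv.flipDart E

variable {M : OrientedMap V E} {S : Contraction V E} {s s' : Mem}

theorem eval_add {e₁ e₂ : Expr} (h : e₁.eval s + e₂.eval s ≤ s.num .N) :
    ArrayExpr.eval s (add e₁ e₂) = e₁.eval s + e₂.eval s := by
  simp only [add, ArrayExpr.eval]
  omega

theorem eval_double {x : Var} (h : 2 * s.num x ≤ s.num .N) :
    ArrayExpr.eval s (double x) = 2 * s.num x := by
  rw [double, eval_add] <;> simp only [ArrayExpr.eval] <;> omega

theorem code_flip (ι : E ≃ Fin n) {d : E × Bool} {l : ℕ} (h1 : 2 * l ≤ code ι d)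
    (h2 : code ι d < 2 * (l + 1)) :
    code ι d = 2 * l ∧ code ι (flip d) = 2 * l + 1 ∨
      code ι d = 2 * l + 1 ∧ code ι (flip d) = 2 * l := by
  rcases d with ⟨e, b⟩
  cases b <;> simp [code, Equiv.flipDart] at * <;> omega

/-- Two numbers precede the table, and each half-edge has two entries there, so the half-edge with
code `c` is described at positions `2 + 2 c` and `3 + 2 c`. The bound `hN` exceeds all these
positions, which makes the truncated sums correct. -/
theorem start_spec {lab : V → ℕ} {l : List ℕ} (h1 : l.getD 1 0 = n)
    (hlab : ∀ d, l.getD (2 + 2 * code ι d) 0 = lab (M.tail d))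
    (hrot : ∀ d, l.getD (3 + 2 * code ι d) 0 = code ι (M.rot d))
    (hN : 4 * n + 2 ≤ (l.flatMap EmbeddedGraph.encodeNumber).length) :
    Sim ι M (eval start (initState .N .one .inp l)) (Contraction.init M lab) := by
  have hone : (initState Var.N Var.one Arr.inp l).num .one = 1 := by simp [initState]
  have hNN : (initState Var.N Var.one Arr.inp l).num .N =
    (l.flatMap EmbeddedGraph.encodeNumber).length := by simp [initState]
  have hinp : ∀ i, (initState Var.N Var.one Arr.inp l).arr .inp i = l.getD i 0 := by
    simp [initState]
  have hsel : ∀ i, (initState Var.N Var.one Arr.inp l).arr .sel i = 0 := by simp [initState]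
  have hdead : ∀ i, (initState Var.N Var.one Arr.inp l).arr .dead i = 0 := by simp [initState]
  generalize initState Var.N Var.one Arr.inp l = s at *
  rw [start, eval_seq, eval_seq, eval_seq, eval_seq, eval_assign, eval_assign]
  have he : ArrayExpr.eval s (.get .inp (.var .one)) = n := by
    simp only [ArrayExpr.eval, hone, hinp, h1]
  rw [he]
  have he : ArrayExpr.eval (s.setNum .m n) (double .m) = 2 * n := by
    rw [eval_double] <;> rw [setNum_num_self]
    rw [setNum_num_of_ne (by simp), hNN]
    omega
  rw [he]
  have c1 := ((Change.refl [.m, .dd, .d, .x] [.other, .lab, .next] s).setNum (x := .m) (by simp)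
    n).setNum (x := .dd) (by simp) (2 * n)
  have hm₁ : ((s.setNum .m n).setNum .dd (2 * n)).num .m = n := by
    rw [setNum_num_of_ne (by simp), setNum_num_self]
  have hdd₁ : ((s.setNum .m n).setNum .dd (2 * n)).num .dd = 2 * n := setNum_num_self _ _ _
  generalize (s.setNum .m n).setNum .dd (2 * n) = s₁ at *
  obtain ⟨c2, h2⟩ : Change [.d] [.other] s₁ (eval (.loop .d (.var .m) <|
      .seq (.set .other (double .d) (add (double .d) (.var .one)))
        (.set .other (add (double .d) (.var .one)) (double .d))) s₁) ∧
      ∀ d, 2 * 0 ≤ code ι d → (eval (.loop .d (.var .m) <|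
      .seq (.set .other (double .d) (add (double .d) (.var .one)))
        (.set .other (add (double .d) (.var .one)) (double .d))) s₁).arr .other (code ι d) =
        code ι (flip d) := by
    refine eval_loop_induction (fun l s' => Change [.d] [.other] s₁ s' ∧
      ∀ d, 2 * l ≤ code ι d → s'.arr .other (code ι d) = code ι (flip d)) ?_ ?_
    · refine ⟨(Change.refl _ _ _).setNum (by simp) _, fun d hd => ?_⟩
      have := code_lt ι d
      simp only [ArrayExpr.eval, hm₁] at hd
      omega
    · rintro l hl s' ⟨h, h'⟩
      simp only [ArrayExpr.eval, hm₁] at hl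
      have hd := setNum_num_self s' .d l
      have h₂ := h.setNum (x := .d) (by simp) l
      have ha : (s'.setNum .d l).arr = s'.arr := rfl
      generalize s'.setNum .d l = s₂ at *
      have hN₂ : 4 * n + 2 ≤ s₂.num .N := by
        rw [h₂.num _ (by simp), c1.num _ (by simp), hNN]
        exact hN
      have ho₂ : s₂.num .one = 1 := by rw [h₂.num _ (by simp), c1.num _ (by simp), hone]
      have hexpr : ∀ s₃ : Mem, s₃.num = s₂.num → ArrayExpr.eval s₃ (double .d) = 2 * l ∧
          ArrayExpr.eval s₃ (add (double .d) (.var .one)) = 2 * l + 1 := by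
        intro s₃ hs₃
        have h4 : ArrayExpr.eval s₃ (double .d) = 2 * l := by
          rw [eval_double] <;> rw [hs₃, hd]
          omega
        refine ⟨h4, ?_⟩
        rw [eval_add] <;> rw [h4] <;> simp only [ArrayExpr.eval, hs₃, ho₂]
        omega
      rw [eval_seq, eval_set, eval_set]
      rw [(hexpr s₂ rfl).1, (hexpr s₂ rfl).2]
      rw [(hexpr (s₂.setArr .other (2 * l) (2 * l + 1)) rfl).1,
        (hexpr (s₂.setArr .other (2 * l) (2 * l + 1)) rfl).2]
      refine ⟨((h₂.setArr (by simp) _ _).setArr (by simp) _ _).setNum (by simp) _, fun d hdl => ?_⟩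
      change ((s₂.setArr .other (2 * l) (2 * l + 1)).setArr .other (2 * l + 1) (2 * l)).arr .other
        (code ι d) = _
      rw [setArr_arr_self, setArr_arr_self]
      by_cases hlt : code ι d < 2 * (l + 1)
      · rcases code_flip ι hdl hlt with ⟨h5, h6⟩ | ⟨h5, h6⟩
        · rw [h5, h6, Function.update_of_ne (by omega), Function.update_self]
        · rw [h5, h6, Function.update_self]
      · rw [Function.update_of_ne (by omega), Function.update_of_ne (by omega), ha]
        exact h' d (by omega)
  generalize eval _ s₁ = s₂ at *
  have c2' := c1.trans (c2.mono (by simp) (by simp))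
  have hN' : ∀ s', Change [.m, .dd, .d, .x] [.other, .lab, .next] s s' → 4 * n + 2 ≤ s'.num .N :=
    fun s' h => by rw [h.num _ (by simp), hNN]; exact hN
  have hone' : ∀ s', Change [.m, .dd, .d, .x] [.other, .lab, .next] s s' →
      s'.num .one = 1 ∧ ArrayExpr.eval s' (double .one) = 2 := by
    intro s' h
    have h1 : s'.num .one = 1 := by rw [h.num _ (by simp), hone]
    refine ⟨h1, ?_⟩
    have := hN' s' h
    rw [eval_double] <;> rw [h1]
    omega
  obtain ⟨c3, h3⟩ := map_spec (s := s₂) ι (by rw [c2.num _ (by simp), hdd₁]) (T := [.d])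
    (A := .lab) (by simp) (f := fun d => lab (M.tail d))
    (p := .set .lab (.var .d) (.get .inp (add (double .one) (double .d)))) (fun s' h d hd hA => by
      have hc := c2'.trans (h.mono (by simp) (by simp))
      have hlt := code_lt ι d
      have hN' := hN' s' hc
      obtain ⟨ho, ho'⟩ := hone' s' hc
      have he : ArrayExpr.eval s' (.get .inp (add (double .one) (double .d))) = lab (M.tail d) := by
        rw [ArrayExpr.eval, eval_add] <;> rw [ho', eval_double, hd]
        · rw [hc.arr _ (by simp), hinp, hlab]
        · rw [hd]; omega
        · omega
        · rw [hd]; omega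
      rw [eval_set, he]
      refine ⟨(Change.refl _ _ _).setArr (by simp) _ _, ?_⟩
      rw [setArr_arr_self]
      simp only [ArrayExpr.eval, hd]) rfl
  generalize eval _ s₂ = s₃ at *
  have c3' := c2'.trans (c3.mono (by simp) (by simp))
  obtain ⟨c4, h4⟩ := map_spec (s := s₃) ι (by rw [c3.num _ (by simp), c2.num _ (by simp), hdd₁])
    (T := [.d, .x]) (A := .next) (by simp) (f := fun d => code ι (M.facePerm d))
    (p := .seq (.assign .x (.get .other (.var .d)))
      (.set .next (.var .d) (.get .inp (add (add (double .one) (.var .one)) (double .x)))))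
    (fun s' h d hd hA => by
      have hx : ArrayExpr.eval s' (.get .other (.var .d)) = code ι (flip d) := by
        simp only [ArrayExpr.eval, hd, h.arr .other (by simp), c3.arr .other (by simp)]
        exact h2 d (Nat.zero_le _)
      rw [eval_seq, eval_assign, hx]
      have h5 := (Change.refl [.d, .x] [.next] s').setNum (x := .x) (by simp) (code ι (flip d))
      have h6 := h.trans h5
      have hx := setNum_num_self s' .x (code ι (flip d))
      have ha : (s'.setNum .x (code ι (flip d))).arr = s'.arr := rfl
      have hd' : (s'.setNum .x (code ι (flip d))).num .d = code ι d := by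
        rw [setNum_num_of_ne (by simp), hd]
      generalize s'.setNum .x (code ι (flip d)) = s'' at *
      have hc := c3'.trans (h6.mono (by simp) (by simp))
      have hlt := code_lt ι (flip d)
      have hN' := hN' s'' hc
      obtain ⟨ho, ho'⟩ := hone' s'' hc
      have ho2 : ArrayExpr.eval s'' (add (double .one) (.var .one)) = 3 := by
        rw [eval_add] <;> rw [ho'] <;> simp only [ArrayExpr.eval, ho]
        omega
      have he : ArrayExpr.eval s'' (.get .inp (add (add (double .one) (.var .one)) (double .x))) =
          code ι (M.facePerm d) := by
        rw [ArrayExpr.eval, eval_add] <;> rw [ho2, eval_double, hx]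
        · rw [hc.arr _ (by simp), hinp, hrot]
          rfl
        · rw [hx]; omega
        · omega
        · rw [hx]; omega
      rw [eval_set, he]
      refine ⟨h5.setArr (by simp) _ _, ?_⟩
      rw [setArr_arr_self, ha]
      simp only [ArrayExpr.eval, hd']) rfl
  generalize eval _ s₃ = s₄ at *
  have c4' := c3'.trans (c4.mono (by simp) (by simp))
  exact {
    N := by have := hN' _ c4'; omega
    one := (hone' _ c4').1
    m := by rw [c4.num _ (by simp), c3.num _ (by simp), c2.num _ (by simp), hm₁]
    dd := by rw [c4.num _ (by simp), c3.num _ (by simp), c2.num _ (by simp), hdd₁]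
    other := fun d => by
      rw [c4.arr _ (by simp), c3.arr _ (by simp)]
      exact h2 d (Nat.zero_le _)
    next := h4
    lab := fun d => by rw [c4.arr _ (by simp), h3]; rfl
    dead := fun d => by
      rw [c4'.arr _ (by simp), hdead]
      exact iff_of_true rfl trivial
    sel := fun d => by
      rw [c4'.arr _ (by simp), hsel]
      exact iff_of_true rfl id }

/-- The output lists the selected edges. -/
theorem emit_spec (h : Sim ι M s S) (e : E) :
    (eval (.loop .d (.var .m) (.emit (.get .sel (double .d)))) s).out[(ι e : ℕ)]? = some true ↔
      e ∈ S.sel := by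
  -- Bits are pushed in front while the edge numbers descend, so the bit of edge `i` ends at
  -- position `i`. The output is reset for the comparison of memories, since the loop changes it.
  suffices s.Agree [.d] { eval (.loop .d (.var .m) (.emit (.get .sel (double .d)))) s
      with out := s.out } ∧ ∀ e, 0 ≤ (ι e : ℕ) →
        ((eval (.loop .d (.var .m) (.emit (.get .sel (double .d)))) s).out[(ι e : ℕ) - 0]? =
          some true ↔ e ∈ S.sel) from this.2 e (Nat.zero_le _)
  refine eval_loop_induction (fun l s' => s.Agree [.d] { s' with out := s.out } ∧
    ∀ e, l ≤ (ι e : ℕ) → (s'.out[(ι e : ℕ) - l]? = some true ↔ e ∈ S.sel)) ?_ ?_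
  · refine ⟨(Agree.refl _ _).setNum (by simp) _, fun e he => ?_⟩
    have := (ι e).2
    simp only [ArrayExpr.eval, h.m] at he
    omega
  · rintro l hl s₁ ⟨h1, h2⟩
    simp only [ArrayExpr.eval, h.m] at hl
    have hd := setNum_num_self s₁ .d l
    have ho : (s₁.setNum .d l).out = s₁.out := rfl
    have h3 : s.Agree [.d] { s₁.setNum .d l with out := s.out } := h1.setNum (x := .d) (by simp) l
    generalize s₁.setNum .d l = s₂ at *
    refine ⟨h3.setNum (x := .d) (by simp) l, fun e he => ?_⟩
    change ((_ :: s₂.out)[(ι e : ℕ) - l]? = some true ↔ e ∈ S.sel)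
    rcases he.eq_or_lt with rfl | hlt
    · have hN : s₂.num .N = s.num .N := h3.num .N (by simp)
      have hsel : s₂.arr = s.arr := h3.arr
      have := h.N
      have he : ArrayExpr.eval s₂ (.get .sel (double .d)) = s.arr .sel (code ι (e, false)) := by
        rw [ArrayExpr.eval, eval_double, hd, hsel]
        · simp [code]
        · rw [hd, hN]; omega
      rw [Nat.sub_self, List.getElem?_cons_zero, he, Option.some_inj, bne_iff_ne, ne_eq, h.sel,
        not_not]
    · rw [show (ι e : ℕ) - l = (ι e : ℕ) - (l + 1) + 1 by omega, List.getElem?_cons_succ, ho]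
      exact h2 e hlt

/-- The algorithm does what it should. -/
theorem main_spec [Finite V] (M : OrientedMap V E) (ι : E ≃ Fin n) {lab : V → ℕ}
    (hinj : Function.Injective lab) {l : List ℕ} (h1 : l.getD 1 0 = n)
    (hlab : ∀ d, l.getD (2 + 2 * code ι d) 0 = lab (M.tail d))
    (hrot : ∀ d, l.getD (3 + 2 * code ι d) 0 = code ι (M.rot d))
    (hN : 4 * n + 2 ≤ (l.flatMap EmbeddedGraph.encodeNumber).length) :
    ∃ S : ℕ → Contraction V E, S 0 = Contraction.init M lab ∧
      (∀ i < Nat.card E, Contraction.Step M (S i) (S (i + 1))) ∧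
      ∀ e, (eval main (initState .N .one .inp l)).out[(ι e : ℕ)]? = some true ↔
        e ∈ (S (Nat.card E)).sel := by
  have : Finite E := Finite.of_equiv _ ι.symm
  have hS := start_spec h1 hlab hrot hN
  rw [main, eval_seq, eval_seq, card_eq ι]
  generalize eval start _ = s at *
  obtain ⟨j, hj, S, hS0, hstep, hSj, -⟩ : ∃ j, n = 0 + j ∧ ∃ S : ℕ → Contraction V E, S 0 = Contraction.init M lab ∧
        (∀ i < j, Contraction.Step M (S i) (S (i + 1))) ∧
        Sim ι M (eval (.loop .i (.var .m) step) s) (S j) ∧ Contraction.Good M (S j) := by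
    have hi {s' : Mem} {S' : Contraction V E} (h : Sim ι M s' S') (v : ℕ) :
        Sim ι M (s'.setNum .i v) S' :=
      h.agree ((Agree.refl [.i] _).setNum (by simp) v) (by simp)
    refine eval_loop_induction (fun l s' => ∃ j, n = l + j ∧
      ∃ S : ℕ → Contraction V E, S 0 = Contraction.init M lab ∧
        (∀ i < j, Contraction.Step M (S i) (S (i + 1))) ∧ Sim ι M s' (S j) ∧
          Contraction.Good M (S j)) ?_ ?_
    · exact ⟨0, hS.m.symm, fun _ => Contraction.init M lab, rfl,
        fun i hi => (Nat.not_lt_zero _ hi).elim, hi hS _, Contraction.good_init hinj⟩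
    · rintro l hl s' ⟨j, hj, S, hS0, hstep, hSj, hG⟩
      obtain ⟨S', h3, h4⟩ := step_spec (hi hSj l) hG
      refine ⟨j + 1, by omega, update S (j + 1) S', ?_, fun i hij => ?_, ?_, ?_⟩
      · rw [Function.update_of_ne (by omega), hS0]
      · rw [Function.update_of_ne (by omega : i ≠ j + 1)]
        rcases (Nat.lt_succ_iff_lt_or_eq.1 hij) with hlt | rfl
        · rw [Function.update_of_ne (by omega)]
          exact hstep i hlt
        · rw [Function.update_self]
          exact h3
      · rw [Function.update_self]
        exact hi h4 l
      · rw [Function.update_self]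
        exact h3.good hG
  rw [zero_add] at hj
  subst hj
  exact ⟨S, hS0, hstep, fun e => emit_spec hSj e⟩

end ThinTree

end

/-! ### Thin spanning trees of graphs -/

namespace Graph

open OrientedMap

namespace RotationSystem

variable {α : Type u} {β : Type v} {G : Graph α β} (R : RotationSystem G)

local notation "flip" => Equiv.flipDart G.edgeSet

/-- The combinatorial map of a rotation system. -/
def toMap : OrientedMap G.vertexSet G.edgeSet := ⟨R.tail, R.rot, R.sameCycle_iff⟩

theorem isLink (d : G.edgeSet × Bool) :
    G.IsLink d.1 (R.toMap.tail d) (R.toMap.tail (flip d)) := by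
  rcases d with ⟨e, b⟩
  cases b
  · exact R.isLink_tail e
  · exact (R.isLink_tail e).symm

theorem exists_dart {e : β} {x y : α} (h : G.IsLink e x y) :
    ∃ d : G.edgeSet × Bool, d.1 = e ∧ R.toMap.tail d = x ∧ R.toMap.tail (flip d) = y := by
  rcases (R.isLink (⟨e, h.edge_mem⟩, false)).eq_and_eq_or_eq_and_eq h with ⟨h1, h2⟩ | ⟨h1, h2⟩
  · exact ⟨_, rfl, h1, h2⟩
  · exact ⟨flip (⟨e, h.edge_mem⟩, false), rfl, h2, by rw [OrientedMap.flip_flip]; exact h1⟩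

theorem cut_eq (U : Set α) : G.cut U = Subtype.val '' R.toMap.cut {v | v.1 ∈ U} := by
  ext e
  constructor
  · rintro ⟨x, hx, y, hy, h⟩
    obtain ⟨d, rfl, rfl, rfl⟩ := R.exists_dart h
    exact ⟨d.1, ⟨d, rfl, hx, hy⟩, rfl⟩
  · rintro ⟨_, ⟨d, rfl, h1, h2⟩, rfl⟩
    exact ⟨_, h1, _, h2, R.isLink d⟩

theorem ncard_inter_cut (T : Set G.edgeSet) (U : Set α) :
    (Subtype.val '' T ∩ G.cut U).ncard = (T ∩ R.toMap.cut {v | v.1 ∈ U}).ncard := by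
  rw [R.cut_eq, ← Set.image_inter Subtype.val_injective,
    Set.ncard_image_of_injective _ Subtype.val_injective]

theorem ncard_cut (U : Set α) : (G.cut U).ncard = (R.toMap.cut {v | v.1 ∈ U}).ncard := by
  rw [R.cut_eq, Set.ncard_image_of_injective _ Subtype.val_injective]

theorem isEdgeConnected_toMap {k : ℕ} (h : G.IsEdgeConnected k) : R.toMap.IsEdgeConnected k := by
  intro U hU hU'
  have hpre : {v : G.vertexSet | v.1 ∈ Subtype.val '' U} = U := by
    ext v
    simp
  have := h.2 (Subtype.val '' U) (by rintro _ ⟨v, -, rfl⟩; exact v.2) (hU.image _) fun h' => hU' ?_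
  · rwa [R.ncard_cut, hpre] at this
  · rw [← hpre, h']
    ext v
    simp

theorem isSpanningTree {T : Set G.edgeSet} (hV : G.vertexSet.Nonempty)
    (h1 : ∀ v w, R.toMap.Reach T v w) (h2 : ¬ R.toMap.HasCycle T) :
    G.IsSpanningTree (Subtype.val '' T) := by
  refine ⟨by rintro _ ⟨e, -, rfl⟩; exact e.2, hV, fun x hx y hy => ?_, ?_⟩
  · refine (h1 ⟨x, hx⟩ ⟨y, hy⟩).lift Subtype.val ?_
    rintro v w ⟨d, hd, rfl, rfl⟩
    exact ⟨d.1, ⟨d.1, hd, rfl⟩, R.isLink d⟩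
  · rintro ⟨n, hn, x, e, hx, he, h⟩
    choose d hd1 hd2 hd3 using fun i => R.exists_dart (h i).2
    refine h2 ⟨n, hn, fun i => R.toMap.tail (d i), d, fun i j hij => ?_, fun i j hij => ?_,
      fun i => ⟨?_, rfl, Subtype.ext ?_⟩⟩
    · refine hx ?_
      rw [← hd2 i, ← hd2 j]
      exact congrArg Subtype.val hij
    · refine he ?_
      rw [← hd1 i, ← hd1 j]
      exact congrArg Subtype.val hij
    · obtain ⟨e', he', h'⟩ := (h i).1
      rwa [← Subtype.ext (h'.trans (hd1 i).symm)]
    · rw [hd3 i, hd2]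

theorem isThin {T : Set G.edgeSet} {k c : ℕ} (hk : 0 < k)
    (h : ∀ U, k * (T ∩ R.toMap.cut U).ncard ≤ c * (R.toMap.cut U).ncard) :
    G.IsThin (c / k) (Subtype.val '' T) := by
  intro U _
  rw [R.ncard_inter_cut, R.ncard_cut, div_mul_eq_mul_div, le_div_iff₀ (by exact_mod_cast hk),
    mul_comm]
  exact_mod_cast h _

/-- With at least two vertices and no empty cut there are no isolated vertices, so the faces are
exactly the orbits of the face permutation. As there is at least one component, `2 c - 2 g ≥ 2 - 2
γ`. -/
theorem euler_le (hV : G.vertexSet.Finite) (hG : G.IsEdgeConnected 1) {γ : ℕ} (h : R.GenusLE γ)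
    (h2 : 2 ≤ Nat.card G.vertexSet) :
    (2 : ℤ) - 2 * γ ≤ Nat.card G.vertexSet - Nat.card G.edgeSet +
      Nat.card (Quotient (Equiv.Perm.SameCycle.setoid R.toMap.facePerm)) := by
  obtain ⟨g, hg, h⟩ := h
  have hiso : {x ∈ G.vertexSet | ∀ e, ¬ G.Inc e x} = ∅ := by
    refine Set.eq_empty_iff_forall_notMem.2 fun x ⟨hx, hx'⟩ => ?_
    have hcut := hG.2 {x} (by simpa using hx) ⟨x, rfl⟩ fun h' => by
      rw [Nat.card_coe_set_eq, ← h', Set.ncard_singleton] at h2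
      omega
    obtain ⟨e, _, rfl, y, -, he⟩ : (G.cut {x}).Nonempty :=
      Set.nonempty_of_ncard_ne_zero (by omega)
    exact hx' e he.inc_left
  have hc : 0 < G.numComponents := by
    have : Finite G.vertexSet := hV
    obtain ⟨x, hx⟩ := hG.1
    have : Nonempty (Quot fun x y : G.vertexSet => G.Adj x y) := ⟨Quot.mk _ ⟨x, hx⟩⟩
    exact Nat.card_pos
  rw [HasGenus, numFaces, hiso, Set.ncard_empty, add_zero] at h
  change (G.vertexSet.ncard : ℤ) - G.edgeSet.ncard + _ = _ at h
  rw [Nat.card_coe_set_eq, Nat.card_coe_set_eq]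
  change _ ≤ _ + ((Nat.card (Quotient (Equiv.Perm.SameCycle.setoid R.facePerm)) : ℕ) : ℤ)
  omega

/-- The algorithm finds thin spanning trees. -/
theorem isThin_of_step (hV : G.vertexSet.Finite) (hE : G.edgeSet.Finite) {lab : G.vertexSet → ℕ}
    (hlab : Function.Injective lab) {S : ℕ → Contraction G.vertexSet G.edgeSet}
    (h0 : S 0 = Contraction.init R.toMap lab)
    (hstep : ∀ i < Nat.card G.edgeSet, Contraction.Step R.toMap (S i) (S (i + 1))) {k γ : ℕ}
    (hk : 0 < k) (hG : G.IsEdgeConnected k) (hγ : R.GenusLE γ) :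
    G.IsSpanningTree (Subtype.val '' (S (Nat.card G.edgeSet)).sel) ∧
      G.IsThin (((10 + 25 * Nat.sqrt γ : ℕ) : ℝ) / k)
        (Subtype.val '' (S (Nat.card G.edgeSet)).sel) := by
  have : Finite G.vertexSet := hV
  have : Finite G.edgeSet := hE
  have : Nonempty G.vertexSet := hG.1.to_subtype
  have hG1 : G.IsEdgeConnected 1 := ⟨hG.1, fun U h1 h2 h3 => hk.trans_le (hG.2 U h1 h2 h3)⟩
  obtain ⟨h1, h2, h3⟩ := Contraction.isThin_of_step hlab h0 hstep hk
    (R.isEdgeConnected_toMap hG) (R.euler_le hV hG1 hγ)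
  exact ⟨R.isSpanningTree hG.1 h1 h2, R.isThin hk h3⟩

end RotationSystem

theorem exists_thin_spanningTree {α : Type u} {β : Type v} {G : Graph α β}
    (hV : G.vertexSet.Finite) (hE : G.edgeSet.Finite) {γ k : ℕ} (hk : 0 < k)
    (hγ : G.IsEmbeddable γ) (hG : G.IsEdgeConnected k) :
    ∃ T : Set β, G.IsSpanningTree T ∧ G.IsThin (((10 + 25 * Nat.sqrt γ : ℕ) : ℝ) / k) T := by
  obtain ⟨R, hR⟩ := hγ
  have : Finite G.vertexSet := hV
  obtain ⟨lab, hlab⟩ := exists_injective_nat G.vertexSet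
  obtain ⟨S, h0, hS⟩ := Contraction.exists_steps R.toMap (Contraction.init R.toMap lab)
  exact ⟨_, R.isThin_of_step hV hE hlab h0 (fun i _ => hS i) hk hG hR⟩

end Graph

/-! ### The algorithm on codes of embedded graphs -/

namespace EmbeddedGraph

open OrientedMap

variable (M : EmbeddedGraph)

/-- The numbers in the table for the edge `i`. -/
def row (i : Fin M.numEdges) : List ℕ :=
  [(M.rotation.tail (M.halfEdge i false)).1,
    2 * (M.rotation.rot (M.halfEdge i false)).1.1 + (M.rotation.rot (M.halfEdge i false)).2.toNat,
    (M.rotation.tail (M.halfEdge i true)).1,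
    2 * (M.rotation.rot (M.halfEdge i true)).1.1 + (M.rotation.rot (M.halfEdge i true)).2.toNat]

/-- The numbers that describe an embedded graph. -/
def table : List ℕ :=
  M.numVerts :: M.numEdges :: (List.finRange M.numEdges).flatMap M.row

theorem encode_eq : M.encode = M.table.flatMap encodeNumber := by
  simp [encode, table, row, encodeHalfEdge, List.flatMap_assoc]

/-- The edges are numbered. -/
def edgeEquiv : M.graph.edgeSet ≃ Fin M.numEdges :=
  (Equiv.setCongr M.edgeSet_eq).trans (Equiv.Set.univ _)

theorem length_le_flatMap_encodeNumber (l : List ℕ) :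
    l.length ≤ (l.flatMap encodeNumber).length := by
  induction l with
  | nil => simp
  | cons a l ih => simp [encodeNumber] at *; omega

theorem _root_.List.getElem?_flatMap_of_length {γ : Type*} (l : List γ) (f : γ → List ℕ) {c : ℕ}
    (hf : ∀ a, (f a).length = c) (i j : ℕ) (hi : i < l.length) (hj : j < c) :
    (l.flatMap f)[c * i + j]? = (f l[i])[j]? := by
  induction l generalizing i with
  | nil => simp at hi
  | cons a l ih =>
    rw [List.flatMap_cons]
    rcases i with _ | i
    · rw [mul_zero, zero_add, List.getElem?_append_left (by rw [hf]; exact hj)]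
      rfl
    · rw [List.getElem?_append_right (by rw [hf, mul_add]; omega), hf,
        show c * (i + 1) + j - c = c * i + j by rw [mul_add]; omega]
      exact ih i (by simpa using hi)

theorem table_getD (i : Fin M.numEdges) {j : ℕ} (hj : j < 4) :
    M.table.getD (2 + (4 * i + j)) 0 = (M.row i).getD j 0 := by
  rw [table, List.getD_eq_getElem?_getD, add_comm 2, List.getElem?_cons_succ,
    List.getElem?_cons_succ, List.getElem?_flatMap_of_length (c := 4) _ _ (fun _ => rfl) _ _
      (by simp) hj, List.getD_eq_getElem?_getD]
  simp

theorem length_table : M.table.length = 4 * M.numEdges + 2 := by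
  simp [table, row, List.length_flatMap, mul_comm]

/-- The output of the algorithm. -/
def thinTree : List Bool :=
  (ArrayProg.eval ThinTree.main (ArrayProg.initState .N .one .inp M.table)).out

/-- The labels are the numbers of the vertices in the code, and the contents of the memory trace out
a sequence of steps, to which `isThin_of_step` applies. -/
theorem exists_steps_thinTree :
    ∃ (lab : M.graph.vertexSet → ℕ) (S : ℕ → Contraction M.graph.vertexSet M.graph.edgeSet),
      Function.Injective lab ∧ S 0 = Contraction.init M.rotation.toMap lab ∧
      (∀ i < Nat.card M.graph.edgeSet, Contraction.Step M.rotation.toMap (S i) (S (i + 1))) ∧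
      M.selectedEdges M.thinTree = Subtype.val '' (S (Nat.card M.graph.edgeSet)).sel := by
  have hinj : Function.Injective fun v : M.graph.vertexSet => (v.1 : ℕ) :=
    Fin.val_injective.comp Subtype.val_injective
  obtain ⟨S, h0, hstep, hS⟩ := ThinTree.main_spec M.rotation.toMap M.edgeEquiv hinj (l := M.table)
    rfl (by
      rintro ⟨e, b⟩
      have h : 2 + 2 * ThinTree.code M.edgeEquiv (e, b) = 2 + (4 * (e.1 : ℕ) + 2 * b.toNat) := by
        change 2 + 2 * (2 * (e.1 : ℕ) + b.toNat) = _
        ring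
      rw [h, M.table_getD _ (by cases b <;> simp)]
      cases b <;> rfl) (by
      rintro ⟨e, b⟩
      have h : 3 + 2 * ThinTree.code M.edgeEquiv (e, b) =
          2 + (4 * (e.1 : ℕ) + (2 * b.toNat + 1)) := by
        change 3 + 2 * (2 * (e.1 : ℕ) + b.toNat) = _
        ring
      rw [h, M.table_getD _ (by cases b <;> simp)]
      cases b <;> rfl)
    (by rw [← M.length_table]; exact length_le_flatMap_encodeNumber _)
  refine ⟨_, S, hinj, h0, hstep, ?_⟩
  ext i
  have hi : i ∈ M.graph.edgeSet := M.edgeSet_eq ▸ Set.mem_univ i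
  refine (hS ⟨i, hi⟩).trans ⟨fun h => ⟨_, h, rfl⟩, ?_⟩
  rintro ⟨e, he, rfl⟩
  exact he

end EmbeddedGraph

/-! ### Growth of the bound, and the theorem -/

theorem sqrt_isBigO : (fun γ : ℕ => ((10 + 25 * Nat.sqrt γ : ℕ) : ℝ)) =O[atTop]
    fun γ : ℕ => Real.sqrt γ * Real.log γ := by
  -- Here 35 = 10 + 25, since both `√γ` and `log γ` are at least 1 for `γ ≥ 3`. The logarithm is not
  -- needed otherwise.
  refine IsBigO.of_bound 35 ?_
  filter_upwards [eventually_ge_atTop 3] with γ hγ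
  have hγ' : (3 : ℝ) ≤ γ := by exact_mod_cast hγ
  have h1 : 1 ≤ Real.sqrt γ := Real.one_le_sqrt.2 (by linarith)
  have h2 : 1 ≤ Real.log γ := by
    rw [Real.le_log_iff_exp_le (by linarith)]
    linarith [Real.exp_one_lt_d9]
  have h3 : (Nat.sqrt γ : ℝ) ≤ Real.sqrt γ := Real.nat_sqrt_le_real_sqrt
  have h4 : Real.sqrt γ ≤ Real.sqrt γ * Real.log γ := le_mul_of_one_le_right (by linarith) h2
  rw [Real.norm_of_nonneg (by positivity), Real.norm_of_nonneg (by linarith)]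
  push_cast
  linarith

theorem theorem4p1 :
    ∃ f : ℕ → ℝ,
      (f =O[atTop] fun γ : ℕ => Real.sqrt γ * Real.log γ) ∧
      f 0 = 10 ∧
      -- thin spanning trees exist
      (∀ (α : Type u) (β : Type v) (G : Graph α β), G.vertexSet.Finite → G.edgeSet.Finite →
        ∀ γ k : ℕ, 0 < k → G.IsEmbeddable γ → G.IsEdgeConnected k →
          ∃ T : Set β, G.IsSpanningTree T ∧ G.IsThin (f γ / k) T) ∧
      -- they are found in polynomial time, given an embedding
      (∃ A : EmbeddedGraph → List Bool,
        Nonempty (Turing.TM2ComputableInPolyTime EmbeddedGraph.encode id A) ∧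
        ∀ (M : EmbeddedGraph) (γ k : ℕ), 0 < k → M.rotation.GenusLE γ →
          M.graph.IsEdgeConnected k →
            M.graph.IsSpanningTree (M.selectedEdges (A M)) ∧
            M.graph.IsThin (f γ / k) (M.selectedEdges (A M))) ∧
      -- the thin-tree conjecture for graphs of bounded orientable genus
      (∀ γ : ℕ, ∃ h : ℝ → ℕ, ∀ ε : ℝ, 0 < ε →
        ∀ (α : Type u) (β : Type v) (G : Graph α β), G.vertexSet.Finite → G.edgeSet.Finite →
          G.IsEmbeddable γ → G.IsEdgeConnected (h ε) →
            ∃ T : Set β, G.IsSpanningTree T ∧ G.IsThin ε T) := by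
  refine ⟨fun γ => ((10 + 25 * Nat.sqrt γ : ℕ) : ℝ), sqrt_isBigO, by simp,
    fun α β G hV hE γ k hk hγ hG => Graph.exists_thin_spanningTree hV hE hk hγ hG,
    ⟨EmbeddedGraph.thinTree, ?_, fun M γ k hk hγ hG => ?_⟩, fun γ => ?_⟩
  · exact ArrayProg.nonempty_computableInPolyTime _ EmbeddedGraph.table EmbeddedGraph.encode_eq
      ThinTree.main (by simp) _
  · obtain ⟨lab, S, hlab, h0, hstep, hS⟩ := M.exists_steps_thinTree
    rw [hS]
    exact M.rotation.isThin_of_step (Set.toFinite _) (Set.toFinite _) hlab h0 hstep hk hG hγ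
  -- Any connectivity of at least `f γ / ε` suffices; adding 1 makes it positive.
  · refine ⟨fun ε => ⌈((10 + 25 * Nat.sqrt γ : ℕ) : ℝ) / ε⌉₊ + 1,
      fun ε hε α β G hV hE hγ hG => ?_⟩
    obtain ⟨T, hT, hthin⟩ := Graph.exists_thin_spanningTree hV hE (Nat.succ_pos _) hγ hG
    refine ⟨T, hT, fun U hU => (hthin U hU).trans ?_⟩
    refine mul_le_mul_of_nonneg_right ?_ (Nat.cast_nonneg _)
    rw [div_le_iff₀ (by positivity), ← div_le_iff₀' hε]
    push_cast
    exact (Nat.le_ceil _).trans (le_add_of_nonneg_right zero_le_one)
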